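/- Let $X=(Y,A,Z)\in\mathbb R\times\{0,1\}\times\mathbb R^d$ have law $P_0$, let $X_1,X_2,\dots$ be i.i.d. from $P_0$, write $Pf=\int f\,dP$, and let $\mathbb P_n$ and $Q_n$ be the empirical distributions of $X_1,\dots,X_n$ and of $Z_1,\dots,Z_n$. Put $\pi_0=P_0(A=1)$, $g_0(z)=P_0(A=1\mid Z=z)$, $\mu_0(z)=E_0(Y\mid A=0,Z=z)$, and let the parameter of interest be the G-computed conditional mean $\psi_0=E_0[\mu_0(Z)\mid A=1]$. For functions $\mu,g$ of $z$ and numbers $\pi,\psi$ put $$\phi_{\psi,\mu,g,\pi}(y,a,z)=\frac{I(a=0)\,g(z)}{\pi[1-g(z)]}[y-\mu(z)]+\frac{I(a=1)}{\pi}[\mu(z)-\psi],\qquad \phi_0=\phi_{\psi_0,\mu_0,g_0,\pi_0}.$$ Let $\mu_n$ and $g_n$ be estimators of $\mu_0$ and $g_0$ (random measurable functions of $z$), and put $\pi_n=\int g_n\,dQ_n$, $\bar\pi_n=\frac1n\sum_{i=1}^n A_i$ and $\phi_{\psi,n}=\phi_{\psi,\mu_n,g_n,\pi_n}$. All probability limits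 below are in outer probability; "with probability tending to one" means that the outer probability of the complement tends to zero. A class of functions is $P_0$-Donsker if it consists of measurable, $P_0$-square-integrable functions and its empirical process $f\mapsto n^{1/2}(\mathbb P_n-P_0)f$ (with almost surely bounded paths) converges weakly, in the sense of outer expectations, in the space of bounded functions on the class to a tight Borel limit. An estimator $T_n$ of $\psi_0$ is asymptotically linear with influence function $\phi_0$ if $P_0\phi_0=0$, $P_0\phi_0^2<\infty$ and $T_n=\psi_0+\mathbb P_n\phi_0+o_{P_0^*}(n^{-1/2})$. Assume that 1. each of $\mu_n$, $g_n$ and $(y,a,z)\mapsto(1-a)\,y\,g_n(z)/[1-g_n(z)]$, as a function of $(y,a,z)$, falls in some $P_0$-Donsker class with probability tending to one; 2. $E_0(Y^2)<\infty$; 3. there are constants $0<a<b<1$ and $M\in\mathbb R$ such that $P_0(g_0(Z)\in(a,b))=1$ and, for every $n$, almost surely: $g_n(z)\in(a,b)$ and $|\mu_n(z)|\le M$ for almost every $z$ under the law of $Z$, and also for $z=Z_1,\dots,Z_n$; 4. $\|g_n-g_0\|_{L_2(P_0)}=o_{P_0^*}(1)$ and $\|\mu_n-\mu_0\|_{L_2(P_0)}=o_{P_0^*}(1)$;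 5. $P_0\{(g_n-g_0)(\mu_n-\mu_0)/(1-g_n)\}=o_{P_0^*}(n^{-1/2})$. Then the following hold. (i) The estimating equations-based estimator, i.e. the root $\psi$ of $\mathbb P_n\phi_{\psi,n}=0$, $$\psi_{n,2}=\frac1n\sum_{i=1}^n\left\{\frac{I(A_i=0)\,g_n(Z_i)}{\bar\pi_n[1-g_n(Z_i)]}[Y_i-\mu_n(Z_i)]+\frac{I(A_i=1)}{\bar\pi_n}\mu_n(Z_i)\right\},$$ is asymptotically linear with influence function $\phi_0$. (ii) Let $\psi_n=\int\mu_n g_n\pi_n^{-1}\,dQ_n$. If in addition $(\pi_n-\pi_0)(\psi_n-\psi_0)=o_{P_0^*}(n^{-1/2})$, then the one-step estimator $\psi_n+\mathbb P_n\phi_{\psi_n,n}$ is asymptotically linear with influence function $\phi_0$. (iii) Let instead $\psi_n=\frac1n\sum_{i=1}^n I(A_i=1)\mu_n(Z_i)/\pi_n$. If in addition $(\pi_n-\pi_0)(\psi_n-\psi_0)=o_{P_0^*}(n^{-1/2})$, then the one-step estimator $\psi_n+\mathbb P_n\phi_{\psi_n,n}$, which for this $\psi_n$ equals $$\frac1n\sum_{i=1}^n\left\{\frac{I(A_i=0)\,g_n(Z_i)}{\pi_n[1-g_n(Z_i)]}[Y_i-\mu_n(Z_i)]+\left[2-\frac{\bar\pi_n}{\pi_n}\right]\frac{I(A_i=1)}{\pi_n}\mu_n(Z_i)\right\},$$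 is asymptotically linear with influence function $\phi_0$. -/

import Mathlib

open MeasureTheory ProbabilityTheory Filter Topology
open scoped ENNReal

noncomputable section

namespace GComp

/-! ### Outer expectation, outer probability, weak convergence, Donsker classes -/

/-- Outer expectation `E^* f` of a bounded, possibly non-measurable function: the infimum of `E U`
over the integrable measurable `U` with `U ≥ f` almost surely. -/
def outerExp {Ω : Type*} [MeasurableSpace Ω] (P : Measure Ω) (f : Ω → ℝ) : ℝ :=
  sInf {c : ℝ | ∃ U : Ω → ℝ, Measurable U ∧ Integrable U P ∧ (∀ᵐ ω ∂P, f ω ≤ U ω) ∧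
    c = ∫ ω, U ω ∂P}

/-- `G n ⇝ L`: the outer expectation of `h (G n)` tends to `∫ h dL` for every bounded continuous
`h`; the maps `G n` may be non-measurable, `L` is the (Borel) law of the limit. -/
def WeakConvOuter {Ω D : Type*} [MeasurableSpace Ω] [TopologicalSpace D] {mD : MeasurableSpace D}
    (P : Measure Ω) (G : ℕ → Ω → D) (L : Measure D) : Prop :=
  ∀ h : BoundedContinuousFunction D ℝ,
    Tendsto (fun n => outerExp P (fun ω => h (G n ω))) atTop (𝓝 (∫ z, h z ∂L))

/-- The Banach space `ℓ^∞(F)` of bounded real functions on the class `F`, with supremum norm. -/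
abbrev Linf {S : Type*} (F : Set (S → ℝ)) : Type _ := lp (fun _ : F => ℝ) ∞

open Classical in
/-- A function on `F` as an element of `ℓ^∞(F)` (and `0` if it is unbounded). -/
def toLinf {S : Type*} (F : Set (S → ℝ)) (z : F → ℝ) : Linf F :=
  if h : Memℓp z ∞ then ⟨z, h⟩ else 0

/-- The empirical mean `ℙ_n f` over the first `n` observations of the sequence `s`. -/
def empMean {S : Type*} (s : ℕ → S) (n : ℕ) (f : S → ℝ) : ℝ :=
  (∑ i ∈ Finset.range n, f (s i)) / n

/-- The empirical process `𝔾_n f = n^{1/2} (ℙ_n - P) f`. -/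
def empProc {S : Type*} [MeasurableSpace S] (P : Measure S) (s : ℕ → S) (n : ℕ) (f : S → ℝ) : ℝ :=
  √(n : ℝ) * (empMean s n f - ∫ x, f x ∂P)

/-- `F` is a `P`-Donsker class: its members are measurable and square integrable, the sample paths
`f ↦ 𝔾_n f` are almost surely bounded on `F`, and, on the product space `(S^∞, P^∞)`, `𝔾_n`
converges weakly in `ℓ^∞(F)` to a tight Borel limit. -/
def IsDonsker {S : Type*} [MeasurableSpace S] (P : Measure S) [IsProbabilityMeasure P]
    (F : Set (S → ℝ)) : Prop :=
  (∀ f ∈ F, Measurable f ∧ MemLp f 2 P) ∧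
  (∀ n : ℕ, ∀ᵐ s ∂(Measure.infinitePi fun _ : ℕ => P),
    Memℓp (fun f : F => empProc P s n (f : S → ℝ)) ∞) ∧
  ∃ L : @Measure (Linf F) (borel (Linf F)), L Set.univ = 1 ∧ IsTightMeasureSet {L} ∧
    WeakConvOuter (Measure.infinitePi fun _ : ℕ => P)
      (fun n s => toLinf F fun f : F => empProc P s n (f : S → ℝ)) L

/-- `N n = o_{P^*}(1)` for a sequence of non-negative maps, in outer probability (a measure of
Mathlib, applied to a non-measurable set, is the outer measure). -/
def OuterLittleOOne {Ω : Type*} [MeasurableSpace Ω] (P : Measure Ω) (N : ℕ → Ω → ℝ≥0∞) : Prop :=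
  ∀ ε : ℝ≥0∞, 0 < ε → Tendsto (fun n => P {ω | ε ≤ N n ω}) atTop (𝓝 0)

/-- `R n = o_{P^*}(n^{-1/2})`. -/
def OuterLittleORootN {Ω : Type*} [MeasurableSpace Ω] (P : Measure Ω) (R : ℕ → Ω → ℝ) : Prop :=
  OuterLittleOOne P fun n ω => ENNReal.ofReal (√(n : ℝ) * |R n ω|)

/-- The events `E n` hold with probability tending to one: the outer probability of the complement
of `E n` tends to zero. -/
def WithProbTendstoOne {Ω : Type*} [MeasurableSpace Ω] (P : Measure Ω) (E : ℕ → Set Ω) : Prop :=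
  Tendsto (fun n => P (E n)ᶜ) atTop (𝓝 0)

/-- The estimator `T n` of `θ`, based on the observations `X 0, X 1, …` with law `P₀`, is
asymptotically linear with influence function `φ`:
`P₀ φ = 0`, `P₀ φ² < ∞` and `T n = θ + ℙ_n φ + o_{P^*}(n^{-1/2})`. -/
def AsympLinear {Ω S : Type*} [MeasurableSpace Ω] [MeasurableSpace S] (P : Measure Ω)
    (P₀ : Measure S) (X : ℕ → Ω → S) (T : ℕ → Ω → ℝ) (θ : ℝ) (φ : S → ℝ) : Prop :=
  MemLp φ 2 P₀ ∧ ∫ x, φ x ∂P₀ = 0 ∧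
    OuterLittleORootN P fun n ω => T n ω - (θ + empMean (fun i => X i ω) n φ)

/-! ### The G-computed conditional mean -/

/-- An observation `(Y, A, Z)`: outcome, treatment indicator (`true` for `A = 1`), covariates. -/
abbrev Obs (d : ℕ) : Type := ℝ × Bool × (Fin d → ℝ)

/-- `I(a = 1)`. -/
def treated {d : ℕ} (x : Obs d) : ℝ := if x.2.1 = true then 1 else 0

/-- `I(a = 0)`. -/
def control {d : ℕ} (x : Obs d) : ℝ := if x.2.1 = true then 0 else 1

/-- The propensity score `g_P(z) = P(A = 1 ∣ Z = z)`. -/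
def propensity {d : ℕ} (P : Measure (Obs d)) [IsFiniteMeasure P] (z : Fin d → ℝ) : ℝ :=
  (condDistrib (fun x : Obs d => x.2.1) (fun x : Obs d => x.2.2) P z).real {true}

/-- The outcome regression `μ_P(z) = E_P(Y ∣ A = 0, Z = z)`. -/
def outcomeReg {d : ℕ} (P : Measure (Obs d)) [IsFiniteMeasure P] (z : Fin d → ℝ) : ℝ :=
  ∫ y, y ∂(condDistrib (fun x : Obs d => x.1) (fun x : Obs d => x.2) P (false, z))

/-- `π_P = P(A = 1)`. -/
def treatProb {d : ℕ} (P : Measure (Obs d)) : ℝ := P.real {x | x.2.1 = true}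

/-- The G-computed conditional mean `ψ(P) = E_P[μ_P(Z) ∣ A = 1]`. -/
def gMean {d : ℕ} (P : Measure (Obs d)) [IsFiniteMeasure P] : ℝ :=
  ∫ x, outcomeReg P x.2.2 ∂(P[|{x : Obs d | x.2.1 = true}])

/-- The function `φ_{ψ,η}` for `η` given by `μ`, `g` and `π`:
`(y,a,z) ↦ I(a=0) g(z) / (π [1 - g(z)]) [y - μ(z)] + I(a=1) / π [μ(z) - ψ]`. -/
def infl {d : ℕ} (μ g : (Fin d → ℝ) → ℝ) (π ψ : ℝ) (x : Obs d) : ℝ :=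
  control x * g x.2.2 / (π * (1 - g x.2.2)) * (x.1 - μ x.2.2) + treated x / π * (μ x.2.2 - ψ)

/-- The influence function `φ_P` of the G-computed conditional mean. -/
def inflAt {d : ℕ} (P : Measure (Obs d)) [IsFiniteMeasure P] : Obs d → ℝ :=
  infl (outcomeReg P) (propensity P) (treatProb P) (gMean P)

/-- The weighted outcome map `(y,a,z) ↦ (1 - a) y g(z) / [1 - g(z)]`. -/
def weightedOutcome {d : ℕ} (g : (Fin d → ℝ) → ℝ) (x : Obs d) : ℝ :=
  control x * x.1 * g x.2.2 / (1 - g x.2.2)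

/-- `π_n = ∫ g dQ_n`, with `Q_n` the empirical distribution of the covariates. -/
def piHat {d : ℕ} (g : (Fin d → ℝ) → ℝ) (s : ℕ → Obs d) (n : ℕ) : ℝ :=
  empMean s n fun x => g x.2.2

/-- The proportion `\bar π_n` of treated observations. -/
def piBar {d : ℕ} (s : ℕ → Obs d) (n : ℕ) : ℝ := empMean s n treated

/-- The plug-in estimator `ψ(η_n) = ∫ μ g π_n⁻¹ dQ_n`. -/
def plugIn {d : ℕ} (μ g : (Fin d → ℝ) → ℝ) (s : ℕ → Obs d) (n : ℕ) : ℝ :=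
  empMean s n fun x => μ x.2.2 * g x.2.2 * (piHat g s n)⁻¹

/-- The one-step estimator `ψ(η_n) + ℙ_n φ_{η_n}`. -/
def oneStep {d : ℕ} (μ g : (Fin d → ℝ) → ℝ) (s : ℕ → Obs d) (n : ℕ) : ℝ :=
  plugIn μ g s n + empMean s n (infl μ g (piHat g s n) (plugIn μ g s n))

/-- The variant `n⁻¹ ∑ I(A_i = 1) μ(Z_i) / π_n` of the plug-in estimator. -/
def plugInTreated {d : ℕ} (μ g : (Fin d → ℝ) → ℝ) (s : ℕ → Obs d) (n : ℕ) : ℝ :=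
  empMean s n fun x => treated x / piHat g s n * μ x.2.2

/-- The one-step estimator in closed form, with `2 - \bar π_n / π_n` as the weight of the second
term; it is the one-step correction of `plugInTreated`, see `oneStepTreated_eq`. -/
def oneStepTreated {d : ℕ} (μ g : (Fin d → ℝ) → ℝ) (s : ℕ → Obs d) (n : ℕ) : ℝ :=
  empMean s n fun x =>
    control x * g x.2.2 / (piHat g s n * (1 - g x.2.2)) * (x.1 - μ x.2.2) +
      (2 - piBar s n / piHat g s n) * (treated x / piHat g s n) * μ x.2.2

/-- The estimating equations-based estimator, the root `ψ` of `ℙ_n φ_{ψ,η_n} = 0`, in closed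
form; see `estEq_iff`. -/
def estEq {d : ℕ} (μ g : (Fin d → ℝ) → ℝ) (s : ℕ → Obs d) (n : ℕ) : ℝ :=
  empMean s n fun x =>
    control x * g x.2.2 / (piBar s n * (1 - g x.2.2)) * (x.1 - μ x.2.2) +
      treated x / piBar s n * μ x.2.2

theorem empMean_add {S : Type*} (s : ℕ → S) (n : ℕ) (f h : S → ℝ) :
    empMean s n (fun x => f x + h x) = empMean s n f + empMean s n h := by
  simp [empMean, Finset.sum_add_distrib, add_div]

theorem empMean_mul {S : Type*} (s : ℕ → S) (n : ℕ) (c : ℝ) (f : S → ℝ) :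
    empMean s n (fun x => c * f x) = c * empMean s n f := by
  simp [empMean, ← Finset.mul_sum, mul_div_assoc]

theorem empMean_infl {d : ℕ} (μ g : (Fin d → ℝ) → ℝ) (π ψ : ℝ) (s : ℕ → Obs d) (n : ℕ) :
    empMean s n (infl μ g π ψ) =
      π⁻¹ * empMean s n (fun x => control x * g x.2.2 / (1 - g x.2.2) * (x.1 - μ x.2.2)) +
        π⁻¹ * empMean s n (fun x => treated x * μ x.2.2) + (-(ψ * π⁻¹)) * piBar s n := by
  rw [piBar, ← empMean_mul, ← empMean_mul, ← empMean_mul, ← empMean_add, ← empMean_add]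
  congr 1
  funext x
  simp only [infl, div_eq_mul_inv, mul_inv]
  ring

/-- The closed-form one-step estimator is `ψ̃ + ℙ_n φ_{ψ̃,η_n}` for `ψ̃ = plugInTreated`. -/
theorem oneStepTreated_eq {d : ℕ} (μ g : (Fin d → ℝ) → ℝ) (s : ℕ → Obs d) (n : ℕ) :
    oneStepTreated μ g s n = plugInTreated μ g s n +
      empMean s n (infl μ g (piHat g s n) (plugInTreated μ g s n)) := by
  have h : plugInTreated μ g s n =
      (piHat g s n)⁻¹ * empMean s n (fun x => treated x * μ x.2.2) := by
    rw [plugInTreated, ← empMean_mul]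
    congr 1
    funext x
    simp only [div_eq_mul_inv]
    ring
  have h2 : oneStepTreated μ g s n = (piHat g s n)⁻¹ *
      empMean s n (fun x => control x * g x.2.2 / (1 - g x.2.2) * (x.1 - μ x.2.2)) +
      ((2 - piBar s n / piHat g s n) * (piHat g s n)⁻¹) *
        empMean s n (fun x => treated x * μ x.2.2) := by
    rw [← empMean_mul, ← empMean_mul, ← empMean_add, oneStepTreated]
    congr 1
    funext x
    simp only [div_eq_mul_inv, mul_inv]
    ring
  rw [empMean_infl, h2, h]
  simp only [div_eq_mul_inv]
  ring

/-- `estEq` is the unique root of the sample estimating function `ψ ↦ ℙ_n φ_{ψ,η_n}`. -/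
theorem estEq_iff {d : ℕ} (μ g : (Fin d → ℝ) → ℝ) (s : ℕ → Obs d) (n : ℕ)
    (hπ : piHat g s n ≠ 0) (hbar : piBar s n ≠ 0) (ψ : ℝ) :
    empMean s n (infl μ g (piHat g s n) ψ) = 0 ↔ ψ = estEq μ g s n := by
  have h2 : estEq μ g s n = (piBar s n)⁻¹ *
      empMean s n (fun x => control x * g x.2.2 / (1 - g x.2.2) * (x.1 - μ x.2.2)) +
      (piBar s n)⁻¹ * empMean s n (fun x => treated x * μ x.2.2) := by
    rw [← empMean_mul, ← empMean_mul, ← empMean_add, estEq]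
    congr 1
    funext x
    simp only [div_eq_mul_inv, mul_inv]
    ring
  rw [empMean_infl, h2]
  field_simp
  constructor <;> intro h <;> linarith

end GComp

end

open GComp

/-!
Multiplying the score by `π` turns it into the estimating function
`I(a = 0) g / (1 - g) (y - μ) + I(a = 1) μ`, whose mean at `(μ_n, g_n)` differs from its mean at
the truth exactly by the product of errors whose rate is assumed. So everything rests on the
empirical process of the difference between the estimated and the true estimating function being
`o(1)`; the rest is the algebra of normalizing by `π̄_n` or `π_n`.

That difference is small in `L₂(P₀)`, but it involves products of members of Donsker classes. A
Donsker class is stochastically equicontinuous at differences: a tight limit has a finite net, and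
weak convergence transports it to the empirical process. Stochastic equicontinuity is stable under
sums and Lipschitz transformations, hence under bounded products. For the Lipschitz
transformations: symmetrize, condition on the sample, apply the Ledoux–Talagrand contraction to the
Rademacher sums, and return to the empirical process by splitting the sample according to balanced
signs. No envelope is assumed, so means of suprema need not exist; a Kahane-type inequality lets
the contraction work with quantiles instead.
-/

namespace GComp

/-! ### Rademacher sums -/

/-- The sign `±1` attached to a Boolean, so that vectors of signs are maps `ι → Bool`. -/
def sgn (b : Bool) : ℝ := if b then 1 else -1

theorem sgn_not (b : Bool) : sgn (!b) = -sgn b := by cases b <;> simp [sgn]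

theorem abs_sgn (b : Bool) : |sgn b| = 1 := by cases b <;> simp [sgn]

theorem sgn_sq (b : Bool) : sgn b ^ 2 = 1 := by cases b <;> simp [sgn]

section Flip

variable {ι : Type*} [DecidableEq ι]

/-- The vector of signs `ε` with its `i`-th sign reversed. -/
def flipAt (i : ι) (ε : ι → Bool) : ι → Bool := Function.update ε i (!ε i)

theorem flipAt_flipAt (i : ι) (ε : ι → Bool) : flipAt i (flipAt i ε) = ε := by simp [flipAt]

theorem flipAt_comm (i j : ι) (ε : ι → Bool) : flipAt i (flipAt j ε) = flipAt j (flipAt i ε) := by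
  rcases eq_or_ne i j with rfl | hij
  · rfl
  · simp [flipAt, hij, hij.symm, Function.update_comm hij]

theorem sgn_flipAt_self (i : ι) (ε : ι → Bool) : sgn (flipAt i ε i) = -sgn (ε i) := by
  simp [flipAt, sgn_not]

theorem sum_sgn_flipAt_of_notMem {i : ι} {J : Finset ι} (hi : i ∉ J) (ε : ι → Bool) (u : ι → ℝ) :
    ∑ j ∈ J, sgn (flipAt i ε j) * u j = ∑ j ∈ J, sgn (ε j) * u j :=
  Finset.sum_congr rfl fun j hj => by simp [flipAt, ne_of_mem_of_not_mem hj hi]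

end Flip

section SignLaw

variable {ι : Type*}

variable (ι) in
/-- The law of a vector of independent fair signs: the uniform law on the cube. -/
noncomputable def signLaw : Measure (ι → Bool) := uniformOn Set.univ

variable [Finite ι]

instance : IsProbabilityMeasure (signLaw ι) :=
  inferInstanceAs (IsProbabilityMeasure (uniformOn Set.univ))

theorem measurePreserving_signLaw (e : Equiv.Perm (ι → Bool)) :
    MeasurePreserving e (signLaw ι) (signLaw ι) := by
  have := Fintype.ofFinite (ι → Bool)
  refine ⟨.of_discrete, Measure.ext fun s hs => ?_⟩
  rw [Measure.map_apply .of_discrete hs, ← Equiv.image_symm_eq_preimage, signLaw, uniformOn_univ,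
    uniformOn_univ, Measure.count_injective_image e.symm.injective]

theorem integral_signLaw_comp (e : Equiv.Perm (ι → Bool)) (f : (ι → Bool) → ℝ) :
    ∫ ε, f (e ε) ∂signLaw ι = ∫ ε, f ε ∂signLaw ι :=
  (measurePreserving_signLaw e).integral_comp
    (MeasurableEquiv.mk e .of_discrete .of_discrete).measurableEmbedding f

theorem integral_comp_not (f : (ι → Bool) → ℝ) :
    ∫ ε, f (fun i => !ε i) ∂signLaw ι = ∫ ε, f ε ∂signLaw ι := by
  have hinv : Function.Involutive fun (ε : ι → Bool) (i : ι) => !ε i := fun ε => by simp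
  exact integral_signLaw_comp hinv.toPerm f

variable [DecidableEq ι]

theorem integral_comp_flipAt (i : ι) (f : (ι → Bool) → ℝ) :
    ∫ ε, f (flipAt i ε) ∂signLaw ι = ∫ ε, f ε ∂signLaw ι :=
  integral_signLaw_comp (Function.Involutive.toPerm (flipAt i) (flipAt_flipAt i)) f

theorem integral_eq_flipAt_average (i : ι) (f : (ι → Bool) → ℝ) :
    ∫ ε, f ε ∂signLaw ι = ∫ ε, (f ε + f (flipAt i ε)) / 2 ∂signLaw ι := by
  rw [integral_div, integral_add .of_finite .of_finite, integral_comp_flipAt, add_self_div_two]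

theorem integral_insert_sgn_sq {i : ι} {J : Finset ι} (hi : i ∉ J) (u : ι → ℝ) :
    ∫ ε, (∑ j ∈ insert i J, sgn (ε j) * u j) ^ 2 ∂signLaw ι =
      u i ^ 2 + ∫ ε, (∑ j ∈ J, sgn (ε j) * u j) ^ 2 ∂signLaw ι := by
  rw [integral_eq_flipAt_average i]
  simp only [Finset.sum_insert hi, sgn_flipAt_self, sum_sgn_flipAt_of_notMem hi]
  calc _ = ∫ ε, (u i ^ 2 + (∑ j ∈ J, sgn (ε j) * u j) ^ 2) ∂signLaw ι := by
        congr with ε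
        linear_combination u i ^ 2 * sgn_sq (ε i)
    _ = _ := by rw [integral_add .of_finite .of_finite, integral_const, probReal_univ, one_smul]

theorem integral_insert_sgn_pow_four {i : ι} {J : Finset ι} (hi : i ∉ J) (u : ι → ℝ) :
    ∫ ε, (∑ j ∈ insert i J, sgn (ε j) * u j) ^ 4 ∂signLaw ι =
      u i ^ 4 + 6 * u i ^ 2 * ∫ ε, (∑ j ∈ J, sgn (ε j) * u j) ^ 2 ∂signLaw ι +
        ∫ ε, (∑ j ∈ J, sgn (ε j) * u j) ^ 4 ∂signLaw ι := by
  rw [integral_eq_flipAt_average i]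
  simp only [Finset.sum_insert hi, sgn_flipAt_self, sum_sgn_flipAt_of_notMem hi]
  calc _ = ∫ ε, (u i ^ 4 + 6 * u i ^ 2 * (∑ j ∈ J, sgn (ε j) * u j) ^ 2 +
          (∑ j ∈ J, sgn (ε j) * u j) ^ 4) ∂signLaw ι := by
        congr with ε
        linear_combination (u i ^ 4 * (sgn (ε i) ^ 2 + 1) +
          6 * u i ^ 2 * (∑ j ∈ J, sgn (ε j) * u j) ^ 2) * sgn_sq (ε i)
    _ = _ := by
        rw [integral_add .of_finite .of_finite, integral_add .of_finite .of_finite, integral_const,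
          probReal_univ, one_smul, integral_const_mul]

omit [DecidableEq ι] in
theorem integral_sum_sgn_sq (J : Finset ι) (u : ι → ℝ) :
    ∫ ε, (∑ j ∈ J, sgn (ε j) * u j) ^ 2 ∂signLaw ι = ∑ j ∈ J, u j ^ 2 := by
  classical
  induction J using Finset.induction_on with
  | empty => simp
  | insert i J hi ih => rw [integral_insert_sgn_sq hi, ih, Finset.sum_insert hi]

omit [DecidableEq ι] in
theorem integral_sum_sgn_pow_four_le (J : Finset ι) (u : ι → ℝ) :
    ∫ ε, (∑ j ∈ J, sgn (ε j) * u j) ^ 4 ∂signLaw ι ≤ 3 * (∑ j ∈ J, u j ^ 2) ^ 2 := by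
  classical
  induction J using Finset.induction_on with
  | empty => simp
  | insert i J hi ih =>
    rw [integral_insert_sgn_pow_four hi, integral_sum_sgn_sq, Finset.sum_insert hi]
    nlinarith [sq_nonneg (u i ^ 2)]

end SignLaw

section EfronStein

variable {ι : Type*} [DecidableEq ι]

theorem eq_of_forall_flipAt_eq [Finite ι] {f : (ι → Bool) → ℝ} (hf : ∀ i ε, f (flipAt i ε) = f ε)
    (ε ε' : ι → Bool) : f ε = f ε' := by
  have := Fintype.ofFinite ι
  have hpiecewise (J : Finset ι) : f (J.piecewise ε ε') = f ε' := by
    induction J using Finset.induction_on with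
    | empty => simp
    | insert i J _ ih =>
      rw [Finset.piecewise_insert, ← ih]
      rcases eq_or_ne (ε i) (J.piecewise ε ε' i) with h | h
      · rw [h, Function.update_eq_self]
      · rw [Bool.eq_not_of_ne h]
        exact hf i _
  simpa using hpiecewise Finset.univ

variable [Finite ι]

theorem variance_eq_average_add (i : ι) (f : (ι → Bool) → ℝ) :
    Var[f; signLaw ι] = Var[fun ε => (f ε + f (flipAt i ε)) / 2; signLaw ι] +
      1 / 4 * ∫ ε, (f ε - f (flipAt i ε)) ^ 2 ∂signLaw ι := by
  rw [variance_eq_sub .of_discrete, variance_eq_sub .of_discrete, ← integral_eq_flipAt_average]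
  simp only [Pi.pow_apply]
  rw [integral_eq_flipAt_average i fun ε => f ε ^ 2, ← integral_const_mul, sub_add_eq_add_sub,
    ← integral_add .of_finite .of_finite]
  congr 2 with ε
  ring

theorem integral_sq_average_sub_le (i j : ι) (f : (ι → Bool) → ℝ) :
    ∫ ε, ((f ε + f (flipAt j ε)) / 2 -
      (f (flipAt i ε) + f (flipAt j (flipAt i ε))) / 2) ^ 2 ∂signLaw ι ≤
      ∫ ε, (f ε - f (flipAt i ε)) ^ 2 ∂signLaw ι := by
  rw [integral_eq_flipAt_average j fun ε => (f ε - f (flipAt i ε)) ^ 2]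
  refine integral_mono .of_finite .of_finite fun ε => ?_
  rw [flipAt_comm i j]
  dsimp only
  nlinarith [sq_nonneg (f ε - f (flipAt i ε) - (f (flipAt j ε) - f (flipAt j (flipAt i ε))))]

theorem variance_le_of_forall_notMem_flipAt_eq (J : Finset ι) (f : (ι → Bool) → ℝ)
    (hf : ∀ i ∉ J, ∀ ε, f (flipAt i ε) = f ε) :
    Var[f; signLaw ι] ≤ 1 / 4 * ∑ i ∈ J, ∫ ε, (f ε - f (flipAt i ε)) ^ 2 ∂signLaw ι := by
  induction J using Finset.induction_on generalizing f with
  | empty =>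
    have hconst : f = fun _ => f fun _ => true :=
      funext fun ε => eq_of_forall_flipAt_eq (fun i => hf i (Finset.notMem_empty i)) _ _
    rw [hconst, variance_eq_integral Measurable.of_discrete.aemeasurable]
    simp
  | insert j J hj ih =>
    have hinv : ∀ i ∉ J, ∀ ε, (f (flipAt i ε) + f (flipAt j (flipAt i ε))) / 2 =
        (f ε + f (flipAt j ε)) / 2 := by
      intro i hi ε
      rcases eq_or_ne i j with rfl | hij
      · rw [flipAt_flipAt, add_comm]
      · have hi' : i ∉ insert j J := by simp [hij, hi]
        rw [flipAt_comm, hf i hi', hf i hi']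
    have hsum : ∑ i ∈ J, ∫ ε, ((f ε + f (flipAt j ε)) / 2 -
        (f (flipAt i ε) + f (flipAt j (flipAt i ε))) / 2) ^ 2 ∂signLaw ι ≤
        ∑ i ∈ J, ∫ ε, (f ε - f (flipAt i ε)) ^ 2 ∂signLaw ι :=
      Finset.sum_le_sum fun i _ => integral_sq_average_sub_le i j f
    rw [variance_eq_average_add j, Finset.sum_insert hj]
    linarith [ih (fun ε => (f ε + f (flipAt j ε)) / 2) hinv]

end EfronStein

section Rademacher

variable {ι : Type*} [Fintype ι]

/-- The Rademacher sum `∑ ε_i u_i`. -/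
def rad (ε : ι → Bool) (u : ι → ℝ) : ℝ := ∑ i, sgn (ε i) * u i

theorem rad_zero (ε : ι → Bool) : rad ε 0 = 0 := by simp [rad]

theorem rad_not (ε : ι → Bool) (u : ι → ℝ) : rad (fun i => !ε i) u = -rad ε u := by
  simp [rad, sgn_not]

theorem rad_const_mul (ε : ι → Bool) (c : ℝ) (u : ι → ℝ) :
    rad ε (fun i => c * u i) = c * rad ε u := by
  simp only [rad, Finset.mul_sum, mul_left_comm]

theorem rad_eq_erase_add [DecidableEq ι] (i : ι) (ε : ι → Bool) (u : ι → ℝ) :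
    rad ε u = ∑ j ∈ Finset.univ.erase i, sgn (ε j) * u j + sgn (ε i) * u i :=
  (Finset.sum_erase_add _ _ (Finset.mem_univ i)).symm

theorem rad_flipAt [DecidableEq ι] (i : ι) (ε : ι → Bool) (u : ι → ℝ) :
    rad (flipAt i ε) u = ∑ j ∈ Finset.univ.erase i, sgn (ε j) * u j + -sgn (ε i) * u i := by
  rw [rad_eq_erase_add i, sum_sgn_flipAt_of_notMem (Finset.notMem_erase i _), sgn_flipAt_self]

theorem le_iSup_of_finite {κ : Type*} [Finite κ] (f : κ → ℝ) (t : κ) : f t ≤ ⨆ t, f t :=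
  le_ciSup (Set.finite_range f).bddAbove t

section Contraction

variable {κ : Type*} [Finite κ] [Nonempty κ]

theorem iSup_add_iSup_le_of_abs_sub_le (A x y : κ → ℝ) {s : ℝ} (hs : |s| = 1)
    (h : ∀ t t', |x t - x t'| ≤ |y t - y t'|) :
    (⨆ t, (A t + s * x t)) + (⨆ t, (A t + -s * x t)) ≤
      (⨆ t, (A t + s * y t)) + ⨆ t, (A t + -s * y t) := by
  obtain ⟨t₁, h₁⟩ := exists_eq_ciSup_of_finite (f := fun t => A t + s * x t)
  obtain ⟨t₂, h₂⟩ := exists_eq_ciSup_of_finite (f := fun t => A t + -s * x t)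
  rw [← h₁, ← h₂]
  have hxy : s * (x t₁ - x t₂) ≤ |s * (y t₁ - y t₂)| := by
    refine (le_abs_self _).trans ?_
    rw [abs_mul, abs_mul, hs, one_mul, one_mul]
    exact h t₁ t₂
  -- The maximisers on the left, in the order dictated by the sign of `s * (y t₁ - y t₂)`, compete
  -- for the two suprema on the right.
  rcases le_total 0 (s * (y t₁ - y t₂)) with h0 | h0
  · rw [abs_of_nonneg h0] at hxy
    linarith [le_iSup_of_finite (fun t => A t + s * y t) t₁,
      le_iSup_of_finite (fun t => A t + -s * y t) t₂]
  · rw [abs_of_nonpos h0] at hxy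
    linarith [le_iSup_of_finite (fun t => A t + s * y t) t₂,
      le_iSup_of_finite (fun t => A t + -s * y t) t₁]

theorem integral_iSup_rad_le_of_eq_off (i : ι) (v w : κ → ι → ℝ)
    (hvw : ∀ t, ∀ j ≠ i, v t j = w t j) (h : ∀ t t', |v t i - v t' i| ≤ |w t i - w t' i|) :
    ∫ ε, (⨆ t, rad ε (v t)) ∂signLaw ι ≤ ∫ ε, (⨆ t, rad ε (w t)) ∂signLaw ι := by
  classical
  rw [integral_eq_flipAt_average i, integral_eq_flipAt_average i fun ε => ⨆ t, rad ε (w t)]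
  refine integral_mono .of_finite .of_finite fun ε => div_le_div_of_nonneg_right ?_ zero_le_two
  have hoff : ∀ t, ∑ j ∈ Finset.univ.erase i, sgn (ε j) * v t j =
      ∑ j ∈ Finset.univ.erase i, sgn (ε j) * w t j := fun t =>
    Finset.sum_congr rfl fun j hj => by rw [hvw t j (Finset.ne_of_mem_erase hj)]
  simp only [rad_flipAt, rad_eq_erase_add i ε, hoff]
  exact iSup_add_iSup_le_of_abs_sub_le _ _ _ (abs_sgn _) h

/-- Ledoux–Talagrand comparison: the coordinates are replaced one at a time. -/
theorem integral_iSup_rad_le (v w : κ → ι → ℝ)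
    (h : ∀ t t' i, |v t i - v t' i| ≤ |w t i - w t' i|) :
    ∫ ε, (⨆ t, rad ε (v t)) ∂signLaw ι ≤ ∫ ε, (⨆ t, rad ε (w t)) ∂signLaw ι := by
  classical
  have replace_on (J : Finset ι) : ∫ ε, (⨆ t, rad ε (v t)) ∂signLaw ι ≤
      ∫ ε, (⨆ t, rad ε fun j => if j ∈ J then w t j else v t j) ∂signLaw ι := by
    induction J using Finset.induction_on with
    | empty => simp
    | insert i J hi ih =>
      refine ih.trans (integral_iSup_rad_le_of_eq_off i _ _ (fun t j hj => ?_) fun t t' => ?_)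
      · simp [hj]
      · simpa [hi] using h t t' i
  simpa using replace_on Finset.univ

theorem iSup_abs_rad_le_add (ε : ι → Bool) (v : κ → ι → ℝ) :
    ⨆ t, |rad ε (v t)| ≤
      (⨆ o : Option κ, rad ε (o.elim 0 v)) + ⨆ o : Option κ, rad (fun i => !ε i) (o.elim 0 v) := by
  refine ciSup_le fun t => ?_
  have hle (ε : ι → Bool) (o : Option κ) := le_iSup_of_finite (fun o => rad ε (o.elim 0 v)) o
  have h₁ : 0 ≤ ⨆ o : Option κ, rad ε (o.elim 0 v) := (rad_zero ε).symm.trans_le (hle ε none)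
  have h₂ : 0 ≤ ⨆ o : Option κ, rad (fun i => !ε i) (o.elim 0 v) :=
    (rad_zero _).symm.trans_le (hle _ none)
  have h₃ : -rad ε (v t) ≤ ⨆ o : Option κ, rad (fun i => !ε i) (o.elim 0 v) :=
    (rad_not ε _).symm.trans_le (hle _ (some t))
  exact abs_le.2 ⟨by linarith, (hle ε (some t)).trans (le_add_of_nonneg_right h₂)⟩

theorem iSup_option_rad_le (ε : ι → Bool) (w : κ → ι → ℝ) :
    ⨆ o : Option κ, rad ε (o.elim 0 w) ≤ ⨆ t, |rad ε (w t)| := by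
  have hle := le_iSup_of_finite fun t => |rad ε (w t)|
  refine ciSup_le fun o => ?_
  rcases o with _ | t
  · exact (rad_zero ε).trans_le ((abs_nonneg _).trans (hle (Classical.arbitrary κ)))
  · exact (le_abs_self _).trans (hle t)

theorem integral_iSup_abs_rad_le (v w : κ → ι → ℝ)
    (h : ∀ t t' i, |v t i - v t' i| ≤ |w t i - w t' i|) (h0 : ∀ t i, |v t i| ≤ |w t i|) :
    ∫ ε, (⨆ t, |rad ε (v t)|) ∂signLaw ι ≤ 2 * ∫ ε, (⨆ t, |rad ε (w t)|) ∂signLaw ι := by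
  have hcomparison : ∫ ε, (⨆ o : Option κ, rad ε (o.elim 0 v)) ∂signLaw ι ≤
      ∫ ε, (⨆ o : Option κ, rad ε (o.elim 0 w)) ∂signLaw ι := by
    refine integral_iSup_rad_le _ _ fun o o' i => ?_
    rcases o with _ | t <;> rcases o' with _ | t'
    · simp
    · simpa using h0 t' i
    · simpa using h0 t i
    · exact h t t' i
  calc ∫ ε, (⨆ t, |rad ε (v t)|) ∂signLaw ι
      ≤ ∫ ε, ((⨆ o : Option κ, rad ε (o.elim 0 v)) +
          ⨆ o : Option κ, rad (fun i => !ε i) (o.elim 0 v)) ∂signLaw ι :=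
        integral_mono .of_finite .of_finite fun ε => iSup_abs_rad_le_add ε v
    _ = 2 * ∫ ε, (⨆ o : Option κ, rad ε (o.elim 0 v)) ∂signLaw ι := by
        rw [integral_add .of_finite .of_finite,
          integral_comp_not fun ε => ⨆ o : Option κ, rad ε (o.elim 0 v), two_mul]
    _ ≤ 2 * ∫ ε, (⨆ t, |rad ε (w t)|) ∂signLaw ι := by
        refine mul_le_mul_of_nonneg_left (hcomparison.trans ?_) zero_le_two
        exact integral_mono .of_finite .of_finite fun ε => iSup_option_rad_le ε w

end Contraction

theorem integral_rad_sq (u : ι → ℝ) : ∫ ε, rad ε u ^ 2 ∂signLaw ι = ∑ i, u i ^ 2 :=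
  integral_sum_sgn_sq Finset.univ u

theorem integral_rad_pow_four_le (u : ι → ℝ) :
    ∫ ε, rad ε u ^ 4 ∂signLaw ι ≤ 3 * (∑ i, u i ^ 2) ^ 2 :=
  integral_sum_sgn_pow_four_le Finset.univ u

theorem sq_le_add_pow_four_div_add_indicator {s c : ℝ} (hs : 0 < s) (x : ℝ) :
    x ^ 2 ≤ c ^ 2 + x ^ 4 / (12 * s) + 3 * s * {x | c < |x|}.indicator 1 x := by
  have h4 : 0 ≤ x ^ 4 / (12 * s) := by positivity
  by_cases hc : c < |x|
  · have hsq : x ^ 4 / (12 * s) + 3 * s - x ^ 2 = (x ^ 2 - 6 * s) ^ 2 / (12 * s) := by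
      field_simp
      ring
    have : 0 ≤ (x ^ 2 - 6 * s) ^ 2 / (12 * s) := by positivity
    rw [Set.indicator_of_mem (by exact hc), Pi.one_apply]
    nlinarith [sq_nonneg c]
  · rw [Set.indicator_of_notMem (by exact hc)]
    have : x ^ 2 ≤ c ^ 2 := sq_le_sq.2 ((not_lt.1 hc).trans (le_abs_self c))
    linarith

/-- A Paley–Zygmund argument: the fourth moment keeps a Rademacher sum from concentrating near
zero, so a small quantile forces a small variance. -/
theorem sum_sq_le_of_signLaw_le (u : ι → ℝ) {c : ℝ}
    (h : (signLaw ι).real {ε | c < |rad ε u|} ≤ 1 / 12) : ∑ i, u i ^ 2 ≤ 2 * c ^ 2 := by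
  set s := ∑ i, u i ^ 2
  rcases (show 0 ≤ s by positivity).eq_or_lt with h0 | hs
  · rw [← h0]
    positivity
  have hindicator : ∫ ε, {x | c < |x|}.indicator (1 : ℝ → ℝ) (rad ε u) ∂signLaw ι =
      (signLaw ι).real {ε | c < |rad ε u|} :=
    integral_indicator_one (s := {ε | c < |rad ε u|}) (Set.toFinite _).measurableSet
  have hmean : s ≤ c ^ 2 + (∫ ε, rad ε u ^ 4 ∂signLaw ι) / (12 * s) +
      3 * s * (signLaw ι).real {ε | c < |rad ε u|} := by
    have := integral_mono (μ := signLaw ι) .of_finite .of_finite fun ε =>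
      sq_le_add_pow_four_div_add_indicator (c := c) hs (rad ε u)
    rwa [integral_rad_sq, integral_add .of_finite .of_finite, integral_add .of_finite .of_finite,
      integral_const, probReal_univ, one_smul, integral_div, integral_const_mul, hindicator] at this
  have hfourth : (∫ ε, rad ε u ^ 4 ∂signLaw ι) / (12 * s) ≤ s / 4 := by
    rw [div_le_iff₀ (by positivity)]
    linarith [integral_rad_pow_four_le u, sq s]
  nlinarith

theorem efron_stein [DecidableEq ι] (f : (ι → Bool) → ℝ) :
    Var[f; signLaw ι] ≤ 1 / 4 * ∑ i, ∫ ε, (f ε - f (flipAt i ε)) ^ 2 ∂signLaw ι :=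
  variance_le_of_forall_notMem_flipAt_eq Finset.univ f fun i hi => absurd (Finset.mem_univ i) hi

theorem efron_stein_posPart [DecidableEq ι] (f : (ι → Bool) → ℝ) :
    Var[f; signLaw ι] ≤ 1 / 2 * ∫ ε, ∑ i, max (f ε - f (flipAt i ε)) 0 ^ 2 ∂signLaw ι := by
  have hpair (i : ι) : ∫ ε, (f ε - f (flipAt i ε)) ^ 2 ∂signLaw ι =
      2 * ∫ ε, max (f ε - f (flipAt i ε)) 0 ^ 2 ∂signLaw ι := by
    rw [integral_eq_flipAt_average i fun ε => max _ 0 ^ 2, ← integral_const_mul]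
    congr with ε
    rw [flipAt_flipAt]
    rcases le_total (f ε) (f (flipAt i ε)) with h | h
    · rw [max_eq_right (sub_nonpos.2 h), max_eq_left (sub_nonneg.2 h)]
      ring
    · rw [max_eq_left (sub_nonneg.2 h), max_eq_right (sub_nonpos.2 h)]
      ring
  have := efron_stein f
  rw [Finset.sum_congr rfl fun i _ => hpair i, ← Finset.mul_sum] at this
  rw [integral_finsetSum _ fun _ _ => .of_finite]
  linarith

theorem abs_rad_sub_abs_rad_flipAt_le [DecidableEq ι] (i : ι) (ε : ι → Bool) (u : ι → ℝ) :
    |rad ε u| - |rad (flipAt i ε) u| ≤ |2 * u i| := by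
  have hdiff : rad ε u - rad (flipAt i ε) u = sgn (ε i) * (2 * u i) := by
    rw [rad_flipAt, rad_eq_erase_add i ε]
    ring
  calc |rad ε u| - |rad (flipAt i ε) u| ≤ |rad ε u - rad (flipAt i ε) u| :=
        abs_sub_abs_le_abs_sub _ _
    _ = |2 * u i| := by rw [hdiff, abs_mul, abs_sgn, one_mul]

theorem variance_iSup_abs_rad_le {κ : Type*} [Finite κ] [Nonempty κ] (w : κ → ι → ℝ) {b : ℝ}
    (hw : ∀ t, ∑ i, w t i ^ 2 ≤ b) : Var[fun ε => ⨆ t, |rad ε (w t)|; signLaw ι] ≤ 2 * b := by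
  classical
  have hbound (ε : ι → Bool) :
      ∑ i, max ((⨆ t, |rad ε (w t)|) - ⨆ t, |rad (flipAt i ε) (w t)|) 0 ^ 2 ≤ 4 * b := by
    obtain ⟨t, ht⟩ := exists_eq_ciSup_of_finite (f := fun t => |rad ε (w t)|)
    have hcoord (i : ι) :
        max ((⨆ t, |rad ε (w t)|) - ⨆ t, |rad (flipAt i ε) (w t)|) 0 ≤ |2 * w t i| := by
      refine max_le ?_ (abs_nonneg _)
      rw [← ht]
      linarith [abs_rad_sub_abs_rad_flipAt_le i ε (w t),
        le_iSup_of_finite (fun t => |rad (flipAt i ε) (w t)|) t]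
    calc _ ≤ ∑ i, |2 * w t i| ^ 2 := by gcongr with i; exact hcoord i
      _ = 4 * ∑ i, w t i ^ 2 := by
        rw [Finset.mul_sum]
        refine Finset.sum_congr rfl fun i _ => ?_
        rw [sq_abs]
        ring
      _ ≤ 4 * b := by linarith [hw t]
  have := integral_mono (μ := signLaw ι) .of_finite .of_finite hbound
  rw [integral_const, probReal_univ, one_smul] at this
  linarith [efron_stein_posPart fun ε => ⨆ t, |rad ε (w t)|]

/-- A Kahane-type inequality: a quantile controls every single variance, these control the variance
of the supremum by Efron–Stein, and then the quantile cannot be far below the mean. -/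
theorem integral_iSup_abs_rad_le_of_signLaw_le {κ : Type*} [Finite κ] [Nonempty κ]
    (w : κ → ι → ℝ) {c : ℝ} (hc : 0 < c)
    (h : (signLaw ι).real {ε | c < ⨆ t, |rad ε (w t)|} ≤ 1 / 12) :
    ∫ ε, (⨆ t, |rad ε (w t)|) ∂signLaw ι ≤ 4 * c := by
  set m : (ι → Bool) → ℝ := fun ε => ⨆ t, |rad ε (w t)|
  have hvar : Var[m; signLaw ι] ≤ 4 * c ^ 2 := by
    refine (variance_iSup_abs_rad_le w fun t => sum_sq_le_of_signLaw_le (c := c) _ ?_).trans_eq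
      (by ring)
    exact (measureReal_mono fun ε hε =>
      lt_of_lt_of_le hε (le_iSup_of_finite (fun t => |rad ε (w t)|) t)).trans h
  by_contra! hlarge
  have hchebyshev : (signLaw ι).real {ε | 3 * c ≤ |m ε - ∫ ε, m ε ∂signLaw ι|} ≤ 4 / 9 := by
    refine ENNReal.toReal_le_of_le_ofReal (by norm_num) ?_
    refine (meas_ge_le_variance_div_sq .of_discrete (by positivity)).trans
      (ENNReal.ofReal_le_ofReal ?_)
    rw [div_le_iff₀ (by positivity)]
    linarith
  have hsmall : {ε | c < m ε}ᶜ ⊆ {ε | 3 * c ≤ |m ε - ∫ ε, m ε ∂signLaw ι|} := fun ε hε => by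
    have : m ε ≤ c := not_lt.1 hε
    exact (by linarith : 3 * c ≤ -(m ε - ∫ ε, m ε ∂signLaw ι)).trans (neg_le_abs _)
  have hcompl := probReal_compl_eq_one_sub (μ := signLaw ι) (s := {ε | c < m ε})
    (Set.toFinite _).measurableSet
  linarith [measureReal_mono (μ := signLaw ι) hsmall]

/-- Quantiles rather than means, because the supremum over an unbounded `T` may be infinite. -/
theorem mul_signLaw_exists_lt_rad_comp_le {T : Set (ι → ℝ)} {φ : ι → ℝ → ℝ} {L c s : ℝ}
    (hc : 0 < c) (hL : 0 ≤ L) (hs : 0 ≤ s) (hφ0 : ∀ i, φ i 0 = 0)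
    (hφ : ∀ i a b, |φ i a - φ i b| ≤ L * |a - b|)
    (h : (signLaw ι).real {ε | ∃ t ∈ T, c < |rad ε t|} ≤ 1 / 12) :
    s * (signLaw ι).real {ε | ∃ t ∈ T, s < |rad ε fun i => φ i (t i)|} ≤ 8 * L * c := by
  classical
  rcases T.eq_empty_or_nonempty with rfl | ⟨t₀, ht₀⟩
  · simp only [Set.mem_empty_iff_false, false_and, exists_false, Set.ofPred_false,
      measureReal_empty, mul_zero]
    positivity
  -- One near-maximiser in `T` for each vector of signs reduces `T` to a finite family.
  have hwitness (ε : ι → Bool) : ∃ t ∈ T, (∃ t ∈ T, s < |rad ε fun i => φ i (t i)|) →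
      s < |rad ε fun i => φ i (t i)| := by
    by_cases hε : ∃ t ∈ T, s < |rad ε fun i => φ i (t i)|
    · obtain ⟨t, ht, hlt⟩ := hε
      exact ⟨t, ht, fun _ => hlt⟩
    · exact ⟨t₀, ht₀, fun h => absurd h hε⟩
  choose u huT hu using hwitness
  have hmean : ∫ ε, (⨆ η, |rad ε (u η)|) ∂signLaw ι ≤ 4 * c := by
    refine integral_iSup_abs_rad_le_of_signLaw_le u hc ((measureReal_mono fun ε hε => ?_).trans h)
    obtain ⟨η, hη⟩ := exists_eq_ciSup_of_finite (f := fun η => |rad ε (u η)|)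
    exact ⟨u η, huT η, lt_of_lt_of_eq hε hη.symm⟩
  have hscale (ε : ι → Bool) : ⨆ η, |rad ε fun i => L * u η i| = L * ⨆ η, |rad ε (u η)| := by
    simp only [rad_const_mul, abs_mul, abs_of_nonneg hL, Real.mul_iSup_of_nonneg hL]
  have hcontract : ∫ ε, (⨆ η, |rad ε fun i => φ i (u η i)|) ∂signLaw ι ≤ 2 * (L * (4 * c)) := by
    refine (integral_iSup_abs_rad_le _ (fun η i => L * u η i) (fun η η' i => ?_)
      fun η i => ?_).trans ?_
    · rw [← mul_sub, abs_mul, abs_of_nonneg hL]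
      exact hφ i _ _
    · rw [abs_mul, abs_of_nonneg hL]
      simpa [hφ0] using hφ i (u η i) 0
    · simp only [hscale, integral_const_mul]
      gcongr
  calc s * (signLaw ι).real {ε | ∃ t ∈ T, s < |rad ε fun i => φ i (t i)|}
      ≤ s * (signLaw ι).real {ε | s ≤ ⨆ η, |rad ε fun i => φ i (u η i)|} := by
        refine mul_le_mul_of_nonneg_left (measureReal_mono fun ε hε => ?_) hs
        exact (hu ε hε).le.trans (le_iSup_of_finite (fun η => |rad ε fun i => φ i (u η i)|) ε)
    _ ≤ ∫ ε, (⨆ η, |rad ε fun i => φ i (u η i)|) ∂signLaw ι :=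
        mul_meas_ge_le_integral_of_nonneg
          (.of_forall fun ε => Real.iSup_nonneg fun η => abs_nonneg _) .of_finite s
    _ ≤ 8 * L * c := by linarith

theorem signLaw_unbalanced_le {n : ℕ} (hn : 0 < n) {K : ℝ} (hK : 0 < K) :
    (signLaw (Fin n)).real {ε | K * √(n : ℝ) < |∑ i, sgn (ε i)|} ≤ 1 / K ^ 2 := by
  have hn' : (0 : ℝ) < n := by exact_mod_cast hn
  have hmarkov := mul_meas_ge_le_integral_of_nonneg (μ := signLaw (Fin n))
    (f := fun ε => rad ε (fun _ => 1) ^ 2) (.of_forall fun ε => sq_nonneg _) .of_finite (K ^ 2 * n)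
  have hsubset : {ε : Fin n → Bool | K * √(n : ℝ) < |∑ i, sgn (ε i)|} ⊆
      {ε | K ^ 2 * n ≤ rad ε (fun _ => 1) ^ 2} := fun ε hε => by
    have : (K * √(n : ℝ)) ^ 2 ≤ |∑ i, sgn (ε i)| ^ 2 :=
      pow_le_pow_left₀ (by positivity) (le_of_lt hε) 2
    simpa [rad, mul_pow, hn'.le] using this
  rw [integral_rad_sq] at hmarkov
  simp only [one_pow, Finset.sum_const, Finset.card_univ, Fintype.card_fin, nsmul_one] at hmarkov
  rw [le_div_iff₀ (by positivity)]
  refine le_of_mul_le_mul_right ?_ hn'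
  nlinarith [measureReal_mono (μ := signLaw (Fin n)) hsubset,
    mul_pos (pow_pos hK 2) hn']

theorem sum_sgn_eq (ε : ι → Bool) :
    ∑ i, sgn (ε i) =
      (Finset.univ.filter (ε · = true)).card - (Finset.univ.filter (ε · = false)).card := by
  rw [← Finset.sum_boole, ← Finset.sum_boole, ← Finset.sum_sub_distrib]
  refine Finset.sum_congr rfl fun i _ => ?_
  cases ε i <;> simp [sgn]

end Rademacher

/-! ### Symmetrization in outer probability -/

/-- The law of `n` independent observations from `P`. -/
noncomputable abbrev sampleLaw {S : Type*} [MeasurableSpace S] (P : Measure S) (n : ℕ) :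
    Measure (Fin n → S) :=
  Measure.pi fun _ : Fin n => P

/-- The empirical process `n^{-1/2} ∑ (h(x_i) - P h)` of a finite sample. -/
noncomputable def sampleProc {S : Type*} [MeasurableSpace S] (P : Measure S) (n : ℕ) (h : S → ℝ)
    (x : Fin n → S) : ℝ :=
  (√(n : ℝ))⁻¹ * ∑ i, (h (x i) - ∫ y, h y ∂P)

section Sample

variable {S : Type*} [MeasurableSpace S] (P : Measure S) [IsProbabilityMeasure P]

theorem measurePreserving_comp_injective {ι κ : Type*} [Fintype ι] [Fintype κ] {e : κ → ι}
    (he : Function.Injective e) :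
    MeasurePreserving (fun (x : ι → S) (j : κ) => x (e j)) (Measure.pi fun _ => P)
      (Measure.pi fun _ => P) := by
  refine ⟨by fun_prop, ?_⟩
  rw [← Measure.infinitePi_eq_pi, ← Measure.infinitePi_eq_pi]
  exact Measure.map_infinitePi_infinitePi_of_inj (P := fun _ : ι => P) he

omit [IsProbabilityMeasure P] in
theorem sampleProc_sub (n : ℕ) (h : S → ℝ) (x y : Fin n → S) :
    sampleProc P n h x - sampleProc P n h y = (√(n : ℝ))⁻¹ * ∑ i, (h (x i) - h (y i)) := by
  simp only [sampleProc, ← mul_sub, ← Finset.sum_sub_distrib, sub_sub_sub_cancel_right]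

section Moments

variable {P} {h : S → ℝ} (hh : MemLp h 2 P) (n : ℕ)
include hh

theorem memLp_sampleProc : MemLp (sampleProc P n h) 2 (sampleLaw P n) :=
  (memLp_finsetSum _ fun i _ => (hh.comp_measurePreserving
    (measurePreserving_eval (fun _ : Fin n => P) i)).sub (memLp_const _)).const_mul _

theorem integral_sampleProc : ∫ x, sampleProc P n h x ∂(sampleLaw P n) = 0 := by
  have hi (i : Fin n) : Integrable (fun x : Fin n → S => h (x i)) (sampleLaw P n) :=
    (hh.comp_measurePreserving (measurePreserving_eval (fun _ => P) i)).integrable one_le_two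
  have hv (i : Fin n) : ∫ x : Fin n → S, h (x i) ∂(sampleLaw P n) = ∫ y, h y ∂P :=
    integral_comp_eval (μ := fun _ : Fin n => P) hh.1
  have hi' (i : Fin n) : Integrable (fun x : Fin n → S => h (x i) - ∫ y, h y ∂P) (sampleLaw P n) :=
    (hi i).sub (integrable_const _)
  simp only [sampleProc]
  rw [integral_const_mul, integral_finsetSum _ fun i _ => hi' i]
  simp [integral_sub (hi _) (integrable_const _), hv]

theorem variance_sampleProc_le :
    Var[sampleProc P n h; sampleLaw P n] ≤ ∫ y, h y ^ 2 ∂P := by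
  have hvar : Var[fun y => h y - ∫ y, h y ∂P; P] ≤ ∫ y, h y ^ 2 ∂P := by
    rw [variance_sub_const hh.1]
    exact variance_le_expectation_sq hh.1
  have hsum := variance_sum_pi (μ := fun _ : Fin n => P) (X := fun _ y => h y - ∫ y, h y ∂P)
    fun _ => hh.sub (memLp_const _)
  have e : sampleProc P n h = fun x => (√(n : ℝ))⁻¹ *
      (∑ i, fun x : Fin n → S => h (x i) - ∫ y, h y ∂P) x := by
    funext x
    simp [sampleProc]
  rw [e, variance_const_mul, hsum, Finset.sum_const, Finset.card_univ, Fintype.card_fin,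
    nsmul_eq_mul, inv_pow, Real.sq_sqrt n.cast_nonneg]
  rcases n.eq_zero_or_pos with rfl | hn
  · simpa using integral_nonneg fun y => sq_nonneg (h y)
  · rwa [inv_mul_cancel_left₀ (by positivity)]

theorem chebyshev_sampleProc {c : ℝ} (hc : 0 < c) :
    sampleLaw P n {x | c ≤ |sampleProc P n h x|} ≤ ENNReal.ofReal ((∫ y, h y ^ 2 ∂P) / c ^ 2) := by
  have := meas_ge_le_variance_div_sq (memLp_sampleProc hh n) hc
  simp only [integral_sampleProc hh n, sub_zero] at this
  refine this.trans (ENNReal.ofReal_le_ofReal ?_)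
  gcongr
  exact variance_sampleProc_le hh n

end Moments

variable {Θ : Type*} (h : Θ → S → ℝ) (A : Set Θ)

theorem sampleLaw_exists_lt_sum_le {c : ℝ} {p : ℝ≥0∞} {n : ℕ} (I : Finset (Fin n))
    (hp : sampleLaw P I.card {x | ∃ θ ∈ A, c < |sampleProc P I.card (h θ) x|} ≤ p) :
    sampleLaw P n {x | ∃ θ ∈ A, c < |(√(n : ℝ))⁻¹ * ∑ i ∈ I, (h θ (x i) - ∫ y, h θ y ∂P)|} ≤ p := by
  set e : Fin I.card → Fin n := fun j => I.orderEmbOfFin rfl j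
  have hm := measurePreserving_comp_injective P (I.orderEmbOfFin rfl).injective
  refine le_trans (measure_mono ?_) ((Measure.le_map_apply hm.measurable.aemeasurable
    {x | ∃ θ ∈ A, c < |sampleProc P I.card (h θ) x|}).trans (hm.map_eq.symm ▸ hp))
  rintro x ⟨θ, hθ, hx⟩
  refine ⟨θ, hθ, hx.trans_le ?_⟩
  have hsum : ∑ i ∈ I, (h θ (x i) - ∫ y, h θ y ∂P) =
      ∑ j : Fin I.card, (h θ (x (e j)) - ∫ y, h θ y ∂P) := by
    conv_lhs => rw [← I.map_orderEmbOfFin_univ rfl]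
    exact Finset.sum_map ..
  have hle : I.card ≤ n := by simpa using I.card_le_univ
  rw [sampleProc, hsum, abs_mul, abs_mul]
  rcases I.card.eq_zero_or_pos with h0 | h0
  · simp [← hsum, Finset.card_eq_zero.1 h0]
  · refine mul_le_mul_of_nonneg_right ?_ (abs_nonneg _)
    rw [abs_of_nonneg (by positivity), abs_of_nonneg (by positivity)]
    gcongr

theorem rad_eq_sum_sub_sum {ι : Type*} [Fintype ι] (ε : ι → Bool) (a : ι → ℝ) :
    rad ε a = ∑ i with ε i = true, a i - ∑ i with ε i = false, a i := by
  simp_rw [rad, Finset.sum_filter, ← Finset.sum_sub_distrib]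
  refine Finset.sum_congr rfl fun i _ => ?_
  cases hi : ε i <;> simp [sgn]

theorem sampleLaw_exists_lt_rad_sub_le {c : ℝ} {p : ℝ≥0∞} {k₀ n : ℕ}
    (hp : ∀ k ≥ k₀, sampleLaw P k {x | ∃ θ ∈ A, c < |sampleProc P k (h θ) x|} ≤ p)
    (ε : Fin n → Bool) (h₁ : k₀ ≤ (Finset.univ.filter fun i => ε i = true).card)
    (h₀ : k₀ ≤ (Finset.univ.filter fun i => ε i = false).card) :
    sampleLaw P n {x | ∃ θ ∈ A, 2 * c <
      |(√(n : ℝ))⁻¹ * rad ε fun i => h θ (x i) - ∫ y, h θ y ∂P|} ≤ 2 * p := by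
  rw [two_mul p]
  refine le_trans (measure_mono ?_) ((measure_union_le _ _).trans (add_le_add
    (sampleLaw_exists_lt_sum_le P h A _ (hp _ h₁)) (sampleLaw_exists_lt_sum_le P h A _ (hp _ h₀))))
  rintro x ⟨θ, hθ, hx⟩
  rw [rad_eq_sum_sub_sum, mul_sub] at hx
  by_contra! hcon
  simp only [Set.mem_union, Set.mem_ofPred_eq, not_or, not_exists, not_and, not_lt] at hcon
  have := hx.trans_le (abs_sub _ _)
  linarith [hcon.1 θ hθ, hcon.2 θ hθ]

/-- Exchange of the coordinates with a `false` label between two samples. -/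
def swapSample {S ι : Type*} (ε : ι → Bool) (p : (ι → S) × (ι → S)) : (ι → S) × (ι → S) :=
  (fun i => if ε i then p.1 i else p.2 i, fun i => if ε i then p.2 i else p.1 i)

theorem measurePreserving_swapSample {ι : Type*} [Fintype ι] (ε : ι → Bool) :
    MeasurePreserving (swapSample (S := S) ε)
      ((Measure.pi fun _ : ι => P).prod (Measure.pi fun _ : ι => P))
      ((Measure.pi fun _ : ι => P).prod (Measure.pi fun _ : ι => P)) := by
  have hpair := measurePreserving_arrowProdEquivProdArrow S S ι (fun _ => P) (fun _ => P)
  have hswap : MeasurePreserving (fun (x : ι → S × S) i => (if ε i then id else Prod.swap) (x i))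
      (Measure.pi fun _ => P.prod P) (Measure.pi fun _ => P.prod P) := by
    refine measurePreserving_pi _ _ fun i => ?_
    cases hi : ε i
    · simpa using Measure.measurePreserving_swap (μ := P) (ν := P)
    · simpa using MeasurePreserving.id (P.prod P)
  convert! (hpair.comp hswap).comp (hpair.symm _) using 1
  funext p
  ext i <;> cases hi : ε i <;> simp [swapSample, hi, MeasurableEquiv.arrowProdEquivProdArrow,
    Equiv.arrowProdEquivProdArrow]

theorem sum_sub_eq_rad_swapSample_sub {S ι : Type*} [Fintype ι] (ε : ι → Bool) (f : S → ℝ)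
    (p : (ι → S) × (ι → S)) :
    ∑ i, (f (p.1 i) - f (p.2 i)) = rad ε (fun i => f ((swapSample ε p).1 i)) -
      rad ε (fun i => f ((swapSample ε p).2 i)) := by
  rw [rad, rad, ← Finset.sum_sub_distrib]
  refine Finset.sum_congr rfl fun i _ => ?_
  cases hi : ε i <;> simp [swapSample, sgn, hi]
  ring

theorem sampleLaw_exists_lt_sampleProc_le_prod {t : ℝ} {n : ℕ}
    (hcheb : ∀ θ ∈ A, sampleLaw P n {x | t ≤ |sampleProc P n (h θ) x|} ≤ 1 / 2) :
    sampleLaw P n {x | ∃ θ ∈ A, 2 * t < |sampleProc P n (h θ) x|} ≤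
      2 * ((sampleLaw P n).prod (sampleLaw P n))
        {p | ∃ θ ∈ A, t < |(√(n : ℝ))⁻¹ * ∑ i, (h θ (p.1 i) - h θ (p.2 i))|} := by
  set Q := sampleLaw P n
  set C := {p : (Fin n → S) × (Fin n → S) |
    ∃ θ ∈ A, t < |(√(n : ℝ))⁻¹ * ∑ i, (h θ (p.1 i) - h θ (p.2 i))|}
  set H := toMeasurable (Q.prod Q) C
  have hH : MeasurableSet H := measurableSet_toMeasurable _ _
  have hsection : {x | ∃ θ ∈ A, 2 * t < |sampleProc P n (h θ) x|} ⊆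
      {x | 1 / 2 ≤ Q (Prod.mk x ⁻¹' H)} := by
    rintro x ⟨θ, hθ, hx⟩
    set small := {x' | t ≤ |sampleProc P n (h θ) x'|}ᶜ
    have hsub : small ⊆ Prod.mk x ⁻¹' H := by
      refine fun x' hx' => subset_toMeasurable _ _ ⟨θ, hθ, ?_⟩
      have hx' : |sampleProc P n (h θ) x'| < t := not_le.1 hx'
      simp only [← sampleProc_sub P]
      linarith [abs_sub_abs_le_abs_sub (sampleProc P n (h θ) x) (sampleProc P n (h θ) x')]
    have hone : 1 ≤ Q smallᶜ + Q small := by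
      rw [← measure_univ (μ := Q), ← Set.compl_union_self small]
      exact measure_union_le _ _
    have hhalf : (1 : ℝ≥0∞) - 1 / 2 = 1 / 2 := by rw [one_div, ENNReal.one_sub_inv_two]
    rw [compl_compl] at hone
    rw [Set.mem_ofPred_eq, ← hhalf]
    exact (tsub_le_iff_left.2 (hone.trans (by gcongr; exact hcheb θ hθ))).trans (measure_mono hsub)
  have hmarkov := mul_meas_ge_le_lintegral (μ := Q)
    (measurable_measure_prodMk_left (ν := Q) hH) (1 / 2)
  rw [← Measure.prod_apply hH, measure_toMeasurable, one_div,
    ENNReal.inv_mul_le_iff two_ne_zero ENNReal.ofNat_ne_top] at hmarkov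
  exact (measure_mono hsection).trans (by simpa using hmarkov)

theorem prod_exists_lt_sum_sub_le_rad {t : ℝ} {n : ℕ} (ε : Fin n → Bool) :
    ((sampleLaw P n).prod (sampleLaw P n))
        {p | ∃ θ ∈ A, t < |(√(n : ℝ))⁻¹ * ∑ i, (h θ (p.1 i) - h θ (p.2 i))|} ≤
      2 * sampleLaw P n {x | ∃ θ ∈ A, t / 2 < |(√(n : ℝ))⁻¹ * rad ε fun i => h θ (x i)|} := by
  set Q := sampleLaw P n
  set D := {x : Fin n → S | ∃ θ ∈ A, t / 2 < |(√(n : ℝ))⁻¹ * rad ε fun i => h θ (x i)|}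
  set C := {p : (Fin n → S) × (Fin n → S) |
    ∃ θ ∈ A, t < |(√(n : ℝ))⁻¹ * ∑ i, (h θ (p.1 i) - h θ (p.2 i))|}
  have hsw := measurePreserving_swapSample P ε
  have hsub : C ⊆ swapSample ε ⁻¹' (Prod.fst ⁻¹' D ∪ Prod.snd ⁻¹' D) := by
    rintro p ⟨θ, hθ, hp⟩
    by_contra hcon
    simp only [Set.mem_preimage, Set.mem_union, D, Set.mem_ofPred_eq, not_or, not_exists, not_and,
      not_lt] at hcon
    rw [sum_sub_eq_rad_swapSample_sub ε (h θ), mul_sub] at hp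
    have := hp.trans_le (abs_sub _ _)
    linarith [hcon.1 θ hθ, hcon.2 θ hθ]
  have hfst : (Q.prod Q) (Prod.fst ⁻¹' D) ≤ Q D :=
    (Measure.le_map_apply measurable_fst.aemeasurable D).trans (by simp)
  have hsnd : (Q.prod Q) (Prod.snd ⁻¹' D) ≤ Q D :=
    (Measure.le_map_apply measurable_snd.aemeasurable D).trans (by simp)
  calc (Q.prod Q) C ≤ (Q.prod Q) (swapSample ε ⁻¹' (Prod.fst ⁻¹' D ∪ Prod.snd ⁻¹' D)) :=
        measure_mono hsub
    _ ≤ (Q.prod Q) (Prod.fst ⁻¹' D ∪ Prod.snd ⁻¹' D) :=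
        (Measure.le_map_apply hsw.measurable.aemeasurable _).trans_eq (by rw [hsw.map_eq])
    _ ≤ Q D + Q D := (measure_union_le _ _).trans (add_le_add hfst hsnd)
    _ = 2 * Q D := (two_mul _).symm

theorem sampleLaw_exists_lt_sampleProc_le_rad {t : ℝ} {n : ℕ}
    (hcheb : ∀ θ ∈ A, sampleLaw P n {x | t ≤ |sampleProc P n (h θ) x|} ≤ 1 / 2)
    (ε : Fin n → Bool) :
    sampleLaw P n {x | ∃ θ ∈ A, 2 * t < |sampleProc P n (h θ) x|} ≤
      4 * sampleLaw P n {x | ∃ θ ∈ A, t / 2 < |(√(n : ℝ))⁻¹ * rad ε fun i => h θ (x i)|} := by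
  refine (sampleLaw_exists_lt_sampleProc_le_prod P h A hcheb).trans ?_
  refine (mul_le_mul_right (prod_exists_lt_sum_sub_le_rad P h A ε) 2).trans_eq ?_
  rw [← mul_assoc]
  norm_num

end Sample

/-! ### Contraction in outer probability -/

theorem abs_rad_sub_le {ι : Type*} [Fintype ι] (ε : ι → Bool) {u v : ι → ℝ} {b : ℝ}
    (huv : ∀ i, |u i - v i| ≤ b) : |rad ε u - rad ε v| ≤ Fintype.card ι * b := by
  rw [rad, rad, ← Finset.sum_sub_distrib]
  refine (Finset.abs_sum_le_sum_abs _ _).trans ?_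
  calc _ ≤ ∑ _i : ι, b := Finset.sum_le_sum fun i _ => by
        rw [← mul_sub, abs_mul, abs_sgn, one_mul]
        exact huv i
    _ = Fintype.card ι * b := by simp

theorem prod_le_of_section_le {α β : Type*} [MeasurableSpace α] [MeasurableSpace β]
    {μ : Measure α} {ν : Measure β} [IsProbabilityMeasure μ] [IsProbabilityMeasure ν]
    {B D : Set (α × β)} (hB : MeasurableSet B) (hD : MeasurableSet D) {a r : ℝ≥0∞} (ha0 : a ≠ 0)
    (ha : a ≠ ∞)
    (h : ∀ y, μ ((fun x => (x, y)) ⁻¹' B) ≤ a → μ ((fun x => (x, y)) ⁻¹' D) ≤ r) :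
    (μ.prod ν) D ≤ a⁻¹ * (μ.prod ν) B + r := by
  have hm : Measurable fun y => μ ((fun x => (x, y)) ⁻¹' B) := measurable_measure_prodMk_right hB
  set N := {y | a ≤ μ ((fun x => (x, y)) ⁻¹' B)}
  have hN : MeasurableSet N := measurableSet_le measurable_const hm
  have hpt (y : β) : μ ((fun x => (x, y)) ⁻¹' D) ≤ N.indicator 1 y + r := by
    by_cases hy : y ∈ N
    · exact le_add_right (by simpa [hy] using prob_le_one)
    · exact le_add_left (h y (not_le.1 hy).le)
  have hmarkov : a * ν N ≤ (μ.prod ν) B := by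
    rw [Measure.prod_apply_symm hB]
    exact mul_meas_ge_le_lintegral hm a
  calc (μ.prod ν) D = ∫⁻ y, μ ((fun x => (x, y)) ⁻¹' D) ∂ν := Measure.prod_apply_symm hD
    _ ≤ ∫⁻ y, (N.indicator 1 y + r) ∂ν := lintegral_mono hpt
    _ = ν N + r := by
      rw [lintegral_add_right _ measurable_const, lintegral_indicator_one hN]
      simp
    _ ≤ a⁻¹ * (μ.prod ν) B + r := by
      gcongr
      rwa [← ENNReal.mul_le_iff_le_inv ha0 ha]

section Grid

variable {S : Type*} [MeasurableSpace S] (P : Measure S) {Θ : Type*} (h : Θ → S → ℝ) (A : Set Θ)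
  {n : ℕ}

/-- Values at the sample points rounded down to the grid `ℤ / n`. -/
noncomputable def gridValue (q : Fin n → ℤ) (i : Fin n) : ℝ := q i / n

/-- A measurable hull of the event that some function of the class takes the grid values `q` at
the sample points. Discretizing makes these events countable in number, so that hulls of all of
them can be taken simultaneously. -/
noncomputable def gridHull (q : Fin n → ℤ) : Set (Fin n → S) :=
  toMeasurable (sampleLaw P n) {x | ∃ θ ∈ A, ∀ i, ⌊n * h θ (x i)⌋ = q i}

/-- The measurable event that the Rademacher sum of some discretized, transformed function of the
class exceeds `c`. -/
def gridExceed (Ψ : S → ℝ → ℝ) (c : ℝ) : Set ((Fin n → Bool) × (Fin n → S)) :=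
  ⋃ q, {p | p.2 ∈ gridHull P h A q ∧ c < |rad p.1 fun i => Ψ (p.2 i) (gridValue q i)|}

variable {P h A}

theorem abs_sub_gridValue_floor_le (hn : 0 < n) (u : Fin n → ℝ) (i : Fin n) :
    |u i - gridValue (fun j => ⌊n * u j⌋) i| ≤ 1 / n := by
  have hn' : (0 : ℝ) < n := by exact_mod_cast hn
  have e : u i - gridValue (fun j => ⌊n * u j⌋) i = Int.fract (n * u i) / n := by
    rw [gridValue, Int.fract]
    field_simp
  rw [e, abs_div, abs_of_pos hn', Int.abs_fract]
  gcongr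
  exact (Int.fract_lt_one _).le

theorem measurableSet_gridExceed {Ψ : S → ℝ → ℝ} (hΨ : ∀ t, Measurable fun x => Ψ x t) (c : ℝ) :
    MeasurableSet (gridExceed P h A Ψ c (n := n)) := by
  have hrad (q : Fin n → ℤ) : Measurable fun p : (Fin n → Bool) × (Fin n → S) =>
      rad p.1 fun i => Ψ (p.2 i) (gridValue q i) :=
    Finset.measurable_fun_sum _ fun i _ => ((Measurable.of_discrete (f := sgn)).comp
      ((measurable_pi_apply i).comp measurable_fst)).mul
        ((hΨ _).comp ((measurable_pi_apply i).comp measurable_snd))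
  exact MeasurableSet.iUnion fun q => (measurable_snd (measurableSet_toMeasurable _ _)).inter
    (measurableSet_lt measurable_const (hrad q).abs)

variable {c s L : ℝ}

theorem measure_gridExceed_le (hn : 0 < n) (hnc : (√(n : ℝ))⁻¹ ≤ c) (ε : Fin n → Bool) :
    sampleLaw P n (Prod.mk ε ⁻¹' gridExceed P h A (fun _ t => t) (2 * c * √(n : ℝ))) ≤
      sampleLaw P n {x | ∃ θ ∈ A, c < |(√(n : ℝ))⁻¹ * rad ε fun i => h θ (x i)|} := by
  have hn' : (0 : ℝ) < n := by exact_mod_cast hn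
  have hrt : 0 < √(n : ℝ) := Real.sqrt_pos.2 hn'
  have e : Prod.mk ε ⁻¹' gridExceed P h A (fun _ t => t) (2 * c * √(n : ℝ)) =
      ⋃ q : {q : Fin n → ℤ // 2 * c * √(n : ℝ) < |rad ε (gridValue q)|}, gridHull P h A q := by
    ext x
    simp [gridExceed, and_comm]
  simp only [e, gridHull]
  rw [measure_iUnion_toMeasurable]
  refine measure_mono (Set.iUnion_subset ?_)
  rintro ⟨q, hq⟩ x ⟨θ, hθ, hx⟩
  obtain rfl : (fun i => ⌊n * h θ (x i)⌋) = q := funext hx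
  refine ⟨θ, hθ, ?_⟩
  have hround := abs_rad_sub_le ε (abs_sub_gridValue_floor_le hn fun i => h θ (x i))
  rw [Fintype.card_fin, mul_one_div_cancel hn'.ne', abs_sub_comm] at hround
  have hone : 1 ≤ c * √(n : ℝ) := by rwa [inv_le_iff_one_le_mul₀ hrt] at hnc
  rw [abs_mul, abs_of_pos (inv_pos.2 hrt), lt_inv_mul_iff₀ hrt]
  linarith [(abs_sub_abs_le_abs_sub _ _).trans hround]

theorem setOf_exists_lt_rad_subset_gridExceed (hn : 0 < n) (hL : 0 ≤ L) {Φ : S → ℝ → ℝ}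
    (hΦ : ∀ x a b, |Φ x a - Φ x b| ≤ L * |a - b|) (hns : L * (√(n : ℝ))⁻¹ ≤ s)
    (ε : Fin n → Bool) :
    {x | ∃ θ ∈ A, 2 * s < |(√(n : ℝ))⁻¹ * rad ε fun i => Φ (x i) (h θ (x i))|} ⊆
      Prod.mk ε ⁻¹' gridExceed P h A Φ (s * √(n : ℝ)) := by
  have hn' : (0 : ℝ) < n := by exact_mod_cast hn
  have hrt : 0 < √(n : ℝ) := Real.sqrt_pos.2 hn'
  rintro x ⟨θ, hθ, hx⟩
  refine Set.mem_iUnion.2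
    ⟨fun i => ⌊n * h θ (x i)⌋, subset_toMeasurable _ _ ⟨θ, hθ, fun i => rfl⟩, ?_⟩
  have hround := abs_rad_sub_le ε fun i => (hΦ (x i) _ _).trans
    (mul_le_mul_of_nonneg_left (abs_sub_gridValue_floor_le hn (fun i => h θ (x i)) i) hL)
  rw [Fintype.card_fin, mul_left_comm, mul_one_div_cancel hn'.ne', mul_one] at hround
  have hLs : L ≤ s * √(n : ℝ) := by rwa [← div_eq_mul_inv, div_le_iff₀ hrt] at hns
  rw [abs_mul, abs_of_pos (inv_pos.2 hrt), lt_inv_mul_iff₀ hrt] at hx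
  linarith [(abs_sub_abs_le_abs_sub _ _).trans hround]

theorem signLaw_gridExceed_comp_le (hn : 0 < n) (hL : 0 ≤ L) (hc : 0 < c) (hs : 0 < s)
    {Φ : S → ℝ → ℝ} (hΦ0 : ∀ x, Φ x 0 = 0) (hΦ : ∀ x a b, |Φ x a - Φ x b| ≤ L * |a - b|)
    {x : Fin n → S} (hx : signLaw (Fin n)
      ((fun ε => (ε, x)) ⁻¹' gridExceed P h A (fun _ t => t) (2 * c * √(n : ℝ))) ≤ 12⁻¹) :
    signLaw (Fin n) ((fun ε => (ε, x)) ⁻¹' gridExceed P h A Φ (s * √(n : ℝ))) ≤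
      ENNReal.ofReal (16 * L * c / s) := by
  have hrt : 0 < √(n : ℝ) := Real.sqrt_pos.2 (by exact_mod_cast hn)
  have hsection (Ψ : S → ℝ → ℝ) (r : ℝ) : (fun ε => (ε, x)) ⁻¹' gridExceed P h A Ψ r =
      {ε | ∃ t ∈ gridValue '' {q | x ∈ gridHull P h A q}, r < |rad ε fun i => Ψ (x i) (t i)|} := by
    ext ε
    simp [gridExceed]
  rw [hsection] at hx ⊢
  have hx' := ENNReal.toReal_mono (by simp) hx
  rw [ENNReal.toReal_inv, ENNReal.toReal_ofNat, ← one_div] at hx'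
  have hcontr := mul_signLaw_exists_lt_rad_comp_le (φ := fun i => Φ (x i))
    (by positivity : 0 < 2 * c * √(n : ℝ)) hL (by positivity : 0 ≤ s * √(n : ℝ))
    (fun i => hΦ0 _) (fun i => hΦ _) hx'
  refine (ENNReal.le_ofReal_iff_toReal_le (measure_ne_top _ _) (by positivity)).2 ?_
  refine le_of_mul_le_mul_left (hcontr.trans_eq ?_) (by positivity : 0 < s * √(n : ℝ))
  field_simp
  ring

theorem prod_gridExceed_le [IsProbabilityMeasure P] (hn : 0 < n) (hnc : (√(n : ℝ))⁻¹ ≤ c)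
    {p : ℝ≥0∞} {G : Set (Fin n → Bool)} (hG : ∀ ε ∈ G, sampleLaw P n
      {x | ∃ θ ∈ A, c < |(√(n : ℝ))⁻¹ * rad ε fun i => h θ (x i)|} ≤ p) :
    ((signLaw (Fin n)).prod (sampleLaw P n))
      (gridExceed P h A (fun _ t => t) (2 * c * √(n : ℝ))) ≤ p + signLaw (Fin n) Gᶜ := by
  have hpt (ε : Fin n → Bool) :
      sampleLaw P n (Prod.mk ε ⁻¹' gridExceed P h A (fun _ t => t) (2 * c * √(n : ℝ))) ≤
        p + Gᶜ.indicator 1 ε := by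
    by_cases hε : ε ∈ G
    · exact le_add_right ((measure_gridExceed_le hn hnc ε).trans (hG ε hε))
    · exact le_add_left (by simpa [hε] using prob_le_one)
  have hm : MeasurableSet (gridExceed P h A (n := n) (fun _ t => t) (2 * c * √(n : ℝ))) :=
    measurableSet_gridExceed (Ψ := fun _ t => t) (fun _ => measurable_const) _
  rw [Measure.prod_apply hm]
  refine (lintegral_mono hpt).trans_eq ?_
  rw [lintegral_add_left measurable_const, lintegral_indicator_one .of_discrete]
  simp

theorem lintegral_sampleLaw_exists_lt_rad_comp_le [IsProbabilityMeasure P] (hn : 0 < n)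
    (hL : 0 ≤ L) (hc : 0 < c) (hs : 0 < s) {Φ : S → ℝ → ℝ} (hΦm : ∀ t, Measurable fun x => Φ x t)
    (hΦ0 : ∀ x, Φ x 0 = 0) (hΦ : ∀ x a b, |Φ x a - Φ x b| ≤ L * |a - b|)
    (hnc : (√(n : ℝ))⁻¹ ≤ c) (hns : L * (√(n : ℝ))⁻¹ ≤ s) {p : ℝ≥0∞} {G : Set (Fin n → Bool)}
    (hG : ∀ ε ∈ G, sampleLaw P n
      {x | ∃ θ ∈ A, c < |(√(n : ℝ))⁻¹ * rad ε fun i => h θ (x i)|} ≤ p) :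
    ∫⁻ ε, sampleLaw P n {x | ∃ θ ∈ A,
        2 * s < |(√(n : ℝ))⁻¹ * rad ε fun i => Φ (x i) (h θ (x i))|} ∂signLaw (Fin n) ≤
      12 * (p + signLaw (Fin n) Gᶜ) + ENNReal.ofReal (16 * L * c / s) := by
  have hB : MeasurableSet (gridExceed P h A (n := n) (fun _ t => t) (2 * c * √(n : ℝ))) :=
    measurableSet_gridExceed (Ψ := fun _ t => t) (fun _ => measurable_const) _
  have hD : MeasurableSet (gridExceed P h A (n := n) Φ (s * √(n : ℝ))) :=
    measurableSet_gridExceed hΦm _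
  refine (lintegral_mono fun ε => measure_mono
    (setOf_exists_lt_rad_subset_gridExceed (P := P) hn hL hΦ hns ε)).trans ?_
  rw [← Measure.prod_apply hD]
  refine (prod_le_of_section_le hB hD (a := 12⁻¹) (by simp) (by simp) fun x hx =>
    signLaw_gridExceed_comp_le hn hL hc hs hΦ0 hΦ hx).trans ?_
  rw [inv_inv]
  gcongr
  exact prod_gridExceed_le hn hnc hG

theorem sampleLaw_exists_lt_sampleProc_comp_le [IsProbabilityMeasure P] (hn : 0 < n)
    (hL : 0 ≤ L) (hc : 0 < c) (hs : 0 < s) {Φ : S → ℝ → ℝ} (hΦm : ∀ t, Measurable fun x => Φ x t)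
    (hΦ0 : ∀ x, Φ x 0 = 0) (hΦ : ∀ x a b, |Φ x a - Φ x b| ≤ L * |a - b|)
    (hnc : (√(n : ℝ))⁻¹ ≤ c) (hns : L * (√(n : ℝ))⁻¹ ≤ s) {p : ℝ≥0∞} {G : Set (Fin n → Bool)}
    (hG : ∀ ε ∈ G, sampleLaw P n
      {x | ∃ θ ∈ A, c < |(√(n : ℝ))⁻¹ * rad ε fun i => h θ (x i)|} ≤ p)
    (hcheb : ∀ θ ∈ A, sampleLaw P n {x | 4 * s ≤ |sampleProc P n (fun y => Φ y (h θ y)) x|} ≤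
      1 / 2) :
    sampleLaw P n {x | ∃ θ ∈ A, 8 * s < |sampleProc P n (fun y => Φ y (h θ y)) x|} ≤
      4 * (12 * (p + signLaw (Fin n) Gᶜ) + ENNReal.ofReal (16 * L * c / s)) := by
  have hsym := lintegral_mono (μ := signLaw (Fin n))
    (sampleLaw_exists_lt_sampleProc_le_rad P (fun θ y => Φ y (h θ y)) A hcheb)
  rw [lintegral_const, measure_univ, mul_one, lintegral_const_mul _ .of_discrete] at hsym
  rw [show 2 * (4 * s) = 8 * s by ring, show 4 * s / 2 = 2 * s by ring] at hsym
  refine hsym.trans ?_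
  gcongr
  exact lintegral_sampleLaw_exists_lt_rad_comp_le hn hL hc hs hΦm hΦ0 hΦ hnc hns hG

end Grid

/-! ### Stochastic equicontinuity -/

/-- Stochastic equicontinuity along a filter on the index set: the functions `h θ` are small in
`L₂(P)` and the empirical process is small uniformly over a neighbourhood, in outer probability. -/
structure StochEquicont {S : Type*} [MeasurableSpace S] (P : Measure S) [IsProbabilityMeasure P]
    {Θ : Type*} (𝓛 : Filter Θ) (h : Θ → S → ℝ) : Prop where
  memLp : ∀ᶠ θ in 𝓛, MemLp (h θ) 2 P
  small : Tendsto (fun θ => ∫ y, h θ y ^ 2 ∂P) 𝓛 (𝓝 0)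
  equi : ∀ e : ℝ, 0 < e → ∃ A ∈ 𝓛, ∀ᶠ n in atTop,
    sampleLaw P n {x | ∃ θ ∈ A, e < |sampleProc P n (h θ) x|} ≤ ENNReal.ofReal e

section StochEquicont

variable {S : Type*} [MeasurableSpace S] {P : Measure S} {Θ : Type*} {𝓛 : Filter Θ}
  {h : Θ → S → ℝ}

section Lipschitz

variable {Φ : S → ℝ → ℝ} {L : ℝ} (hΦm : Measurable (Function.uncurry Φ)) (hΦ0 : ∀ x, Φ x 0 = 0)
  (hΦ : ∀ x a b, |Φ x a - Φ x b| ≤ L * |a - b|)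
include hΦm hΦ0 hΦ

theorem memLp_comp_lipschitz {f : S → ℝ} (hf : MemLp f 2 P) :
    MemLp (fun x => Φ x (f x)) 2 P := by
  refine hf.of_le_mul (c := L) (hΦm.comp_aemeasurable
    (aemeasurable_id.prodMk hf.1.aemeasurable)).aestronglyMeasurable (ae_of_all _ fun x => ?_)
  simpa [hΦ0] using hΦ x (f x) 0

theorem integral_sq_comp_lipschitz_le {f : S → ℝ} (hf : MemLp f 2 P) :
    ∫ x, Φ x (f x) ^ 2 ∂P ≤ L ^ 2 * ∫ x, f x ^ 2 ∂P := by
  rw [← integral_const_mul]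
  refine integral_mono (memLp_comp_lipschitz hΦm hΦ0 hΦ hf).integrable_sq
    (hf.integrable_sq.const_mul _) fun x => ?_
  have hx : |Φ x (f x)| ≤ L * |f x| := by simpa [hΦ0] using hΦ x (f x) 0
  simpa [mul_pow] using pow_le_pow_left₀ (abs_nonneg _) hx 2

theorem tendsto_integral_sq_comp_lipschitz (hmem : ∀ᶠ θ in 𝓛, MemLp (h θ) 2 P)
    (hsmall : Tendsto (fun θ => ∫ y, h θ y ^ 2 ∂P) 𝓛 (𝓝 0)) :
    Tendsto (fun θ => ∫ y, Φ y (h θ y) ^ 2 ∂P) 𝓛 (𝓝 0) :=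
  squeeze_zero' (Eventually.of_forall fun θ => integral_nonneg fun y => sq_nonneg _)
    (hmem.mono fun _ hθ => integral_sq_comp_lipschitz_le hΦm hΦ0 hΦ hθ)
    (by simpa using hsmall.const_mul (L ^ 2))

end Lipschitz

theorem sampleProc_add {f g : S → ℝ} (hf : Integrable f P) (hg : Integrable g P) (n : ℕ)
    (x : Fin n → S) :
    sampleProc P n (fun y => f y + g y) x = sampleProc P n f x + sampleProc P n g x := by
  rw [sampleProc, sampleProc, sampleProc, ← mul_add, ← Finset.sum_add_distrib,
    integral_add hf hg]
  simp only [add_sub_add_comm]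

variable [IsProbabilityMeasure P]

theorem sq_integral_le {f : S → ℝ} (hf : MemLp f 2 P) : (∫ y, f y ∂P) ^ 2 ≤ ∫ y, f y ^ 2 ∂P := by
  simpa [variance_eq_sub hf] using variance_nonneg f P

theorem sampleLaw_le_abs_sampleProc_le_half {f : S → ℝ} (hf : MemLp f 2 P) {n : ℕ} {t : ℝ}
    (ht : 0 < t) (hft : 2 * ∫ y, f y ^ 2 ∂P ≤ t ^ 2) :
    sampleLaw P n {x | t ≤ |sampleProc P n f x|} ≤ 1 / 2 := by
  have e : (1 / 2 : ℝ≥0∞) = ENNReal.ofReal (1 / 2) := by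
    rw [ENNReal.ofReal_div_of_pos two_pos]
    simp
  rw [e]
  refine (chebyshev_sampleProc hf n ht).trans (ENNReal.ofReal_le_ofReal ?_)
  rw [div_le_iff₀ (by positivity)]
  linarith

theorem sampleLaw_exists_lt_rad_le {A : Set Θ} {c m K : ℝ} {p : ℝ≥0∞} {k₀ n : ℕ} (hn : 0 < n)
    (hp : ∀ k ≥ k₀, sampleLaw P k {x | ∃ θ ∈ A, c < |sampleProc P k (h θ) x|} ≤ p)
    (hmean : ∀ θ ∈ A, |∫ y, h θ y ∂P| ≤ m) (hbig : 2 * k₀ ≤ n - K * √(n : ℝ))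
    {ε : Fin n → Bool} (hε : |∑ i, sgn (ε i)| ≤ K * √(n : ℝ)) :
    sampleLaw P n {x | ∃ θ ∈ A, 2 * c + K * m < |(√(n : ℝ))⁻¹ * rad ε fun i => h θ (x i)|} ≤
      2 * p := by
  have hrt : 0 < √(n : ℝ) := Real.sqrt_pos.2 (by exact_mod_cast hn)
  have hdiff := sum_sgn_eq ε
  have hcard : ((Finset.univ.filter (ε · = true)).card : ℝ) +
      (Finset.univ.filter (ε · = false)).card = n := by
    have := Finset.card_filter_add_card_filter_not (s := Finset.univ) (ε · = true)
    simp only [Bool.not_eq_true, Finset.card_univ, Fintype.card_fin] at this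
    exact_mod_cast this
  have hbal := abs_le.1 hε
  have htrue : (k₀ : ℝ) ≤ (Finset.univ.filter (ε · = true)).card := by linarith [hbal.1]
  have hfalse : (k₀ : ℝ) ≤ (Finset.univ.filter (ε · = false)).card := by linarith [hbal.2]
  refine le_trans (measure_mono ?_) (sampleLaw_exists_lt_rad_sub_le P h A hp ε
    (by exact_mod_cast htrue) (by exact_mod_cast hfalse))
  rintro x ⟨θ, hθ, hx⟩
  have hcenter : (√(n : ℝ))⁻¹ * rad ε (fun i => h θ (x i) - ∫ y, h θ y ∂P) =
      (√(n : ℝ))⁻¹ * rad ε (fun i => h θ (x i)) -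
        (√(n : ℝ))⁻¹ * ((∑ i, sgn (ε i)) * ∫ y, h θ y ∂P) := by
    rw [← mul_sub, Finset.sum_mul, rad, rad, ← Finset.sum_sub_distrib]
    simp only [mul_sub]
  have hshift : |(√(n : ℝ))⁻¹ * ((∑ i, sgn (ε i)) * ∫ y, h θ y ∂P)| ≤ K * m := by
    rw [abs_mul, abs_mul, abs_of_pos (inv_pos.2 hrt), inv_mul_le_iff₀ hrt]
    calc _ ≤ (K * √(n : ℝ)) * m :=
          mul_le_mul hε (hmean θ hθ) (abs_nonneg _) ((abs_nonneg _).trans hε)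
      _ = √(n : ℝ) * (K * m) := by ring
  refine ⟨θ, hθ, ?_⟩
  rw [hcenter]
  linarith [abs_sub_abs_le_abs_sub ((√(n : ℝ))⁻¹ * rad ε (fun i => h θ (x i)))
    ((√(n : ℝ))⁻¹ * ((∑ i, sgn (ε i)) * ∫ y, h θ y ∂P))]

theorem contraction_constants_le {e s K η L : ℝ} (hs : 0 < s) (hL : 0 ≤ L) (hη : 0 ≤ η)
    (hηe : η * (96 + 192 * L / s) = e / 2) (hK : 1 / K ^ 2 = e / 100) {u : ℝ≥0∞}
    (hu : u ≤ ENNReal.ofReal (1 / K ^ 2)) :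
    4 * (12 * (2 * ENNReal.ofReal η + u) + ENNReal.ofReal (16 * L * (3 * η) / s)) ≤
      ENNReal.ofReal e := by
  have hK0 : 0 ≤ 1 / K ^ 2 := by positivity
  calc _ ≤ ENNReal.ofReal 4 * (ENNReal.ofReal 12 * (ENNReal.ofReal 2 * ENNReal.ofReal η +
        ENNReal.ofReal (1 / K ^ 2)) + ENNReal.ofReal (16 * L * (3 * η) / s)) := by
        simp only [ENNReal.ofReal_ofNat]
        gcongr
    _ = ENNReal.ofReal (4 * (12 * (2 * η + 1 / K ^ 2) + 16 * L * (3 * η) / s)) := by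
        rw [← ENNReal.ofReal_mul (by positivity), ← ENNReal.ofReal_add (by positivity) hK0,
          ← ENNReal.ofReal_mul (by positivity), ← ENNReal.ofReal_add (by positivity)
          (by positivity), ← ENNReal.ofReal_mul (by positivity)]
    _ ≤ ENNReal.ofReal e := by
        refine ENNReal.ofReal_le_ofReal ?_
        have : 4 * (16 * L * (3 * η) / s) = η * (192 * L / s) := by ring
        linarith

theorem signLaw_compl_balanced_le {n : ℕ} (hn : 0 < n) {K : ℝ} (hK : 0 < K) :
    signLaw (Fin n) {ε | |∑ i, sgn (ε i)| ≤ K * √(n : ℝ)}ᶜ ≤ ENNReal.ofReal (1 / K ^ 2) := by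
  rw [← ofReal_measureReal]
  refine ENNReal.ofReal_le_ofReal ((measureReal_mono fun ε hε => ?_).trans
    (signLaw_unbalanced_le hn hK))
  simpa using hε

theorem StochEquicont.comp_lipschitz (hh : StochEquicont P 𝓛 h) {Φ : S → ℝ → ℝ}
    (hΦm : Measurable (Function.uncurry Φ)) {L : ℝ} (hL : 0 ≤ L) (hΦ0 : ∀ x, Φ x 0 = 0)
    (hΦ : ∀ x a b, |Φ x a - Φ x b| ≤ L * |a - b|) :
    StochEquicont P 𝓛 fun θ x => Φ x (h θ x) := by
  have hsmall := tendsto_integral_sq_comp_lipschitz hΦm hΦ0 hΦ hh.memLp hh.small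
  refine ⟨hh.memLp.mono fun θ hθ => memLp_comp_lipschitz hΦm hΦ0 hΦ hθ, hsmall, fun e he => ?_⟩
  obtain ⟨s, hs, rfl⟩ : ∃ s, 0 < s ∧ 8 * s = e := ⟨e / 8, by positivity, by ring⟩
  obtain ⟨K, hK, hK2⟩ : ∃ K, 0 < K ∧ 1 / K ^ 2 = 8 * s / 100 :=
    ⟨10 / √(8 * s), by positivity, by rw [div_pow, Real.sq_sqrt he.le]; norm_num⟩
  obtain ⟨η, hη, hηe⟩ : ∃ η, 0 < η ∧ η * (96 + 192 * L / s) = 8 * s / 2 :=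
    ⟨8 * s / 2 / (96 + 192 * L / s), by positivity, div_mul_cancel₀ _ (by positivity)⟩
  obtain ⟨A₀, hA₀, hA₀n⟩ := hh.equi η hη
  obtain ⟨k₀, hk₀⟩ := eventually_atTop.1 hA₀n
  refine ⟨{θ | θ ∈ A₀ ∧ MemLp (h θ) 2 P ∧ ∫ y, h θ y ^ 2 ∂P < (η / K) ^ 2 ∧
    ∫ y, Φ y (h θ y) ^ 2 ∂P < (4 * s) ^ 2 / 2}, ?_, ?_⟩
  · filter_upwards [hA₀, hh.memLp,
      hh.small.eventually_lt_const (by positivity : 0 < (η / K) ^ 2),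
      hsmall.eventually_lt_const (by positivity : 0 < (4 * s) ^ 2 / 2)] with θ h₀ hmem hθ hΦθ
      using ⟨h₀, hmem, hθ, hΦθ⟩
  have hsq : Tendsto (fun n : ℕ => √(n : ℝ)) atTop atTop :=
    Real.tendsto_sqrt_atTop.comp tendsto_natCast_atTop_atTop
  filter_upwards [eventually_gt_atTop 0, hsq.eventually_ge_atTop (K + 2 * k₀ + 1),
    hsq.eventually_ge_atTop (1 / (3 * η)), hsq.eventually_ge_atTop (L / s)] with n hn hnk hnη hnL
  have hrt : 0 < √(n : ℝ) := Real.sqrt_pos.2 (by exact_mod_cast hn)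
  have hbig : 2 * (k₀ : ℝ) ≤ n - K * √(n : ℝ) := by
    nlinarith [Real.mul_self_sqrt (n.cast_nonneg : (0 : ℝ) ≤ n), (k₀.cast_nonneg : (0 : ℝ) ≤ k₀)]
  refine (sampleLaw_exists_lt_sampleProc_comp_le (Φ := Φ) (c := 3 * η) (p := 2 * ENNReal.ofReal η)
    (G := {ε | |∑ i, sgn (ε i)| ≤ K * √(n : ℝ)}) hn hL (by positivity) hs
    (fun t => hΦm.comp measurable_prodMk_right) hΦ0 hΦ ?_ ?_ ?_ ?_).trans
    (contraction_constants_le hs hL hη.le hηe hK2 (signLaw_compl_balanced_le hn hK))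
  · rwa [inv_le_comm₀ hrt (by positivity), ← one_div]
  · rwa [← div_eq_mul_inv, div_le_comm₀ hrt hs]
  · intro ε hε
    have hlevel : 2 * η + K * (η / K) = 3 * η := by
      field_simp
      ring
    rw [← hlevel]
    refine sampleLaw_exists_lt_rad_le hn (fun k hk => (measure_mono ?_).trans (hk₀ k hk)) ?_ hbig hε
    · rintro x ⟨θ, hθ, hx⟩
      exact ⟨θ, hθ.1, hx⟩
    · rintro θ ⟨-, hmem, hθ, -⟩
      exact abs_le_of_sq_le_sq ((sq_integral_le hmem).trans hθ.le) (by positivity)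
  · rintro θ ⟨-, hmem, -, hΦθ⟩
    exact sampleLaw_le_abs_sampleProc_le_half (memLp_comp_lipschitz hΦm hΦ0 hΦ hmem)
      (by positivity) (by linarith)

theorem StochEquicont.add (hh : StochEquicont P 𝓛 h) {k : Θ → S → ℝ}
    (hk : StochEquicont P 𝓛 k) : StochEquicont P 𝓛 fun θ x => h θ x + k θ x := by
  refine ⟨?_, ?_, fun e he => ?_⟩
  · filter_upwards [hh.memLp, hk.memLp] with θ hhθ hkθ using hhθ.add hkθ
  · refine squeeze_zero' (Eventually.of_forall fun θ => integral_nonneg fun y => sq_nonneg _)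
      (g := fun θ => 2 * ∫ y, h θ y ^ 2 ∂P + 2 * ∫ y, k θ y ^ 2 ∂P) ?_
      (by simpa using (hh.small.const_mul 2).add (hk.small.const_mul 2))
    filter_upwards [hh.memLp, hk.memLp] with θ hhθ hkθ
    have hhi := hhθ.integrable_sq.const_mul 2
    have hki := hkθ.integrable_sq.const_mul 2
    rw [← integral_const_mul, ← integral_const_mul, ← integral_add hhi hki]
    refine integral_mono (hhθ.add hkθ).integrable_sq (hhi.add hki) fun y => ?_
    simpa [mul_add] using add_sq_le (a := h θ y) (b := k θ y)
  · obtain ⟨A, hA, hAn⟩ := hh.equi (e / 2) (by positivity)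
    obtain ⟨B, hB, hBn⟩ := hk.equi (e / 2) (by positivity)
    refine ⟨{θ | θ ∈ A ∧ θ ∈ B ∧ MemLp (h θ) 2 P ∧ MemLp (k θ) 2 P}, ?_, ?_⟩
    · filter_upwards [hA, hB, hh.memLp, hk.memLp] with θ hθA hθB hhθ hkθ
        using ⟨hθA, hθB, hhθ, hkθ⟩
    filter_upwards [hAn, hBn] with n hn hn'
    rw [← add_halves e, ENNReal.ofReal_add (by positivity) (by positivity), add_halves]
    refine le_trans (measure_mono ?_) ((measure_union_le _ _).trans (add_le_add hn hn'))
    rintro x ⟨θ, ⟨hθA, hθB, hhθ, hkθ⟩, hx⟩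
    rw [sampleProc_add (hhθ.integrable one_le_two) (hkθ.integrable one_le_two)] at hx
    by_contra hcon
    simp only [Set.mem_union, Set.mem_ofPred_eq, not_or, not_exists, not_and, not_lt] at hcon
    linarith [abs_add_le (sampleProc P n (h θ) x) (sampleProc P n (k θ) x), hcon.1 θ hθA,
      hcon.2 θ hθB]

theorem StochEquicont.mul_left (hh : StochEquicont P 𝓛 h) {w : S → ℝ} (hw : Measurable w) {C : ℝ}
    (hC : ∀ x, |w x| ≤ C) : StochEquicont P 𝓛 fun θ x => w x * h θ x := by
  refine hh.comp_lipschitz (Φ := fun x t => w x * t) (L := max C 0)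
    ((hw.comp measurable_fst).mul measurable_snd) (le_max_right _ _) (fun x => mul_zero _)
    fun x a b => ?_
  rw [← mul_sub, abs_mul]
  exact mul_le_mul_of_nonneg_right ((hC x).trans (le_max_left _ _)) (abs_nonneg _)

theorem StochEquicont.comp_sub {f : Θ → S → ℝ} {f₀ : S → ℝ} (hf₀ : Measurable f₀)
    (hh : StochEquicont P 𝓛 fun θ x => f θ x - f₀ x) {T : ℝ → ℝ} (hT : Measurable T) {L : ℝ}
    (hL : 0 ≤ L) (hTL : ∀ a b, |T a - T b| ≤ L * |a - b|) :
    StochEquicont P 𝓛 fun θ x => T (f θ x) - T (f₀ x) := by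
  have := hh.comp_lipschitz (Φ := fun x t => T (f₀ x + t) - T (f₀ x)) (L := L)
    ((hT.comp ((hf₀.comp measurable_fst).add measurable_snd)).sub
      (hT.comp (hf₀.comp measurable_fst))) hL (fun x => by simp) fun x a b => by
        rw [sub_sub_sub_cancel_right]
        simpa using hTL (f₀ x + a) (f₀ x + b)
  simpa using this

/-- The truncation of a real number to the interval `[a, b]`. -/
def clip (a b u : ℝ) : ℝ := max a (min b u)

theorem abs_clip_sub_le (a b u v : ℝ) : |clip a b u - clip a b v| ≤ |u - v| := by
  simp only [clip, max_comm a, min_comm b]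
  exact (abs_sup_sub_sup_le_abs _ _ _).trans (abs_inf_sub_inf_le_abs _ _ _)

theorem measurable_clip (a b : ℝ) : Measurable (clip a b) :=
  measurable_const.max (measurable_const.min measurable_id)

theorem le_clip (a b u : ℝ) : a ≤ clip a b u := le_max_left _ _

theorem clip_le {a b : ℝ} (hab : a ≤ b) (u : ℝ) : clip a b u ≤ b := max_le hab (min_le_left _ _)

theorem clip_eq {a b u : ℝ} (ha : a ≤ u) (hb : u ≤ b) : clip a b u = u := by
  rw [clip, min_eq_right hb, max_eq_right ha]

theorem abs_clip_le {C : ℝ} (hC : 0 ≤ C) (u : ℝ) : |clip (-C) C u| ≤ C :=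
  abs_le.2 ⟨le_clip _ _ _, clip_le (by linarith) _⟩

theorem StochEquicont.sq (hh : StochEquicont P 𝓛 h) {C : ℝ} (hC : 0 ≤ C)
    (hhC : ∀ θ x, |h θ x| ≤ C) : StochEquicont P 𝓛 fun θ x => h θ x ^ 2 := by
  have hclip : StochEquicont P 𝓛 fun θ x => clip (-C) C (h θ x) ^ 2 := by
    refine hh.comp_lipschitz (Φ := fun _ t => clip (-C) C t ^ 2) (L := 2 * C)
      (((measurable_clip _ _).comp measurable_snd).pow_const 2) (by positivity)
      (fun _ => by simp [clip_eq (neg_nonpos.2 hC) hC]) fun x a b => ?_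
    rw [sq_sub_sq, abs_mul]
    refine mul_le_mul ((abs_add_le _ _).trans ?_) (abs_clip_sub_le _ _ _ _) (abs_nonneg _)
      (by positivity)
    linarith [abs_clip_le hC a, abs_clip_le hC b]
  convert hclip using 4
  exact (clip_eq (abs_le.1 (hhC _ _)).1 (abs_le.1 (hhC _ _)).2).symm

theorem StochEquicont.mul {p q : Θ → S → ℝ} (hp : StochEquicont P 𝓛 p)
    (hq : StochEquicont P 𝓛 q) {C : ℝ} (hC : 0 ≤ C) (hpC : ∀ θ x, |p θ x| ≤ C)
    (hqC : ∀ θ x, |q θ x| ≤ C) : StochEquicont P 𝓛 fun θ x => p θ x * q θ x := by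
  have hconst (c : ℝ) {k : Θ → S → ℝ} (hk : StochEquicont P 𝓛 k) :
      StochEquicont P 𝓛 fun θ x => c * k θ x :=
    hk.mul_left (w := fun _ => c) measurable_const fun _ => le_rfl
  have hadd := (hp.add hq).sq (C := 2 * C) (by positivity) fun θ x =>
    (abs_add_le _ _).trans (by linarith [hpC θ x, hqC θ x])
  have hsub := (hp.add (hconst (-1) hq)).sq (C := 2 * C) (by positivity) fun θ x =>
    (abs_add_le _ _).trans (by rw [neg_one_mul, abs_neg]; linarith [hpC θ x, hqC θ x])
  convert (hconst (1 / 4) hadd).add (hconst (-(1 / 4)) hsub) using 3 with θ x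
  ring

theorem StochEquicont.mul_sub {u v : Θ → S → ℝ} {u₀ v₀ : S → ℝ}
    (hu : StochEquicont P 𝓛 fun θ x => u θ x - u₀ x)
    (hv : StochEquicont P 𝓛 fun θ x => v θ x - v₀ x) (hu₀ : Measurable u₀) (hv₀ : Measurable v₀)
    {C : ℝ} (hC : 0 ≤ C) (huC : ∀ θ x, |u θ x| ≤ C) (hvC : ∀ θ x, |v θ x| ≤ C)
    (hu₀C : ∀ x, |u₀ x| ≤ C) (hv₀C : ∀ x, |v₀ x| ≤ C) :
    StochEquicont P 𝓛 fun θ x => u θ x * v θ x - u₀ x * v₀ x := by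
  have hprod := hu.mul hv (C := 2 * C) (by positivity)
    (fun θ x => (abs_sub _ _).trans (by linarith [huC θ x, hu₀C x]))
    (fun θ x => (abs_sub _ _).trans (by linarith [hvC θ x, hv₀C x]))
  convert ((hu.mul_left hv₀ hv₀C).add (hv.mul_left hu₀ hu₀C)).add hprod using 3 with θ x
  ring

end StochEquicont

/-! ### Donsker classes are stochastically equicontinuous -/

section Splice

variable {S : Type*}

/-- Replacement of the first `n` terms of a sequence; it identifies the law of a sequence with the
product of the law of its first `n` terms and the law of a sequence. -/
def splice {n : ℕ} (p : (Fin n → S) × (ℕ → S)) (i : ℕ) : S :=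
  if h : i < n then p.1 ⟨i, h⟩ else p.2 i

theorem splice_of_lt {n : ℕ} (p : (Fin n → S) × (ℕ → S)) {i : ℕ} (h : i < n) :
    splice p i = p.1 ⟨i, h⟩ := dif_pos h

theorem splice_of_not_lt {n : ℕ} (p : (Fin n → S) × (ℕ → S)) {i : ℕ} (h : ¬ i < n) :
    splice p i = p.2 i := dif_neg h

theorem preimage_splice_pi (n : ℕ) (s : Finset ℕ) (t : ℕ → Set S) :
    splice (n := n) ⁻¹' Set.pi s t =
      (Set.pi Set.univ fun i : Fin n => if (i : ℕ) ∈ s then t i else Set.univ) ×ˢ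
        Set.pi (s.filter fun i => ¬ i < n) t := by
  ext p
  simp only [Set.mem_preimage, Set.mem_pi, Set.mem_prod, Set.mem_univ, true_imp_iff,
    Finset.mem_coe, Finset.mem_filter]
  refine ⟨fun hp => ⟨fun i => ?_, fun i hi => ?_⟩, fun ⟨hlt, hge⟩ i hi => ?_⟩
  · split_ifs with his
    · simpa [splice_of_lt p i.2] using hp i his
    · trivial
  · simpa [splice_of_not_lt p hi.2] using hp i hi.1
  · by_cases hin : i < n
    · simpa [splice_of_lt p hin, hi] using hlt ⟨i, hin⟩
    · simpa [splice_of_not_lt p hin] using hge i ⟨hi, hin⟩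

variable [MeasurableSpace S]

theorem measurable_splice (n : ℕ) : Measurable (splice (S := S) (n := n)) := by
  refine measurable_pi_lambda _ fun i => ?_
  by_cases h : i < n
  · simp only [splice, h, dif_pos]
    fun_prop
  · simp only [splice, h, dif_neg, not_false_eq_true]
    fun_prop

variable {P : Measure S} [IsProbabilityMeasure P]

theorem measurePreserving_splice (n : ℕ) :
    MeasurePreserving (splice (S := S) (n := n))
      ((sampleLaw P n).prod (Measure.infinitePi fun _ : ℕ => P))
      (Measure.infinitePi fun _ : ℕ => P) := by
  refine ⟨measurable_splice n, Measure.eq_infinitePi _ fun s t ht => ?_⟩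
  have hhead : ∏ i : Fin n, P (if (i : ℕ) ∈ s then t i else Set.univ) =
      ∏ i ∈ s.filter fun i => i < n, P (t i) := by
    simp only [apply_ite P, measure_univ]
    rw [← Finset.prod_range fun i => if i ∈ s then P (t i) else 1, ← Finset.prod_filter]
    refine Finset.prod_congr (Finset.ext fun i => ?_) fun _ _ => rfl
    simp [and_comm]
  rw [Measure.map_apply (measurable_splice n)
    (MeasurableSet.pi s.countable_toSet fun i _ => ht i), preimage_splice_pi, Measure.prod_prod,
    sampleLaw, Measure.pi_pi, Measure.infinitePi_pi _ fun i _ => ht i, hhead,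
    Finset.prod_filter_mul_prod_filter_not]

theorem sampleLaw_le_infinitePi (n : ℕ) (B : Set (Fin n → S)) :
    sampleLaw P n B ≤ Measure.infinitePi (fun _ : ℕ => P) {s | (fun i : Fin n => s i) ∈ B} := by
  set μ := Measure.infinitePi fun _ : ℕ => P
  set C := toMeasurable μ {s | (fun i : Fin n => s i) ∈ B}
  have hC : MeasurableSet C := measurableSet_toMeasurable _ _
  have hC' : MeasurableSet (splice (n := n) ⁻¹' C) := measurable_splice n hC
  have hsub : B ⊆ {x | 1 ≤ μ (Prod.mk x ⁻¹' (splice (n := n) ⁻¹' C))} := by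
    intro x hx
    have hfull : Prod.mk x ⁻¹' (splice (n := n) ⁻¹' C) = Set.univ := by
      refine Set.eq_univ_of_forall fun s => subset_toMeasurable _ _ ?_
      change (fun i : Fin n => splice (x, s) i) ∈ B
      simpa [splice_of_lt] using hx
    rw [Set.mem_ofPred_eq, hfull, measure_univ]
  refine (measure_mono hsub).trans ?_
  have hmarkov := mul_meas_ge_le_lintegral (μ := sampleLaw P n)
    (measurable_measure_prodMk_left (ν := μ) hC') 1
  rwa [← Measure.prod_apply hC', one_mul,
    (measurePreserving_splice n).measure_preimage hC.nullMeasurableSet,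
    measure_toMeasurable] at hmarkov

end Splice

section Donsker

variable {S : Type*} [MeasurableSpace S] {P : Measure S}

theorem empProc_eq_sampleProc (s : ℕ → S) (n : ℕ) (f : S → ℝ) :
    empProc P s n f = sampleProc P n f fun i => s i := by
  rcases Nat.eq_zero_or_pos n with rfl | hn
  · simp [empProc, sampleProc]
  have hn' : (0 : ℝ) < n := by exact_mod_cast hn
  have hrt : √(n : ℝ) ≠ 0 := (Real.sqrt_pos.2 hn').ne'
  rw [empProc, empMean, sampleProc, Finset.sum_sub_distrib, Finset.sum_range fun i => f (s i),
    Fin.sum_const, nsmul_eq_mul]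
  field_simp
  rw [Real.sq_sqrt hn'.le]

theorem sampleProc_fun_sub {f g : S → ℝ} (hf : Integrable f P) (hg : Integrable g P) (n : ℕ)
    (x : Fin n → S) :
    sampleProc P n (fun y => f y - g y) x = sampleProc P n f x - sampleProc P n g x := by
  rw [sampleProc, sampleProc, sampleProc, ← mul_sub, ← Finset.sum_sub_distrib,
    integral_sub hf hg]
  simp only [sub_sub_sub_comm]

theorem measure_one_le_le_of_outerExp_lt {Ω : Type*} [MeasurableSpace Ω] {μ : Measure Ω}
    [IsFiniteMeasure μ] {f : Ω → ℝ} (hf₀ : ∀ ω, 0 ≤ f ω) (hf₁ : ∀ ω, f ω ≤ 1) {c : ℝ}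
    (h : outerExp μ f < c) : μ {ω | 1 ≤ f ω} ≤ ENNReal.ofReal c := by
  obtain ⟨_, ⟨U, -, hUi, hfU, rfl⟩, hUc⟩ := exists_lt_of_csInf_lt (by
    exact ⟨_, fun _ => 1, measurable_const, integrable_const 1, ae_of_all _ hf₁, rfl⟩) h
  have hmarkov := mul_meas_ge_le_integral_of_nonneg (hfU.mono fun ω hω => (hf₀ ω).trans hω) hUi 1
  rw [one_mul] at hmarkov
  calc μ {ω | 1 ≤ f ω} ≤ μ {ω | 1 ≤ U ω} := measure_mono_ae (hfU.mono fun ω hω h => h.trans hω)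
    _ = ENNReal.ofReal (μ.real {ω | 1 ≤ U ω}) := (ofReal_measureReal).symm
    _ ≤ ENNReal.ofReal c := ENNReal.ofReal_le_ofReal (hmarkov.trans hUc.le)

theorem WeakConvOuter.exists_isCompact_thickening {Ω D : Type*} [MeasurableSpace Ω]
    [PseudoMetricSpace D] [MeasurableSpace D] [BorelSpace D] {μ : Measure Ω} [IsFiniteMeasure μ]
    {G : ℕ → Ω → D} {L : Measure D} [IsFiniteMeasure L] (hG : WeakConvOuter μ G L)
    (hL : IsTightMeasureSet {L}) {r ε : ℝ} (hr : 0 < r) (hε : 0 < ε) :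
    ∃ K : Set D, IsCompact K ∧
      ∀ᶠ n in atTop, μ {ω | G n ω ∉ Metric.thickening r K} ≤ ENNReal.ofReal ε := by
  obtain ⟨K, hK, hKL⟩ := isTightMeasureSet_iff_exists_isCompact_measure_compl_le.1 hL
    (ENNReal.ofReal (ε / 2)) (by simpa using hε)
  refine ⟨K, hK, ?_⟩
  let φ : BoundedContinuousFunction D ℝ :=
    BoundedContinuousFunction.const D 1 -
      (thickenedIndicator hr K).comp _ NNReal.isometry_coe.lipschitz
  have hφ (z : D) : φ z = 1 - (thickenedIndicator hr K z : ℝ) := rfl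
  have hφ₀ (z : D) : 0 ≤ φ z := by
    rw [hφ, sub_nonneg]
    exact_mod_cast thickenedIndicator_le_one hr K z
  have hφ₁ (z : D) : φ z ≤ 1 := by
    rw [hφ]
    linarith [(thickenedIndicator hr K z).2]
  have hint : ∫ z, φ z ∂L < ε := by
    calc ∫ z, φ z ∂L ≤ ∫ z, (closure K)ᶜ.indicator 1 z ∂L := by
          refine integral_mono (φ.integrable L)
            ((integrable_const 1).indicator isClosed_closure.measurableSet.compl) fun z => ?_
          by_cases hz : z ∈ closure K
          · simp [hφ, thickenedIndicator_one_of_mem_closure hr K hz, hz]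
          · simpa [hz] using hφ₁ z
      _ = L.real (closure K)ᶜ := integral_indicator_one isClosed_closure.measurableSet.compl
      _ ≤ L.real Kᶜ := measureReal_mono (Set.compl_subset_compl.2 subset_closure)
      _ ≤ ε / 2 := ENNReal.toReal_le_of_le_ofReal (by positivity) (hKL L rfl)
      _ < ε := half_lt_self hε
  filter_upwards [(hG φ).eventually_lt_const hint] with n hn
  refine (measure_mono fun ω hω => ?_).trans
    (measure_one_le_le_of_outerExp_lt (fun ω => hφ₀ _) (fun ω => hφ₁ _) hn)
  rw [Set.mem_ofPred_eq, hφ, thickenedIndicator_zero hr K hω, NNReal.coe_zero, sub_zero]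

variable [IsProbabilityMeasure P] {F : Set (S → ℝ)}

theorem IsDonsker.exists_finite_net (hF : IsDonsker P F) {η ε : ℝ} (hη : 0 < η) (hε : 0 < ε) :
    ∃ t : Set (Linf F), t.Finite ∧ ∀ᶠ n in atTop, Measure.infinitePi (fun _ : ℕ => P)
      {s | ¬ ∃ z ∈ t, ∀ f : F, |empProc P s n f - z f| ≤ η} ≤ ENNReal.ofReal ε := by
  obtain ⟨-, hbdd, L, hL, hLt, hconv⟩ := hF
  let _ : MeasurableSpace (Linf F) := borel (Linf F)
  have : BorelSpace (Linf F) := ⟨rfl⟩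
  have : IsProbabilityMeasure L := ⟨hL⟩
  obtain ⟨K, hK, hKn⟩ := hconv.exists_isCompact_thickening hLt (half_pos hη) hε
  obtain ⟨t, -, htfin, htK⟩ := hK.finite_cover_balls (half_pos hη)
  refine ⟨t, htfin, hKn.mono fun n hn => (measure_mono_ae ?_).trans hn⟩
  filter_upwards [hbdd n] with s hs hfar hnear
  obtain ⟨y, hyK, hy⟩ := Metric.mem_thickening_iff.1 hnear
  obtain ⟨z, hz, hyz⟩ := Set.mem_iUnion₂.1 (htK hyK)
  refine hfar ⟨z, hz, fun f => ?_⟩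
  have hval : toLinf F (fun f : F => empProc P s n f) f = empProc P s n f := by
    rw [toLinf, dif_pos hs]
  have hdist : dist (toLinf F fun f : F => empProc P s n f) z < η :=
    (dist_triangle _ y z).trans_lt (by linarith [Metric.mem_ball.1 hyz])
  rw [← hval, ← Real.norm_eq_abs]
  exact (lp.norm_apply_le_norm ENNReal.top_ne_zero (_ - z) f).trans
    ((dist_eq_norm _ z).symm.trans_le hdist.le)

omit [MeasurableSpace S] in
theorem exists_coloring_of_finite {t : Set (Linf F)} (ht : t.Finite) {η : ℝ} (hη : 0 < η) :
    ∃ (c : Finset (t → ℝ)) (color : F → c), ∀ g g', color g = color g' →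
      ∀ z ∈ t, |z g - z g'| ≤ η := by
  have := ht.fintype
  let vec (g : F) (z : t) : ℝ := (z : Linf F) g
  have hbdd : Bornology.IsBounded (Set.range vec) := by
    obtain ⟨C, hC⟩ := ht.isBounded.exists_norm_le
    refine isBounded_iff_forall_norm_le.2 ⟨max C 0, ?_⟩
    rintro _ ⟨g, rfl⟩
    exact (pi_norm_le_iff_of_nonneg (le_max_right _ _)).2 fun z =>
      (lp.norm_apply_le_norm ENNReal.top_ne_zero (z : Linf F) g).trans
        ((hC z z.2).trans (le_max_left _ _))
  obtain ⟨c, hcfin, hc⟩ := Metric.totallyBounded_iff.1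
    (hbdd.isCompact_closure.totallyBounded.subset subset_closure) (η / 2) (half_pos hη)
  have hnear (g : F) : ∃ v : hcfin.toFinset, dist (vec g) v < η / 2 := by
    obtain ⟨v, hv, hgv⟩ := Set.mem_iUnion₂.1 (hc ⟨g, rfl⟩)
    exact ⟨⟨v, hcfin.mem_toFinset.2 hv⟩, hgv⟩
  choose color hcolor using hnear
  refine ⟨hcfin.toFinset, color, fun g g' hgg' z hz => ?_⟩
  have hdist : dist (vec g) (vec g') ≤ η := by
    have hg' := hcolor g'
    rw [← hgg', dist_comm] at hg'
    linarith [dist_triangle (vec g) (color g) (vec g'), hcolor g]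
  exact (dist_le_pi_dist (vec g) (vec g') ⟨z, hz⟩).trans hdist

theorem IsDonsker.exists_coloring (hF : IsDonsker P F) {η ε : ℝ} (hη : 0 < η) (hε : 0 < ε) :
    ∃ (m : ℕ) (color : F → Fin m), ∀ᶠ n in atTop,
      sampleLaw P n {x | ∃ g g' : F, color g = color g' ∧
        η < |sampleProc P n g x - sampleProc P n g' x|} ≤ ENNReal.ofReal ε := by
  obtain ⟨t, htfin, ht⟩ := hF.exists_finite_net (show 0 < η / 3 by positivity) hε
  obtain ⟨c, color, hcolor⟩ := exists_coloring_of_finite htfin (show 0 < η / 3 by positivity)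
  refine ⟨c.card, c.equivFin ∘ color, ht.mono fun n hn => ?_⟩
  refine (sampleLaw_le_infinitePi n _).trans ((measure_mono ?_).trans hn)
  rintro s ⟨g, g', hgg', hlt⟩ ⟨z, hz, hzs⟩
  have hz' := hcolor g g' (c.equivFin.injective hgg') z hz
  rw [← empProc_eq_sampleProc, ← empProc_eq_sampleProc] at hlt
  have hg := abs_le.1 (hzs g)
  have hg' := abs_le.1 (hzs g')
  rw [abs_le] at hz'
  exact hlt.not_ge (abs_le.2 ⟨by linarith, by linarith⟩)

theorem sampleLaw_exists_le_abs_sampleProc_le {ι : Type*} (R : Finset ι) {k : ι → S → ℝ} {τ η : ℝ}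
    (hη : 0 < η) (hk : ∀ i ∈ R, MemLp (k i) 2 P) (hτ : ∀ i ∈ R, ∫ y, k i y ^ 2 ∂P ≤ τ) (n : ℕ) :
    sampleLaw P n {x | ∃ i ∈ R, η ≤ |sampleProc P n (k i) x|} ≤
      R.card * ENNReal.ofReal (τ / η ^ 2) := by
  calc _ = sampleLaw P n (⋃ i ∈ R, {x | η ≤ |sampleProc P n (k i) x|}) := by
        congr 1
        ext x
        simp
    _ ≤ ∑ i ∈ R, sampleLaw P n {x | η ≤ |sampleProc P n (k i) x|} :=
        measure_biUnion_finset_le _ _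
    _ ≤ ∑ _i ∈ R, ENNReal.ofReal (τ / η ^ 2) := Finset.sum_le_sum fun i hi =>
        (chebyshev_sampleProc (hk i hi) n hη).trans
          (ENNReal.ofReal_le_ofReal (div_le_div_of_nonneg_right (hτ i hi) (by positivity)))
    _ = R.card * ENNReal.ofReal (τ / η ^ 2) := by rw [Finset.sum_const, nsmul_eq_mul]

theorem exists_finset_representatives {α : Type*} {m : ℕ} (color : α → Fin m) (A : Set α) :
    ∃ R : Finset α, ↑R ⊆ A ∧ R.card ≤ m ∧ ∀ a ∈ A, ∃ r ∈ R, color r = color a := by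
  obtain ⟨R, hRA, hRcolor⟩ := Set.exists_subset_bijOn A color
  have hRfin : R.Finite := .of_injOn (fun _ _ => Set.mem_univ _) hRcolor.injOn Set.finite_univ
  refine ⟨hRfin.toFinset, by simpa using hRA, ?_, fun a ha => ?_⟩
  · simpa using Finset.card_le_card_of_injOn color (fun _ _ => Finset.mem_univ _)
      (by simpa using hRcolor.injOn)
  · obtain ⟨r, hr, hra⟩ := hRcolor.surjOn ⟨a, ha, rfl⟩
    exact ⟨r, hRfin.mem_toFinset.2 hr, hra⟩

theorem IsDonsker.stochEquicont (hF : IsDonsker P F) {Θ : Type*} {𝓛 : Filter Θ}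
    {f : Θ → S → ℝ} {f₀ : S → ℝ} (hf₀ : MemLp f₀ 2 P) (hf : ∀ᶠ θ in 𝓛, f θ ∈ F)
    (hsmall : Tendsto (fun θ => ∫ y, (f θ y - f₀ y) ^ 2 ∂P) 𝓛 (𝓝 0)) :
    StochEquicont P 𝓛 fun θ x => f θ x - f₀ x := by
  refine ⟨hf.mono fun θ hθ => (hF.1 _ hθ).2.sub hf₀, hsmall, fun e he => ?_⟩
  have hsub (g : F) : MemLp (fun y => (g : S → ℝ) y - f₀ y) 2 P := (hF.1 _ g.2).2.sub hf₀
  obtain ⟨m, color, hm⟩ := hF.exists_coloring (half_pos he) (half_pos he)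
  obtain ⟨τ, hτ, hmτ⟩ : ∃ τ, 0 < τ ∧ m * (τ / (e / 2) ^ 2) ≤ e / 2 := by
    refine ⟨(e / 2) ^ 2 * (e / 2 / (m + 1)), by positivity, ?_⟩
    rw [mul_div_cancel_left₀ _ (by positivity), ← mul_div_assoc, div_le_iff₀ (by positivity)]
    nlinarith
  -- One function close to `f₀` from each colour which has one: it stands for all the others.
  obtain ⟨R, hRτ, hRcard, hRcolor⟩ := exists_finset_representatives color
    {g : F | ∫ y, ((g : S → ℝ) y - f₀ y) ^ 2 ∂P < τ}
  refine ⟨{θ | f θ ∈ F ∧ ∫ y, (f θ y - f₀ y) ^ 2 ∂P < τ},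
    hf.and (hsmall.eventually_lt_const hτ), hm.mono fun n hn => ?_⟩
  have hcheb := sampleLaw_exists_le_abs_sampleProc_le R (half_pos he) (fun g _ => hsub g)
    (fun g hg => (hRτ hg).le) n
  rw [← add_halves e, ENNReal.ofReal_add (by positivity) (by positivity), add_halves]
  refine (measure_mono ?_).trans ((measure_union_le _ _).trans (add_le_add hn (hcheb.trans ?_)))
  · rintro x ⟨θ, ⟨hθF, hθτ⟩, hθ⟩
    obtain ⟨g, hgR, hg⟩ := hRcolor ⟨f θ, hθF⟩ hθτ
    have hi : Integrable (f θ) P := (hF.1 _ hθF).2.integrable one_le_two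
    have hgi : Integrable (g : S → ℝ) P := (hF.1 _ g.2).2.integrable one_le_two
    have hi₀ := hf₀.integrable one_le_two
    by_contra hcon
    simp only [Set.mem_union, Set.mem_ofPred_eq, not_or, not_exists, not_and, not_lt,
      not_le] at hcon
    have hclose := hcon.1 ⟨f θ, hθF⟩ g hg.symm
    have hrep := hcon.2 g hgR
    rw [sampleProc_fun_sub hgi hi₀] at hrep
    rw [sampleProc_fun_sub hi hi₀] at hθ
    have := abs_sub_le (sampleProc P n (f θ) x) (sampleProc P n g x) (sampleProc P n f₀ x)
    linarith
  · rw [← ENNReal.ofReal_natCast, ← ENNReal.ofReal_mul (by positivity)]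
    refine ENNReal.ofReal_le_ofReal (le_trans ?_ hmτ)
    gcongr

end Donsker

/-! ### Convergence in outer probability as convergence along a filter -/

section ProbFilter

variable {Ω : Type*} [MeasurableSpace Ω]

/-- The filter of the sequences of events whose complements have outer probability tending to
zero. -/
def probFilter (Pr : Measure Ω) : Filter (ℕ × Ω) where
  sets := {E | Tendsto (fun n => Pr {ω | (n, ω) ∉ E}) atTop (𝓝 0)}
  univ_sets := by simp
  sets_of_superset {E E'} hE hsub :=
    tendsto_of_tendsto_of_tendsto_of_le_of_le tendsto_const_nhds hE (fun _ => zero_le)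
      fun _ => measure_mono fun _ hE' h => hE' (hsub h)
  inter_sets {E E'} hE hE' := by
    refine tendsto_of_tendsto_of_tendsto_of_le_of_le tendsto_const_nhds
      (by simpa using hE.add hE') (fun _ => zero_le)
      fun n => (measure_mono fun ω hω => ?_).trans (measure_union_le _ _)
    exact not_and_or.1 hω

variable {Pr : Measure Ω}

theorem eventually_probFilter {q : ℕ × Ω → Prop} :
    (∀ᶠ p in probFilter Pr, q p) ↔ Tendsto (fun n => Pr {ω | ¬ q (n, ω)}) atTop (𝓝 0) := Iff.rfl

theorem WithProbTendstoOne.eventually {E : ℕ → Set Ω} (h : WithProbTendstoOne Pr E) :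
    ∀ᶠ p in probFilter Pr, p.2 ∈ E p.1 := eventually_probFilter.2 h

theorem eventually_probFilter_of_ae {q : ℕ × Ω → Prop} (h : ∀ n, ∀ᵐ ω ∂Pr, q (n, ω)) :
    ∀ᶠ p in probFilter Pr, q p := by
  simpa only [eventually_probFilter, ae_iff.1 (h _)] using tendsto_const_nhds

theorem eventually_probFilter_of_measure_le {q : ℕ × Ω → Prop}
    (h : ∀ δ : ℝ≥0∞, 0 < δ → ∃ r : ℕ × Ω → Prop, (∀ᶠ p in probFilter Pr, r p) ∧
      ∀ᶠ n in atTop, Pr {ω | r (n, ω) ∧ ¬ q (n, ω)} ≤ δ) : ∀ᶠ p in probFilter Pr, q p := by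
  refine eventually_probFilter.2 (ENNReal.tendsto_nhds_zero.2 fun δ hδ => ?_)
  obtain ⟨r, hr, hrq⟩ := h (δ / 2) (ENNReal.half_pos hδ.ne')
  filter_upwards [hrq, ENNReal.tendsto_nhds_zero.1 (eventually_probFilter.1 hr) (δ / 2)
    (ENNReal.half_pos hδ.ne')] with n hn hn'
  rw [← ENNReal.add_halves δ]
  refine (measure_mono fun ω hω => ?_).trans ((measure_union_le _ _).trans (add_le_add hn' hn))
  by_cases hr : r (n, ω)
  · exact Or.inr ⟨hr, hω⟩
  · exact Or.inl hr

theorem tendsto_fst_probFilter : Tendsto Prod.fst (probFilter Pr) (atTop : Filter ℕ) := by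
  intro E hE
  refine eventually_probFilter.2 (tendsto_const_nhds.congr' ?_)
  filter_upwards [hE] with n hn
  simp [hn]

theorem OuterLittleOOne.tendsto {N : ℕ → Ω → ℝ≥0∞} (h : OuterLittleOOne Pr N) :
    Tendsto (fun p : ℕ × Ω => N p.1 p.2) (probFilter Pr) (𝓝 0) := by
  refine ENNReal.tendsto_nhds_zero.2 fun ε hε => eventually_probFilter.2
    (tendsto_of_tendsto_of_tendsto_of_le_of_le tendsto_const_nhds
      (h ε hε) (fun _ => zero_le) fun n => measure_mono fun ω hω => ?_)
  exact (not_le.1 hω).le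

theorem outerLittleORootN_iff {R : ℕ → Ω → ℝ} : OuterLittleORootN Pr R ↔
    Tendsto (fun p : ℕ × Ω => √(p.1 : ℝ) * R p.1 p.2) (probFilter Pr) (𝓝 0) := by
  have habs (p : ℕ × Ω) : |√(p.1 : ℝ) * R p.1 p.2| = √(p.1 : ℝ) * |R p.1 p.2| := by
    rw [abs_mul, abs_of_nonneg (Real.sqrt_nonneg _)]
  rw [tendsto_zero_iff_abs_tendsto_zero]
  simp only [Function.comp_def, habs]
  refine ⟨fun h => ?_, fun h ε hε => ?_⟩
  · refine ((ENNReal.tendsto_toReal ENNReal.zero_ne_top).comp (OuterLittleOOne.tendsto h)).congr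
      fun p => ENNReal.toReal_ofReal (by positivity)
  · have hsmall := ENNReal.tendsto_ofReal h
    rw [ENNReal.ofReal_zero] at hsmall
    simpa only [not_lt] using eventually_probFilter.1 (hsmall.eventually_lt_const hε)

theorem OuterLittleORootN.tendsto {R : ℕ → Ω → ℝ} (h : OuterLittleORootN Pr R) :
    Tendsto (fun p : ℕ × Ω => √(p.1 : ℝ) * R p.1 p.2) (probFilter Pr) (𝓝 0) :=
  outerLittleORootN_iff.1 h

instance probFilter_neBot [IsProbabilityMeasure Pr] : (probFilter Pr).NeBot := by
  refine neBot_iff.2 fun hbot => ?_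
  have hfalse : ∀ᶠ _ in probFilter Pr, False := by simp [hbot]
  simpa using eventually_probFilter.1 hfalse

theorem tendsto_inv_sqrt_probFilter :
    Tendsto (fun p : ℕ × Ω => (√(p.1 : ℝ))⁻¹) (probFilter Pr) (𝓝 0) :=
  (tendsto_inv_atTop_zero.comp (Real.tendsto_sqrt_atTop.comp tendsto_natCast_atTop_atTop)).comp
    tendsto_fst_probFilter

section IID

variable {S : Type*} [MeasurableSpace S] {P : Measure S} {X : ℕ → Ω → S}

theorem measurePreserving_sample [IsProbabilityMeasure Pr] (hXmeas : ∀ i, Measurable (X i))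
    (hXindep : iIndepFun X Pr) (hXlaw : ∀ i, Pr.map (X i) = P) (n : ℕ) :
    MeasurePreserving (fun ω (i : Fin n) => X i ω) Pr (sampleLaw P n) := by
  refine ⟨measurable_pi_lambda _ fun i => hXmeas i, ?_⟩
  have hfin := hXindep.precomp (g := fun i : Fin n => (i : ℕ)) Fin.val_injective
  rw [(iIndepFun_iff_map_fun_eq_pi_map fun i : Fin n => (hXmeas i).aemeasurable).1 hfin]
  simp [hXlaw]

theorem empMean_eq (s : ℕ → S) {n : ℕ} (hn : 0 < n) (f : S → ℝ) :
    empMean s n f = empProc P s n f * (√(n : ℝ))⁻¹ + ∫ y, f y ∂P := by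
  have hrt : √(n : ℝ) ≠ 0 := (Real.sqrt_pos.2 (by exact_mod_cast hn)).ne'
  rw [empProc, mul_comm (√(n : ℝ)), mul_inv_cancel_right₀ hrt, sub_add_cancel]

theorem tendsto_empMean_of_tendsto_empProc {h : ℕ × Ω → S → ℝ} {l : ℝ}
    (hproc : Tendsto (fun p : ℕ × Ω => empProc P (fun i => X i p.2) p.1 (h p) * (√(p.1 : ℝ))⁻¹)
      (probFilter Pr) (𝓝 0)) (hmean : Tendsto (fun p => ∫ y, h p y ∂P) (probFilter Pr) (𝓝 l)) :
    Tendsto (fun p : ℕ × Ω => empMean (fun i => X i p.2) p.1 (h p)) (probFilter Pr) (𝓝 l) := by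
  have hsum := hproc.add hmean
  rw [zero_add] at hsum
  refine hsum.congr' ?_
  filter_upwards [tendsto_fst_probFilter.eventually (eventually_gt_atTop 0)] with p hp
  exact (empMean_eq _ hp (h p)).symm

variable [IsProbabilityMeasure P]
  (hX : ∀ n, MeasurePreserving (fun ω (i : Fin n) => X i ω) Pr (sampleLaw P n))
include hX

theorem StochEquicont.tendsto {h : ℕ × Ω → S → ℝ} (hh : StochEquicont P (probFilter Pr) h) :
    Tendsto (fun p : ℕ × Ω => empProc P (fun i => X i p.2) p.1 (h p)) (probFilter Pr) (𝓝 0) := by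
  refine Metric.tendsto_nhds.2 fun e he => eventually_probFilter_of_measure_le fun δ hδ => ?_
  have hlim : Tendsto ENNReal.ofReal (𝓝[>] 0) (𝓝 0) := by
    simpa using (ENNReal.continuous_ofReal.tendsto 0).mono_left nhdsWithin_le_nhds
  obtain ⟨c, ⟨hcδ, hce⟩, hc⟩ := ((((ENNReal.tendsto_nhds_zero.1 hlim δ hδ).and
    (nhdsWithin_le_nhds (eventually_lt_nhds he))).and eventually_mem_nhdsWithin).exists)
  obtain ⟨A, hA, hAn⟩ := hh.equi c hc
  refine ⟨(· ∈ A), hA, hAn.mono fun n hn => ((measure_mono ?_).trans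
    ((hX n).measure_preimage_le _)).trans (hn.trans hcδ)⟩
  rintro ω ⟨hωA, hω⟩
  refine ⟨(n, ω), hωA, ?_⟩
  rw [dist_zero_right, Real.norm_eq_abs, not_lt, empProc_eq_sampleProc] at hω
  exact hce.trans_le hω

theorem tendsto_empProc_mul {f : S → ℝ} (hf : MemLp f 2 P) {r : ℕ × Ω → ℝ}
    (hr : Tendsto r (probFilter Pr) (𝓝 0)) :
    Tendsto (fun p : ℕ × Ω => empProc P (fun i => X i p.2) p.1 f * r p) (probFilter Pr)
      (𝓝 0) := by
  refine Metric.tendsto_nhds.2 fun e he => eventually_probFilter_of_measure_le fun δ hδ => ?_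
  have hlim : Tendsto (fun k : ℝ => ENNReal.ofReal ((∫ y, f y ^ 2 ∂P) / k ^ 2)) atTop (𝓝 0) := by
    rw [← ENNReal.ofReal_zero]
    exact ENNReal.tendsto_ofReal (tendsto_const_nhds.div_atTop (tendsto_pow_atTop two_ne_zero))
  obtain ⟨k, hkδ, hk⟩ := ((ENNReal.tendsto_nhds_zero.1 hlim δ hδ).and
    (eventually_gt_atTop 0)).exists
  refine ⟨_, Metric.tendsto_nhds.1 hr (e / k) (by positivity), Eventually.of_forall fun n =>
    ((measure_mono ?_).trans ((hX n).measure_preimage_le {x | k ≤ |sampleProc P n f x|})).trans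
      ((chebyshev_sampleProc hf n hk).trans hkδ)⟩
  rintro ω ⟨hωr, hω⟩
  by_contra hlt
  refine hω ?_
  rw [dist_zero_right, Real.norm_eq_abs] at hωr ⊢
  rw [empProc_eq_sampleProc, abs_mul, ← mul_div_cancel₀ e hk.ne']
  exact mul_lt_mul'' (not_le.1 hlt) hωr (abs_nonneg _) (abs_nonneg _)

theorem eventually_forall_sample {q : S → Prop} (hq : ∀ᵐ x ∂P, q x) :
    ∀ᶠ p in probFilter Pr, ∀ i < p.1, q (X i p.2) := by
  refine eventually_probFilter_of_ae fun n => ?_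
  have hlaw : ∀ᵐ x ∂sampleLaw P n, ∀ i : Fin n, q (x i) := ae_all_iff.2 fun i =>
    (measurePreserving_eval (fun _ : Fin n => P) i).quasiMeasurePreserving.ae hq
  filter_upwards [(hX n).quasiMeasurePreserving.ae hlaw] with ω hω i hi using hω ⟨i, hi⟩

theorem tendsto_empMean {f : S → ℝ} (hf : MemLp f 2 P) :
    Tendsto (fun p : ℕ × Ω => empMean (fun i => X i p.2) p.1 f) (probFilter Pr)
      (𝓝 (∫ y, f y ∂P)) :=
  tendsto_empMean_of_tendsto_empProc (tendsto_empProc_mul hX hf tendsto_inv_sqrt_probFilter)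
    tendsto_const_nhds

theorem StochEquicont.tendsto_empMean {h : ℕ × Ω → S → ℝ}
    (hh : StochEquicont P (probFilter Pr) h) :
    Tendsto (fun p : ℕ × Ω => empMean (fun i => X i p.2) p.1 (h p)) (probFilter Pr) (𝓝 0) := by
  refine tendsto_empMean_of_tendsto_empProc
    (by simpa using (hh.tendsto hX).mul tendsto_inv_sqrt_probFilter) ?_
  have hsq : Tendsto (fun p => (∫ y, h p y ∂P) ^ 2) (probFilter Pr) (𝓝 0) :=
    squeeze_zero' (Eventually.of_forall fun p => sq_nonneg _)
      (hh.memLp.mono fun p hp => sq_integral_le hp) hh.small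
  refine (tendsto_zero_iff_abs_tendsto_zero _).2 ?_
  simpa [Real.sqrt_sq_eq_abs, Function.comp_def] using (Real.continuous_sqrt.tendsto 0).comp hsq

theorem StochEquicont.tendsto_empMean_of_sub {f : ℕ × Ω → S → ℝ} {f₀ : S → ℝ}
    (hf₀ : MemLp f₀ 2 P) (hf : StochEquicont P (probFilter Pr) fun p x => f p x - f₀ x) :
    Tendsto (fun p : ℕ × Ω => empMean (fun i => X i p.2) p.1 (f p)) (probFilter Pr)
      (𝓝 (∫ y, f₀ y ∂P)) := by
  simpa only [← empMean_add, sub_add_cancel, zero_add] using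
    (hf.tendsto_empMean hX).add (GComp.tendsto_empMean hX hf₀)

end IID

end ProbFilter

/-! ### Convergence in mean square -/

section L2

variable {S Θ : Type*} [MeasurableSpace S] {P : Measure S} {𝓛 : Filter Θ}

theorem eventually_memLp {f : Θ → S → ℝ} (hf : ∀ θ, AEStronglyMeasurable (f θ) P)
    (hlim : Tendsto (fun θ => eLpNorm (f θ) 2 P) 𝓛 (𝓝 0)) : ∀ᶠ θ in 𝓛, MemLp (f θ) 2 P :=
  (hlim.eventually_lt_const ENNReal.zero_lt_top).mono fun θ hθ => ⟨hf θ, hθ⟩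

theorem integral_sq_eq_eLpNorm {f : S → ℝ} (hf : MemLp f 2 P) :
    ∫ x, f x ^ 2 ∂P = (eLpNorm f 2 P).toReal ^ 2 := by
  have hnonneg : 0 ≤ ∫ x, f x ^ 2 ∂P := integral_nonneg fun x => sq_nonneg _
  rw [hf.eLpNorm_eq_integral_rpow_norm two_ne_zero ENNReal.ofNat_ne_top]
  simp only [ENNReal.toReal_ofNat, Real.rpow_ofNat, Real.norm_eq_abs, sq_abs]
  rw [ENNReal.toReal_ofReal (Real.rpow_nonneg hnonneg _), ← Real.rpow_natCast,
    ← Real.rpow_mul hnonneg]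
  norm_num

theorem tendsto_integral_sq {f : Θ → S → ℝ} (hf : ∀ θ, AEStronglyMeasurable (f θ) P)
    (hlim : Tendsto (fun θ => eLpNorm (f θ) 2 P) 𝓛 (𝓝 0)) :
    Tendsto (fun θ => ∫ x, f θ x ^ 2 ∂P) 𝓛 (𝓝 0) := by
  have hsq := ((ENNReal.tendsto_toReal ENNReal.zero_ne_top).comp hlim).pow 2
  rw [ENNReal.toReal_zero, zero_pow two_ne_zero] at hsq
  exact hsq.congr' ((eventually_memLp hf hlim).mono fun θ hθ => (integral_sq_eq_eLpNorm hθ).symm)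

theorem ae_abs_le_of_tendsto [𝓛.NeBot] {f : Θ → S → ℝ} {f₀ : S → ℝ} {p : ℝ≥0∞} (hp : p ≠ 0)
    {M : ℝ} (hf₀ : AEStronglyMeasurable f₀ P)
    (hlim : Tendsto (fun θ => eLpNorm (fun x => f θ x - f₀ x) p P) 𝓛 (𝓝 0))
    (hM : ∀ᶠ θ in 𝓛, ∀ᵐ x ∂P, |f θ x| ≤ M) : ∀ᵐ x ∂P, |f₀ x| ≤ M := by
  have hexcess : AEStronglyMeasurable (fun x => max (|f₀ x| - M) 0) P :=
    (hf₀.norm.sub aestronglyMeasurable_const).sup aestronglyMeasurable_const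
  have hzero : eLpNorm (fun x => max (|f₀ x| - M) 0) p P = 0 := by
    refine le_antisymm (ge_of_tendsto hlim (hM.mono fun θ hθ => eLpNorm_mono_ae ?_)) zero_le
    filter_upwards [hθ] with x hx
    rw [Real.norm_eq_abs, Real.norm_eq_abs, abs_of_nonneg (le_max_right _ _), abs_sub_comm]
    exact max_le (by linarith [abs_sub_abs_le_abs_sub (f₀ x) (f θ x)]) (abs_nonneg _)
  filter_upwards [(eLpNorm_eq_zero_iff hexcess hp).1 hzero] with x hx
  exact sub_nonpos.1 (max_eq_right_iff.1 hx)

theorem abs_max_sub_zero_le {K : ℝ} (hK : 0 ≤ K) (u : ℝ) : |max (u - K) 0| ≤ |u| := by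
  rw [abs_of_nonneg (le_max_right _ _)]
  exact max_le ((sub_le_self _ hK).trans (le_abs_self _)) (abs_nonneg _)

theorem tendsto_integral_max_sub_zero {h : S → ℝ} (hh : Integrable h P) :
    Tendsto (fun K : ℝ => ∫ x, max (h x - K) 0 ∂P) atTop (𝓝 0) := by
  have hdom := tendsto_integral_filter_of_dominated_convergence (μ := P) (l := atTop)
    (F := fun (K : ℝ) x => max (h x - K) 0) (f := fun _ => 0) (fun x => |h x|)
    (Eventually.of_forall fun K =>
      ((hh.aestronglyMeasurable.sub aestronglyMeasurable_const).sup aestronglyMeasurable_const))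
    ((eventually_ge_atTop 0).mono fun K hK => ae_of_all _ fun x => abs_max_sub_zero_le hK (h x))
    hh.abs (ae_of_all _ fun x => ?_)
  · simpa using hdom
  · refine tendsto_const_nhds.congr' ?_
    filter_upwards [eventually_ge_atTop (h x)] with K hK
    rw [max_eq_right (sub_nonpos.2 hK)]

theorem tendsto_integral_mul_of_mem_Icc {h : S → ℝ} (hh : Integrable h P) (hnonneg : 0 ≤ h)
    {u : Θ → S → ℝ} (hu : ∀ᶠ θ in 𝓛, Integrable (u θ) P)
    (hu_mem : ∀ᶠ θ in 𝓛, ∀ᵐ x ∂P, u θ x ∈ Set.Icc 0 1)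
    (hlim : Tendsto (fun θ => ∫ x, u θ x ∂P) 𝓛 (𝓝 0)) :
    Tendsto (fun θ => ∫ x, h x * u θ x ∂P) 𝓛 (𝓝 0) := by
  refine Metric.tendsto_nhds.2 fun e he => ?_
  obtain ⟨K, hK, hK0⟩ := (((tendsto_integral_max_sub_zero hh).eventually_lt_const
    (half_pos he)).and (eventually_gt_atTop 0)).exists
  filter_upwards [hu, hu_mem, hlim.eventually_lt_const (show 0 < e / 2 / K by positivity)]
    with θ hθ hθ_mem hθ_lt
  have hpos : Integrable (fun x => max (h x - K) 0) P :=
    hh.abs.mono' ((hh.aestronglyMeasurable.sub aestronglyMeasurable_const).sup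
      aestronglyMeasurable_const) (ae_of_all _ fun x => abs_max_sub_zero_le hK0.le (h x))
  have hle : ∀ᵐ x ∂P, h x * u θ x ≤ K * u θ x + max (h x - K) 0 := by
    filter_upwards [hθ_mem] with x hx
    calc h x * u θ x = K * u θ x + (h x - K) * u θ x := by ring
      _ ≤ K * u θ x + max (h x - K) 0 * u θ x := by
        gcongr
        · exact hx.1
        · exact le_max_left _ _
      _ ≤ K * u θ x + max (h x - K) 0 := by
        gcongr
        exact mul_le_of_le_one_right (le_max_right _ _) hx.2
  have hnn : ∀ᵐ x ∂P, 0 ≤ h x * u θ x := by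
    filter_upwards [hθ_mem] with x hx using mul_nonneg (hnonneg x) hx.1
  rw [dist_zero_right, Real.norm_eq_abs, abs_of_nonneg (integral_nonneg_of_ae hnn)]
  calc ∫ x, h x * u θ x ∂P ≤ ∫ x, (K * u θ x + max (h x - K) 0) ∂P :=
        integral_mono_of_nonneg hnn ((hθ.const_mul K).add hpos) hle
    _ = K * ∫ x, u θ x ∂P + ∫ x, max (h x - K) 0 ∂P := by
        rw [integral_add (hθ.const_mul K) hpos, integral_const_mul]
    _ < e / 2 + e / 2 := add_lt_add (by rwa [lt_div_iff₀' hK0] at hθ_lt) hK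
    _ = e := add_halves e

end L2

/-! ### Identities in the observational model -/

theorem integral_eq_integral_condDistrib {Ω α β : Type*} [MeasurableSpace Ω]
    [MeasurableSpace α] [MeasurableSpace β] [StandardBorelSpace β] [Nonempty β] {P : Measure Ω}
    [IsFiniteMeasure P] {U : Ω → α} {V : Ω → β} (hU : Measurable U) (hV : Measurable V)
    {f : α × β → ℝ} (hf : Measurable f) (hint : Integrable (fun ω => f (U ω, V ω)) P) :
    ∫ ω, f (U ω, V ω) ∂P = ∫ ω, ∫ v, f (U ω, v) ∂condDistrib V U P (U ω) ∂P := by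
  rw [← integral_congr_ae (condExp_prod_ae_eq_integral_condDistrib hU hV.aemeasurable
    hf.stronglyMeasurable hint), integral_condExp hU.comap_le]

section Model

variable {d : ℕ}

theorem measurable_covariate : Measurable fun x : Obs d => x.2.2 := by fun_prop

theorem measurableSet_treated : MeasurableSet {x : Obs d | x.2.1 = true} :=
  measurable_snd.fst (measurableSet_singleton true)

theorem measurable_treated : Measurable (treated (d := d)) :=
  Measurable.ite measurableSet_treated measurable_const measurable_const

theorem measurable_control : Measurable (control (d := d)) :=
  Measurable.ite measurableSet_treated measurable_const measurable_const

theorem treated_mul_eq_indicator (f : Obs d → ℝ) :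
    (fun x => treated x * f x) = {x | x.2.1 = true}.indicator f := by
  funext x
  by_cases hx : x.2.1 = true <;> simp [treated, hx]

theorem control_eq (x : Obs d) : control x = 1 - treated x := by
  rw [control, treated]
  split_ifs <;> simp

theorem abs_treated_le (x : Obs d) : |treated x| ≤ 1 := by
  rw [treated]
  split_ifs <;> simp

theorem abs_control_le (x : Obs d) : |control x| ≤ 1 := by
  rw [control]
  split_ifs <;> simp

theorem memLp_treated_mul {P : Measure (Obs d)} {f : Obs d → ℝ} {p : ℝ≥0∞} (hf : MemLp f p P) :
    MemLp (fun x => treated x * f x) p P :=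
  hf.mul' (memLp_top_of_bound measurable_treated.aestronglyMeasurable 1
    (ae_of_all _ abs_treated_le))

theorem memLp_control_mul {P : Measure (Obs d)} {f : Obs d → ℝ} {p : ℝ≥0∞} (hf : MemLp f p P) :
    MemLp (fun x => control x * f x) p P :=
  hf.mul' (memLp_top_of_bound measurable_control.aestronglyMeasurable 1
    (ae_of_all _ abs_control_le))

theorem integrable_treated_mul {P : Measure (Obs d)} {f : Obs d → ℝ} (hf : Integrable f P) :
    Integrable (fun x => treated x * f x) P :=
  memLp_one_iff_integrable.1 (memLp_treated_mul (memLp_one_iff_integrable.2 hf))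

variable (P : Measure (Obs d))

theorem memLp_treated [IsFiniteMeasure P] : MemLp (treated (d := d)) 2 P :=
  MemLp.of_bound measurable_treated.aestronglyMeasurable 1 (ae_of_all _ abs_treated_le)

theorem integral_treated : ∫ x, treated x ∂P = treatProb P := by
  rw [treatProb, ← integral_indicator_one measurableSet_treated]
  simpa [Pi.one_def] using
    congrArg (fun f : Obs d → ℝ => ∫ x, f x ∂P) (treated_mul_eq_indicator fun _ => 1)

variable [IsFiniteMeasure P]

theorem measurable_propensity : Measurable (propensity P) :=
  (Kernel.measurable_coe _ (measurableSet_singleton true)).ennreal_toReal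

theorem propensity_nonneg (z : Fin d → ℝ) : 0 ≤ propensity P z := measureReal_nonneg

theorem propensity_le_one (z : Fin d → ℝ) : propensity P z ≤ 1 := measureReal_le_one

theorem abs_propensity_le (z : Fin d → ℝ) : |propensity P z| ≤ 1 := by
  rw [abs_of_nonneg (propensity_nonneg P z)]
  exact propensity_le_one P z

theorem memLp_propensity : MemLp (fun x : Obs d => propensity P x.2.2) 2 P :=
  MemLp.of_bound ((measurable_propensity P).comp measurable_covariate).aestronglyMeasurable 1
    (ae_of_all _ fun x => abs_propensity_le P x.2.2)

theorem measurable_outcomeReg : Measurable (outcomeReg P) :=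
  (StronglyMeasurable.integral_kernel (f := fun y : ℝ => y)
    stronglyMeasurable_id).measurable.comp (measurable_const.prodMk measurable_id)

variable {P}

theorem integrable_propensity_mul {f : Obs d → ℝ} (hf : Integrable f P) :
    Integrable (fun x => propensity P x.2.2 * f x) P :=
  hf.bdd_mul ((measurable_propensity P).comp measurable_covariate).aestronglyMeasurable
    (ae_of_all _ fun x => abs_propensity_le P x.2.2)

theorem integral_treated_mul {v : (Fin d → ℝ) → ℝ} (hv : Measurable v)
    (hvi : Integrable (fun x : Obs d => v x.2.2) P) :
    ∫ x, treated x * v x.2.2 ∂P = ∫ x, propensity P x.2.2 * v x.2.2 ∂P := by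
  have hf : Measurable fun q : (Fin d → ℝ) × Bool => (if q.2 = true then 1 else 0) * v q.1 :=
    (Measurable.ite (measurable_snd (measurableSet_singleton true)) measurable_const
      measurable_const).mul (hv.comp measurable_fst)
  refine (integral_eq_integral_condDistrib measurable_covariate (V := fun x : Obs d => x.2.1)
    measurable_snd.fst hf (integrable_treated_mul hvi)).trans
      (integral_congr_ae (ae_of_all _ fun x => ?_))
  simp only [integral_mul_const]
  congr 1
  rw [propensity, ← integral_indicator_one (measurableSet_singleton true)]
  congr 1 with b
  cases b <;> simp

theorem integral_control_mul {v : (Fin d → ℝ) → ℝ} (hv : Measurable v)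
    (hvi : Integrable (fun x : Obs d => v x.2.2) P) :
    ∫ x, control x * v x.2.2 ∂P = ∫ x, (1 - propensity P x.2.2) * v x.2.2 ∂P := by
  simp only [control_eq, sub_mul, one_mul]
  rw [integral_sub hvi (integrable_treated_mul hvi), integral_treated_mul hv hvi,
    integral_sub hvi (integrable_propensity_mul hvi)]

theorem integral_propensity : ∫ x, propensity P x.2.2 ∂P = treatProb P := by
  simpa [integral_treated] using
    (integral_treated_mul (P := P) (v := fun _ => 1) measurable_const (integrable_const _)).symm

theorem integral_control_mul_outcome {v : (Fin d → ℝ) → ℝ} (hv : Measurable v)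
    (hvi : Integrable (fun x : Obs d => control x * v x.2.2 * x.1) P) :
    ∫ x, control x * v x.2.2 * x.1 ∂P = ∫ x, control x * v x.2.2 * outcomeReg P x.2.2 ∂P := by
  have hf : Measurable fun q : (Bool × (Fin d → ℝ)) × ℝ =>
      (if q.1.1 = true then 0 else 1) * v q.1.2 * q.2 :=
    ((Measurable.ite (measurable_fst.fst (measurableSet_singleton true)) measurable_const
      measurable_const).mul (hv.comp measurable_fst.snd)).mul measurable_snd
  refine (integral_eq_integral_condDistrib (U := fun x : Obs d => x.2) measurable_snd
    measurable_fst hf hvi).trans (integral_congr_ae (ae_of_all _ ?_))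
  rintro ⟨y, b, z⟩
  cases b
  · exact integral_const_mul (L := ℝ) (control (y, false, z) * v z) fun w => w
  · simp [control]

theorem treatProb_mul_gMean (hπ : treatProb P ≠ 0) :
    treatProb P * gMean P = ∫ x, treated x * outcomeReg P x.2.2 ∂P := by
  rw [treated_mul_eq_indicator, integral_indicator measurableSet_treated, gMean,
    ProbabilityTheory.cond, integral_smul_measure, ENNReal.toReal_inv]
  exact mul_inv_cancel_left₀ hπ _

theorem le_treatProb {P : Measure (Obs d)} [IsProbabilityMeasure P] {a : ℝ}
    (ha : ∀ᵐ x ∂P, a ≤ propensity P x.2.2) : a ≤ treatProb P := by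
  rw [← integral_propensity]
  calc a = ∫ _ : Obs d, a ∂P := by simp
    _ ≤ ∫ x, propensity P x.2.2 ∂P :=
        integral_mono_ae (integrable_const a) ((memLp_propensity P).integrable one_le_two) ha

end Model

/-! ### The odds and the weighted outcome -/

/-- The odds `u / (1 - u)`, the weight that the score attaches to the untreated observations. -/
noncomputable def odds (u : ℝ) : ℝ := u / (1 - u)

theorem measurable_odds : Measurable odds := measurable_id.div (measurable_const.sub measurable_id)

theorem abs_odds_sub_le {b u v : ℝ} (hb : b < 1) (hu : u ≤ b) (hv : v ≤ b) :
    |odds u - odds v| ≤ ((1 - b) ^ 2)⁻¹ * |u - v| := by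
  have hu' : 0 < 1 - u := by linarith
  have hv' : 0 < 1 - v := by linarith
  have hsub : odds u - odds v = ((1 - u) * (1 - v))⁻¹ * (u - v) := by
    rw [odds, odds]
    field_simp
    ring
  rw [hsub, abs_mul, abs_of_pos (inv_pos.2 (mul_pos hu' hv')), sq]
  have : 0 < 1 - b := by linarith
  gcongr

theorem abs_odds_le {b u : ℝ} (hb : b < 1) (hu : u ∈ Set.Icc 0 b) : |odds u| ≤ (1 - b)⁻¹ := by
  have : 0 < 1 - b := by linarith
  rw [odds, abs_of_nonneg (div_nonneg hu.1 (by linarith [hu.2])), ← one_div]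
  gcongr
  · exact hu.2.trans hb.le
  · exact hu.2

section Weighted

variable {d : ℕ} {P : Measure (Obs d)} {γ : (Fin d → ℝ) → ℝ} {b : ℝ}

theorem weightedOutcome_eq (γ : (Fin d → ℝ) → ℝ) (x : Obs d) :
    weightedOutcome γ x = control x * odds (γ x.2.2) * x.1 := by
  rw [weightedOutcome, odds]
  ring

theorem ae_abs_odds_le (hb : b < 1) (hγb : ∀ᵐ x ∂P, γ x.2.2 ∈ Set.Icc 0 b) :
    ∀ᵐ x : Obs d ∂P, |odds (γ x.2.2)| ≤ (1 - b)⁻¹ :=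
  hγb.mono fun _ hx => abs_odds_le hb hx

theorem memLp_odds_mul (hγ : Measurable γ) (hb : b < 1)
    (hγb : ∀ᵐ x ∂P, γ x.2.2 ∈ Set.Icc 0 b) {f : Obs d → ℝ} {p : ℝ≥0∞} (hf : MemLp f p P) :
    MemLp (fun x => odds (γ x.2.2) * f x) p P :=
  hf.mul' (memLp_top_of_bound
    (measurable_odds.comp (hγ.comp measurable_covariate)).aestronglyMeasurable _
    (ae_abs_odds_le hb hγb))

theorem memLp_weightedOutcome (hγ : Measurable γ) (hb : b < 1)
    (hγb : ∀ᵐ x ∂P, γ x.2.2 ∈ Set.Icc 0 b) {p : ℝ≥0∞} (hY : MemLp (fun x : Obs d => x.1) p P) :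
    MemLp (weightedOutcome γ) p P := by
  simpa only [← mul_assoc, ← weightedOutcome_eq] using
    memLp_control_mul (memLp_odds_mul hγ hb hγb hY)

theorem sq_weightedOutcome_sub_le (hb : b < 1) {γ₀ : (Fin d → ℝ) → ℝ} {x : Obs d}
    (hx : γ x.2.2 ≤ b) (hx₀ : γ₀ x.2.2 ≤ b) :
    (weightedOutcome γ x - weightedOutcome γ₀ x) ^ 2 ≤
      ((1 - b) ^ 2)⁻¹ ^ 2 * (x.1 ^ 2 * (γ x.2.2 - γ₀ x.2.2) ^ 2) := by
  have hle : |weightedOutcome γ x - weightedOutcome γ₀ x| ≤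
      |((1 - b) ^ 2)⁻¹ * (x.1 * (γ x.2.2 - γ₀ x.2.2))| := by
    calc |weightedOutcome γ x - weightedOutcome γ₀ x|
        = |control x| * |odds (γ x.2.2) - odds (γ₀ x.2.2)| * |x.1| := by
          rw [weightedOutcome_eq, weightedOutcome_eq, ← sub_mul, ← mul_sub, abs_mul, abs_mul]
      _ ≤ 1 * (((1 - b) ^ 2)⁻¹ * |γ x.2.2 - γ₀ x.2.2|) * |x.1| := by
          gcongr
          · exact abs_control_le x
          · exact abs_odds_sub_le hb hx hx₀
      _ = |((1 - b) ^ 2)⁻¹ * (x.1 * (γ x.2.2 - γ₀ x.2.2))| := by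
          rw [abs_mul, abs_mul, abs_of_nonneg (by positivity : 0 ≤ ((1 - b) ^ 2)⁻¹)]
          ring
  simpa only [mul_pow] using sq_le_sq.2 hle

theorem tendsto_weightedOutcome {Θ : Type*} {𝓛 : Filter Θ} {γ : Θ → (Fin d → ℝ) → ℝ}
    {γ₀ : (Fin d → ℝ) → ℝ} (hb : b < 1) (hγ : ∀ᶠ θ in 𝓛, ∀ᵐ x ∂P, γ θ x.2.2 ∈ Set.Icc 0 b)
    (hγ₀ : ∀ᵐ x ∂P, γ₀ x.2.2 ∈ Set.Icc 0 b) (hY : MemLp (fun x : Obs d => x.1) 2 P)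
    (hL : ∀ᶠ θ in 𝓛, MemLp (fun x : Obs d => γ θ x.2.2 - γ₀ x.2.2) 2 P)
    (hlim : Tendsto (fun θ => ∫ x : Obs d, (γ θ x.2.2 - γ₀ x.2.2) ^ 2 ∂P) 𝓛 (𝓝 0)) :
    Tendsto (fun θ => ∫ x : Obs d, (weightedOutcome (γ θ) x - weightedOutcome γ₀ x) ^ 2 ∂P) 𝓛
      (𝓝 0) := by
  have hmem : ∀ᶠ θ in 𝓛, ∀ᵐ x : Obs d ∂P, (γ θ x.2.2 - γ₀ x.2.2) ^ 2 ∈ Set.Icc 0 1 := by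
    filter_upwards [hγ] with θ hθ
    filter_upwards [hθ, hγ₀] with x hx hx₀
    refine ⟨sq_nonneg _, (sq_le_one_iff_abs_le_one _).2 (abs_le.2 ?_)⟩
    constructor <;> linarith [hx.1, hx.2, hx₀.1, hx₀.2]
  have hbound := (tendsto_integral_mul_of_mem_Icc hY.integrable_sq (fun x => sq_nonneg x.1)
    (hL.mono fun θ hθ => hθ.integrable_sq) hmem hlim).const_mul (((1 - b) ^ 2)⁻¹ ^ 2)
  rw [mul_zero] at hbound
  refine squeeze_zero' (Eventually.of_forall fun θ => integral_nonneg fun x => sq_nonneg _) ?_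
    hbound
  filter_upwards [hγ, hL, hmem] with θ hθ hθL hθ1
  rw [← integral_const_mul]
  refine integral_mono_of_nonneg (ae_of_all _ fun x => sq_nonneg _)
    (Integrable.const_mul (hY.integrable_sq.mono' ?_ ?_) _) ?_
  · exact (hY.aestronglyMeasurable.pow 2).mul hθL.integrable_sq.aestronglyMeasurable
  · filter_upwards [hθ1] with x hx
    rw [Real.norm_eq_abs, abs_of_nonneg (by positivity)]
    exact mul_le_of_le_one_right (sq_nonneg _) hx.2
  · filter_upwards [hθ, hγ₀] with x hx hx₀ using sq_weightedOutcome_sub_le hb hx.2 hx₀.2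

end Weighted

/-! ### The score -/

/-- The estimating function `I(a = 0) g / (1 - g) (y - μ) + I(a = 1) μ`, that is `π φ + I(a = 1) ψ`
for the influence function `φ` at `(ψ, μ, g, π)`. -/
noncomputable def score {d : ℕ} (m γ : (Fin d → ℝ) → ℝ) (x : Obs d) : ℝ :=
  weightedOutcome γ x - control x * (odds (γ x.2.2) * m x.2.2) + treated x * m x.2.2

theorem infl_eq {d : ℕ} (m γ : (Fin d → ℝ) → ℝ) (π ψ : ℝ) (x : Obs d) :
    infl m γ π ψ x = π⁻¹ * (score m γ x - ψ * treated x) := by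
  simp only [infl, score, weightedOutcome, odds, div_eq_mul_inv, mul_inv]
  ring

section EmpMean

variable {S : Type*} {s : ℕ → S} {n : ℕ}

theorem empMean_sub (s : ℕ → S) (n : ℕ) (f h : S → ℝ) :
    empMean s n (fun x => f x - h x) = empMean s n f - empMean s n h := by
  simp [empMean, Finset.sum_sub_distrib, sub_div]

theorem empMean_congr {f h : S → ℝ} (hfh : ∀ i < n, f (s i) = h (s i)) :
    empMean s n f = empMean s n h := by
  rw [empMean, empMean, Finset.sum_congr rfl fun i hi => hfh i (Finset.mem_range.1 hi)]

variable {d : ℕ} (m γ : (Fin d → ℝ) → ℝ) (s : ℕ → Obs d) (n : ℕ)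

theorem empMean_infl_eq (π ψ : ℝ) :
    empMean s n (infl m γ π ψ) = π⁻¹ * (empMean s n (score m γ) - ψ * piBar s n) := by
  rw [piBar, ← empMean_mul, ← empMean_sub, ← empMean_mul]
  exact congrArg _ (funext (infl_eq m γ π ψ))

theorem estEq_eq : estEq m γ s n = (piBar s n)⁻¹ * empMean s n (score m γ) := by
  rw [estEq, ← empMean_mul]
  congr 1 with x
  simp only [score, weightedOutcome, odds, div_eq_mul_inv, mul_inv]
  ring

theorem plugIn_eq :
    plugIn m γ s n = (piHat γ s n)⁻¹ * empMean s n fun x => γ x.2.2 * m x.2.2 := by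
  rw [plugIn, ← empMean_mul]
  congr 1 with x
  ring

theorem plugInTreated_eq :
    plugInTreated m γ s n = (piHat γ s n)⁻¹ * empMean s n fun x => treated x * m x.2.2 := by
  rw [plugInTreated, ← empMean_mul]
  congr 1 with x
  ring

end EmpMean

section Score

variable {d : ℕ} {P : Measure (Obs d)} {m γ : (Fin d → ℝ) → ℝ} {b : ℝ}

theorem memLp_score (hγ : Measurable γ) (hb : b < 1) (hγb : ∀ᵐ x ∂P, γ x.2.2 ∈ Set.Icc 0 b)
    {p : ℝ≥0∞} (hm : MemLp (fun x : Obs d => m x.2.2) p P)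
    (hY : MemLp (fun x : Obs d => x.1) p P) : MemLp (score m γ) p P :=
  ((memLp_weightedOutcome hγ hb hγb hY).sub
    (memLp_control_mul (memLp_odds_mul hγ hb hγb hm))).add (memLp_treated_mul hm)

section Odds

variable (hγ : Measurable γ) (hb : b < 1) (hγb : ∀ᵐ x ∂P, γ x.2.2 ∈ Set.Icc 0 b)
include hγ hb hγb

theorem integrable_odds_mul {f : Obs d → ℝ} (hf : Integrable f P) :
    Integrable (fun x => odds (γ x.2.2) * f x) P :=
  memLp_one_iff_integrable.1 (memLp_odds_mul hγ hb hγb (memLp_one_iff_integrable.2 hf))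

theorem integrable_weightedOutcome (hY : Integrable (fun x : Obs d => x.1) P) :
    Integrable (weightedOutcome γ) P :=
  memLp_one_iff_integrable.1 (memLp_weightedOutcome hγ hb hγb (memLp_one_iff_integrable.2 hY))

end Odds

variable [IsFiniteMeasure P]

theorem integrable_one_sub_propensity_mul {f : Obs d → ℝ} (hf : Integrable f P) :
    Integrable (fun x => (1 - propensity P x.2.2) * f x) P := by
  simp only [sub_mul, one_mul]
  exact hf.sub (integrable_propensity_mul hf)

variable (hμ₀ : Integrable (fun x : Obs d => outcomeReg P x.2.2) P)
include hμ₀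

theorem integral_propensity_mul_outcomeReg (hπ : treatProb P ≠ 0) :
    ∫ x, propensity P x.2.2 * outcomeReg P x.2.2 ∂P = treatProb P * gMean P := by
  rw [treatProb_mul_gMean hπ, integral_treated_mul (measurable_outcomeReg P) hμ₀]

variable (hγ : Measurable γ) (hb : b < 1) (hγb : ∀ᵐ x ∂P, γ x.2.2 ∈ Set.Icc 0 b)
  (hY : Integrable (fun x : Obs d => x.1) P)
include hγ hb hγb hY

theorem integral_weightedOutcome : ∫ x, weightedOutcome γ x ∂P =
    ∫ x, (1 - propensity P x.2.2) * (odds (γ x.2.2) * outcomeReg P x.2.2) ∂P := by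
  have hodds : Measurable fun z => odds (γ z) := measurable_odds.comp hγ
  rw [← integral_control_mul (v := fun z => odds (γ z) * outcomeReg P z)
    (hodds.mul (measurable_outcomeReg P)) (integrable_odds_mul hγ hb hγb hμ₀)]
  simp only [weightedOutcome_eq, ← mul_assoc]
  exact integral_control_mul_outcome hodds
    (by simpa only [← weightedOutcome_eq] using integrable_weightedOutcome hγ hb hγb hY)

variable (hm : Measurable m) (hmi : Integrable (fun x : Obs d => m x.2.2) P)
include hm hmi

theorem integral_score_eq : ∫ x, score m γ x ∂P =
    ∫ x, (1 - propensity P x.2.2) * (odds (γ x.2.2) * outcomeReg P x.2.2) ∂P -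
      ∫ x, (1 - propensity P x.2.2) * (odds (γ x.2.2) * m x.2.2) ∂P +
        ∫ x, propensity P x.2.2 * m x.2.2 ∂P := by
  have hW := integrable_weightedOutcome hγ hb hγb hY
  have hom := integrable_odds_mul hγ hb hγb hmi
  have hcom : Integrable (fun x : Obs d => control x * (odds (γ x.2.2) * m x.2.2)) P :=
    memLp_one_iff_integrable.1 (memLp_control_mul (memLp_one_iff_integrable.2 hom))
  have hdiff : Integrable (fun x => weightedOutcome γ x -
      control x * (odds (γ x.2.2) * m x.2.2)) P := hW.sub hcom
  simp only [score]
  rw [integral_add hdiff (integrable_treated_mul hmi), integral_sub hW hcom,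
    integral_weightedOutcome hμ₀ hγ hb hγb hY, integral_treated_mul hm hmi,
    integral_control_mul (v := fun z => odds (γ z) * m z) ((measurable_odds.comp hγ).mul hm) hom]

theorem integral_score (hπ : treatProb P ≠ 0) : ∫ x, score m γ x ∂P = treatProb P * gMean P -
    ∫ x, (γ x.2.2 - propensity P x.2.2) * (m x.2.2 - outcomeReg P x.2.2) / (1 - γ x.2.2) ∂P := by
  have hgμ₀ := integrable_propensity_mul hμ₀
  have hgm := integrable_propensity_mul hmi
  have hoμ₀ := integrable_one_sub_propensity_mul (integrable_odds_mul hγ hb hγb hμ₀)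
  have hom := integrable_one_sub_propensity_mul (integrable_odds_mul hγ hb hγb hmi)
  rw [integral_score_eq hμ₀ hγ hb hγb hY hm hmi, ← integral_propensity_mul_outcomeReg hμ₀ hπ,
    eq_sub_iff_add_eq', ← eq_sub_iff_add_eq, ← integral_sub' hoμ₀ hom,
    ← integral_add' (hoμ₀.sub hom) hgm, ← integral_sub' hgμ₀ ((hoμ₀.sub hom).add hgm)]
  refine integral_congr_ae ?_
  filter_upwards [hγb] with x hx
  have hne : 1 - γ x.2.2 ≠ 0 := by linarith [hx.2]
  simp only [odds, Pi.sub_apply, Pi.add_apply]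
  field_simp
  ring

end Score

/-! ### Asymptotic linearity -/

/-- Nuisance estimators `m`, `γ` of the outcome regression and the propensity score that satisfy the
regularity conditions for asymptotic linearity. They are indexed by the sample size and the
outcome, so that limits in outer probability are limits along `probFilter Pr`. -/
structure RegularNuisance {d : ℕ} (P : Measure (Obs d)) [IsProbabilityMeasure P] {Ω : Type*}
    [MeasurableSpace Ω] (Pr : Measure Ω) (X : ℕ → Ω → Obs d) (m γ : ℕ × Ω → (Fin d → ℝ) → ℝ)
    (b M : ℝ) : Prop where
  sample : ∀ n, MeasurePreserving (fun ω (i : Fin n) => X i ω) Pr (sampleLaw P n)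
  measurable_m : ∀ p, Measurable (m p)
  measurable_γ : ∀ p, Measurable (γ p)
  donsker_m : ∃ F, IsDonsker P F ∧ ∀ᶠ p in probFilter Pr, (fun x : Obs d => m p x.2.2) ∈ F
  donsker_γ : ∃ F, IsDonsker P F ∧ ∀ᶠ p in probFilter Pr, (fun x : Obs d => γ p x.2.2) ∈ F
  donsker_weighted : ∃ F, IsDonsker P F ∧ ∀ᶠ p in probFilter Pr, weightedOutcome (γ p) ∈ F
  outcome_memLp : MemLp (fun x : Obs d => x.1) 2 P
  treatProb_ne_zero : treatProb P ≠ 0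
  lt_one : b < 1
  propensity_le : ∀ᵐ x ∂P, propensity P x.2.2 ≤ b
  γ_mem : ∀ᶠ p in probFilter Pr, (∀ᵐ x ∂P, γ p x.2.2 ∈ Set.Icc 0 b) ∧
    ∀ i < p.1, γ p (X i p.2).2.2 ∈ Set.Icc 0 b
  m_le : ∀ᶠ p in probFilter Pr, (∀ᵐ x ∂P, |m p x.2.2| ≤ M) ∧
    ∀ i < p.1, |m p (X i p.2).2.2| ≤ M
  tendsto_γ : Tendsto (fun p => eLpNorm (fun x : Obs d => γ p x.2.2 - propensity P x.2.2) 2 P)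
    (probFilter Pr) (𝓝 0)
  tendsto_m : Tendsto (fun p => eLpNorm (fun x : Obs d => m p x.2.2 - outcomeReg P x.2.2) 2 P)
    (probFilter Pr) (𝓝 0)
  product_rate : Tendsto (fun p : ℕ × Ω => √(p.1 : ℝ) *
    ∫ x, (γ p x.2.2 - propensity P x.2.2) * (m p x.2.2 - outcomeReg P x.2.2) /
      (1 - γ p x.2.2) ∂P) (probFilter Pr) (𝓝 0)

/-- The score with the nuisance parameters truncated to their ranges, where products of them are
Lipschitz. The weighted outcome is left alone since it is assumed Donsker as it stands. -/
noncomputable def clipScore {d : ℕ} (b M : ℝ) (m γ : (Fin d → ℝ) → ℝ) (x : Obs d) : ℝ :=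
  weightedOutcome γ x - control x * (odds (clip 0 b (γ x.2.2)) * clip (-M) M (m x.2.2)) +
    treated x * clip (-M) M (m x.2.2)

theorem clip_eq_of_abs_le {M u : ℝ} (h : |u| ≤ M) : clip (-M) M u = u :=
  clip_eq (abs_le.1 h).1 (abs_le.1 h).2

theorem clip_eq_of_mem {b u : ℝ} (h : u ∈ Set.Icc 0 b) : clip 0 b u = u :=
  clip_eq h.1 h.2

theorem clipScore_eq {d : ℕ} {b M : ℝ} {m γ : (Fin d → ℝ) → ℝ} {x : Obs d}
    (hγ : γ x.2.2 ∈ Set.Icc 0 b) (hm : |m x.2.2| ≤ M) : clipScore b M m γ x = score m γ x := by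
  rw [clipScore, score, clip_eq_of_mem hγ, clip_eq_of_abs_le hm]

namespace RegularNuisance

variable {d : ℕ} {P : Measure (Obs d)} [IsProbabilityMeasure P] {Ω : Type*} [MeasurableSpace Ω]
  {Pr : Measure Ω} {X : ℕ → Ω → Obs d} {m γ : ℕ × Ω → (Fin d → ℝ) → ℝ} {b M : ℝ}
  (R : RegularNuisance P Pr X m γ b M)
include R

theorem outcomeReg_le : ∀ᵐ x ∂P, |outcomeReg P x.2.2| ≤ M := by
  have : IsProbabilityMeasure (Pr.map fun ω (i : Fin 0) => X i ω) :=
    (R.sample 0).map_eq ▸ inferInstanceAs (IsProbabilityMeasure (sampleLaw P 0))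
  have : IsProbabilityMeasure Pr := Pr.isProbabilityMeasure_of_map fun ω (i : Fin 0) => X i ω
  exact ae_abs_le_of_tendsto two_ne_zero
    ((measurable_outcomeReg P).comp measurable_covariate).aestronglyMeasurable R.tendsto_m
    (R.m_le.mono fun _ hp => hp.1)

theorem bound_nonneg : 0 ≤ M := by
  obtain ⟨x, hx⟩ := R.outcomeReg_le.exists
  exact (abs_nonneg _).trans hx

theorem propensity_mem : ∀ᵐ x ∂P, propensity P x.2.2 ∈ Set.Icc 0 b :=
  R.propensity_le.mono fun x hx => ⟨propensity_nonneg P x.2.2, hx⟩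

theorem clip_mem_Icc (u : ℝ) : clip 0 b u ∈ Set.Icc 0 b := by
  obtain ⟨x, hx⟩ := R.propensity_mem.exists
  exact ⟨le_clip _ _ _, clip_le (hx.1.trans hx.2) u⟩

theorem memLp_outcomeReg : MemLp (fun x : Obs d => outcomeReg P x.2.2) 2 P :=
  MemLp.of_bound ((measurable_outcomeReg P).comp measurable_covariate).aestronglyMeasurable M
    R.outcomeReg_le

theorem aestronglyMeasurable_γ_sub (p : ℕ × Ω) :
    AEStronglyMeasurable (fun x : Obs d => γ p x.2.2 - propensity P x.2.2) P :=
  (((R.measurable_γ p).comp measurable_covariate).sub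
    ((measurable_propensity P).comp measurable_covariate)).aestronglyMeasurable

theorem stoch_m : StochEquicont P (probFilter Pr) fun p x => m p x.2.2 - outcomeReg P x.2.2 := by
  obtain ⟨F, hF, hmem⟩ := R.donsker_m
  exact hF.stochEquicont (f := fun p x => m p x.2.2) R.memLp_outcomeReg hmem
    (tendsto_integral_sq (fun p => (((R.measurable_m p).comp measurable_covariate).sub
      ((measurable_outcomeReg P).comp measurable_covariate)).aestronglyMeasurable) R.tendsto_m)

theorem stoch_γ : StochEquicont P (probFilter Pr) fun p x => γ p x.2.2 - propensity P x.2.2 := by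
  obtain ⟨F, hF, hmem⟩ := R.donsker_γ
  exact hF.stochEquicont (f := fun p x => γ p x.2.2) (memLp_propensity P) hmem
    (tendsto_integral_sq R.aestronglyMeasurable_γ_sub R.tendsto_γ)

theorem stoch_weighted : StochEquicont P (probFilter Pr) fun p x =>
    weightedOutcome (γ p) x - weightedOutcome (propensity P) x := by
  obtain ⟨F, hF, hmem⟩ := R.donsker_weighted
  refine hF.stochEquicont (memLp_weightedOutcome (measurable_propensity P) R.lt_one
    R.propensity_mem R.outcome_memLp) hmem ?_
  exact tendsto_weightedOutcome R.lt_one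
    (R.γ_mem.mono fun _ hp => hp.1) R.propensity_mem R.outcome_memLp
    (eventually_memLp R.aestronglyMeasurable_γ_sub R.tendsto_γ)
    (tendsto_integral_sq R.aestronglyMeasurable_γ_sub R.tendsto_γ)

theorem stoch_clip_m : StochEquicont P (probFilter Pr) fun p x =>
    clip (-M) M (m p x.2.2) - clip (-M) M (outcomeReg P x.2.2) :=
  R.stoch_m.comp_sub (f := fun p x => m p x.2.2)
    ((measurable_outcomeReg P).comp measurable_covariate) (measurable_clip _ _) zero_le_one
    fun u v => (abs_clip_sub_le _ _ u v).trans_eq (one_mul _).symm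

theorem stoch_clip_γ : StochEquicont P (probFilter Pr) fun p x =>
    clip 0 b (γ p x.2.2) - clip 0 b (propensity P x.2.2) :=
  R.stoch_γ.comp_sub (f := fun p x => γ p x.2.2)
    ((measurable_propensity P).comp measurable_covariate) (measurable_clip _ _) zero_le_one
    fun u v => (abs_clip_sub_le _ _ u v).trans_eq (one_mul _).symm

theorem stoch_odds : StochEquicont P (probFilter Pr) fun p x =>
    odds (clip 0 b (γ p x.2.2)) - odds (clip 0 b (propensity P x.2.2)) := by
  refine R.stoch_γ.comp_sub (f := fun p x => γ p x.2.2) (T := fun u => odds (clip 0 b u))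
    (L := ((1 - b) ^ 2)⁻¹) ((measurable_propensity P).comp measurable_covariate)
    (measurable_odds.comp (measurable_clip _ _)) (by positivity) fun u v => ?_
  refine (abs_odds_sub_le R.lt_one (R.clip_mem_Icc u).2 (R.clip_mem_Icc v).2).trans ?_
  exact mul_le_mul_of_nonneg_left (abs_clip_sub_le _ _ _ _) (by positivity)

theorem stoch_treated : StochEquicont P (probFilter Pr) fun p x =>
    treated x * clip (-M) M (m p x.2.2) - treated x * clip (-M) M (outcomeReg P x.2.2) := by
  simp only [← mul_sub]
  exact R.stoch_clip_m.mul_left measurable_treated abs_treated_le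

theorem stoch_mul_clip_m {T : ℝ → ℝ} (hT : Measurable T) {C : ℝ} (hTC : ∀ u, |T u| ≤ C)
    (h : StochEquicont P (probFilter Pr) fun p x => T (γ p x.2.2) - T (propensity P x.2.2)) :
    StochEquicont P (probFilter Pr) fun p x => T (γ p x.2.2) * clip (-M) M (m p x.2.2) -
      T (propensity P x.2.2) * clip (-M) M (outcomeReg P x.2.2) := by
  have hTmax (u : ℝ) : |T u| ≤ max M C := (hTC u).trans (le_max_right _ _)
  have hmax (u : ℝ) : |clip (-M) M u| ≤ max M C :=
    (abs_clip_le R.bound_nonneg u).trans (le_max_left _ _)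
  exact h.mul_sub (u := fun p x => T (γ p x.2.2)) (v := fun p x => clip (-M) M (m p x.2.2))
    R.stoch_clip_m (hT.comp ((measurable_propensity P).comp measurable_covariate))
    ((measurable_clip _ _).comp ((measurable_outcomeReg P).comp measurable_covariate))
    (R.bound_nonneg.trans (le_max_left _ _)) (fun _ _ => hTmax _) (fun _ _ => hmax _)
    (fun _ => hTmax _) (fun _ => hmax _)

theorem abs_clip_γ_le (u : ℝ) : |clip 0 b u| ≤ b := by
  rw [abs_of_nonneg (R.clip_mem_Icc u).1]
  exact (R.clip_mem_Icc u).2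

theorem stoch_clipScore : StochEquicont P (probFilter Pr) fun p x =>
    clipScore b M (m p) (γ p) x - clipScore b M (outcomeReg P) (propensity P) x := by
  have hodds := (R.stoch_mul_clip_m (T := fun u => odds (clip 0 b u))
    (measurable_odds.comp (measurable_clip _ _))
    (fun u => abs_odds_le R.lt_one (R.clip_mem_Icc u)) R.stoch_odds).mul_left
      (w := fun x => -control x) (C := 1) measurable_control.neg
      fun x => by simpa using abs_control_le x
  convert (R.stoch_weighted.add hodds).add R.stoch_treated using 3 with p x
  simp only [clipScore]
  ring

theorem memLp_score : MemLp (score (outcomeReg P) (propensity P)) 2 P :=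
  GComp.memLp_score (measurable_propensity P) R.lt_one R.propensity_mem R.memLp_outcomeReg
    R.outcome_memLp

theorem integral_score_eq_sub {p : ℕ × Ω} (hγ : ∀ᵐ x ∂P, γ p x.2.2 ∈ Set.Icc 0 b)
    (hm : Integrable (fun x : Obs d => m p x.2.2) P) :
    ∫ x, score (m p) (γ p) x ∂P = treatProb P * gMean P -
      ∫ x, (γ p x.2.2 - propensity P x.2.2) * (m p x.2.2 - outcomeReg P x.2.2) /
        (1 - γ p x.2.2) ∂P :=
  integral_score (R.memLp_outcomeReg.integrable one_le_two) (R.measurable_γ p) R.lt_one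
    hγ (R.outcome_memLp.integrable one_le_two) (R.measurable_m p) hm
    R.treatProb_ne_zero

theorem integral_score_nuisance :
    ∫ x, score (outcomeReg P) (propensity P) x ∂P = treatProb P * gMean P := by
  have hμ₀ := R.memLp_outcomeReg.integrable one_le_two
  simpa using integral_score hμ₀ (measurable_propensity P) R.lt_one R.propensity_mem
    (R.outcome_memLp.integrable one_le_two) (measurable_outcomeReg P) hμ₀ R.treatProb_ne_zero

theorem integral_clipScore_sub {p : ℕ × Ω} (hγ : ∀ᵐ x ∂P, γ p x.2.2 ∈ Set.Icc 0 b)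
    (hm : ∀ᵐ x ∂P, |m p x.2.2| ≤ M) :
    ∫ x, (clipScore b M (m p) (γ p) x -
        clipScore b M (outcomeReg P) (propensity P) x) ∂P =
      -∫ x, (γ p x.2.2 - propensity P x.2.2) * (m p x.2.2 - outcomeReg P x.2.2) /
        (1 - γ p x.2.2) ∂P := by
  have hmp : MemLp (fun x : Obs d => m p x.2.2) 2 P :=
    MemLp.of_bound ((R.measurable_m p).comp measurable_covariate).aestronglyMeasurable M hm
  have hscore := GComp.memLp_score (R.measurable_γ p) R.lt_one hγ hmp
    R.outcome_memLp
  calc ∫ x, (clipScore b M (m p) (γ p) x -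
        clipScore b M (outcomeReg P) (propensity P) x) ∂P
      = ∫ x, (score (m p) (γ p) x - score (outcomeReg P) (propensity P) x) ∂P := by
        refine integral_congr_ae ?_
        filter_upwards [hγ, hm, R.propensity_mem, R.outcomeReg_le] with x h₁ h₂ h₃ h₄
        rw [clipScore_eq h₁ h₂, clipScore_eq h₃ h₄]
    _ = _ := by
        rw [integral_sub (hscore.integrable one_le_two) (R.memLp_score.integrable one_le_two),
          R.integral_score_nuisance, R.integral_score_eq_sub hγ (hmp.integrable one_le_two)]
        ring

theorem tendsto_sqrt_mul_empMean_score_sub : Tendsto (fun p : ℕ × Ω => √(p.1 : ℝ) *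
      (empMean (fun i => X i p.2) p.1 (score (m p) (γ p)) -
        empMean (fun i => X i p.2) p.1 (score (outcomeReg P) (propensity P))))
      (probFilter Pr) (𝓝 0) := by
  have hlim := (R.stoch_clipScore.tendsto R.sample).sub R.product_rate
  rw [sub_zero] at hlim
  refine hlim.congr' ?_
  filter_upwards [R.γ_mem, R.m_le, eventually_forall_sample R.sample R.propensity_mem,
    eventually_forall_sample R.sample R.outcomeReg_le] with p hγ hm hg₀ hμ₀
  have hmean : empMean (fun i => X i p.2) p.1 (fun x => clipScore b M (m p) (γ p) x -
      clipScore b M (outcomeReg P) (propensity P) x) =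
      empMean (fun i => X i p.2) p.1 (score (m p) (γ p)) -
        empMean (fun i => X i p.2) p.1 (score (outcomeReg P) (propensity P)) := by
    rw [← empMean_sub]
    refine empMean_congr fun i hi => ?_
    rw [clipScore_eq (hγ.2 i hi) (hm.2 i hi), clipScore_eq (hg₀ i hi) (hμ₀ i hi)]
  rw [empProc, R.integral_clipScore_sub hγ.1 hm.1, hmean]
  ring

theorem tendsto_piBar : Tendsto (fun p : ℕ × Ω => piBar (fun i => X i p.2) p.1) (probFilter Pr)
    (𝓝 (treatProb P)) := by
  rw [← integral_treated]
  exact tendsto_empMean R.sample (memLp_treated P)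

theorem tendsto_piHat : Tendsto (fun p : ℕ × Ω => piHat (γ p) (fun i => X i p.2) p.1)
    (probFilter Pr) (𝓝 (treatProb P)) := by
  rw [← integral_propensity]
  exact StochEquicont.tendsto_empMean_of_sub R.sample (memLp_propensity P) R.stoch_γ

theorem tendsto_inv_piHat_mul_empMean {f : ℕ × Ω → Obs d → ℝ} {f₀ : Obs d → ℝ}
    (hf₀ : MemLp f₀ 2 P) (hint : ∫ x, f₀ x ∂P = treatProb P * gMean P)
    (hf : StochEquicont P (probFilter Pr) fun p x => f p x - f₀ x) :
    Tendsto (fun p : ℕ × Ω => (piHat (γ p) (fun i => X i p.2) p.1)⁻¹ *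
      empMean (fun i => X i p.2) p.1 (f p)) (probFilter Pr) (𝓝 (gMean P)) := by
  have hlim := (R.tendsto_piHat.inv₀ R.treatProb_ne_zero).mul
    (StochEquicont.tendsto_empMean_of_sub R.sample hf₀ hf)
  rwa [hint, inv_mul_cancel_left₀ R.treatProb_ne_zero] at hlim

theorem tendsto_plugIn : Tendsto (fun p : ℕ × Ω => plugIn (m p) (γ p) (fun i => X i p.2) p.1)
    (probFilter Pr) (𝓝 (gMean P)) := by
  have heq : (fun x : Obs d => clip 0 b (propensity P x.2.2) * clip (-M) M (outcomeReg P x.2.2))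
      =ᵐ[P] fun x => propensity P x.2.2 * outcomeReg P x.2.2 := by
    filter_upwards [R.propensity_mem, R.outcomeReg_le] with x hg hμ
    rw [clip_eq_of_mem hg, clip_eq_of_abs_le hμ]
  have hLp : MemLp (fun x : Obs d => propensity P x.2.2 * outcomeReg P x.2.2) 2 P :=
    R.memLp_outcomeReg.mul' (memLp_top_of_bound
      ((measurable_propensity P).comp measurable_covariate).aestronglyMeasurable 1
      (ae_of_all _ fun x => abs_propensity_le P x.2.2))
  refine (R.tendsto_inv_piHat_mul_empMean ((memLp_congr_ae heq).2 hLp) ?_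
    (R.stoch_mul_clip_m (measurable_clip 0 b) R.abs_clip_γ_le R.stoch_clip_γ)).congr' ?_
  · rw [integral_congr_ae heq, integral_propensity_mul_outcomeReg
      (R.memLp_outcomeReg.integrable one_le_two) R.treatProb_ne_zero]
  · filter_upwards [R.γ_mem, R.m_le] with p hγ hm
    rw [plugIn_eq]
    congr 1
    refine empMean_congr fun i hi => ?_
    rw [clip_eq_of_mem (hγ.2 i hi), clip_eq_of_abs_le (hm.2 i hi)]

theorem tendsto_plugInTreated :
    Tendsto (fun p : ℕ × Ω => plugInTreated (m p) (γ p) (fun i => X i p.2) p.1) (probFilter Pr)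
      (𝓝 (gMean P)) := by
  have heq : (fun x : Obs d => treated x * clip (-M) M (outcomeReg P x.2.2))
      =ᵐ[P] fun x => treated x * outcomeReg P x.2.2 := by
    filter_upwards [R.outcomeReg_le] with x hμ
    rw [clip_eq_of_abs_le hμ]
  refine (R.tendsto_inv_piHat_mul_empMean
    ((memLp_congr_ae heq).2 (memLp_treated_mul R.memLp_outcomeReg)) ?_ R.stoch_treated).congr' ?_
  · rw [integral_congr_ae heq, treatProb_mul_gMean R.treatProb_ne_zero]
  · filter_upwards [R.m_le] with p hm
    rw [plugInTreated_eq]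
    congr 1
    refine empMean_congr fun i hi => ?_
    rw [clip_eq_of_abs_le (hm.2 i hi)]

theorem memLp_score_sub :
    MemLp (fun x => score (outcomeReg P) (propensity P) x - gMean P * treated x) 2 P :=
  R.memLp_score.sub ((memLp_treated P).const_mul _)

theorem integral_score_sub :
    ∫ x, (score (outcomeReg P) (propensity P) x - gMean P * treated x) ∂P = 0 := by
  rw [integral_sub (R.memLp_score.integrable one_le_two)
    (((memLp_treated P).integrable one_le_two).const_mul _), R.integral_score_nuisance,
    integral_const_mul, integral_treated]
  ring

theorem asympLinear_of_tendsto {T : ℕ → Ω → ℝ}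
    (hT : Tendsto (fun p : ℕ × Ω => √(p.1 : ℝ) * (T p.1 p.2 - (gMean P +
      empMean (fun i => X i p.2) p.1 (inflAt P)))) (probFilter Pr) (𝓝 0)) :
    AsympLinear Pr P X T (gMean P) (inflAt P) := by
  have hinfl : inflAt P = fun x => (treatProb P)⁻¹ *
      (score (outcomeReg P) (propensity P) x - gMean P * treated x) := funext (infl_eq _ _ _ _)
  refine ⟨?_, ?_, outerLittleORootN_iff.2 hT⟩
  · rw [hinfl]
    exact R.memLp_score_sub.const_mul _
  · rw [hinfl, integral_const_mul, R.integral_score_sub, mul_zero]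

theorem tendsto_normalized {q : ℕ × Ω → ℝ} (hq : Tendsto q (probFilter Pr) (𝓝 (treatProb P))) :
    Tendsto (fun p : ℕ × Ω => √(p.1 : ℝ) * ((q p)⁻¹ * (empMean (fun i => X i p.2) p.1
      (score (m p) (γ p)) - gMean P * piBar (fun i => X i p.2) p.1) -
        empMean (fun i => X i p.2) p.1 (inflAt P))) (probFilter Pr) (𝓝 0) := by
  have hinv := hq.inv₀ R.treatProb_ne_zero
  have hdiff := hinv.sub_const (treatProb P)⁻¹
  rw [sub_self] at hdiff
  have hlim := (tendsto_empProc_mul R.sample R.memLp_score_sub hdiff).add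
    (R.tendsto_sqrt_mul_empMean_score_sub.mul hinv)
  rw [zero_mul, add_zero] at hlim
  refine hlim.congr fun p => ?_
  rw [empProc, R.integral_score_sub, inflAt, empMean_infl_eq, empMean_sub, empMean_mul, piBar]
  ring

theorem asympLinear_estEq :
    AsympLinear Pr P X (fun n ω => estEq (m (n, ω)) (γ (n, ω)) (fun i => X i ω) n) (gMean P)
      (inflAt P) := by
  refine R.asympLinear_of_tendsto ((R.tendsto_normalized R.tendsto_piBar).congr' ?_)
  filter_upwards [R.tendsto_piBar.eventually_ne R.treatProb_ne_zero] with p hp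
  rw [estEq_eq]
  field_simp
  ring

theorem asympLinear_oneStep {t : ℕ × Ω → ℝ} (ht : Tendsto t (probFilter Pr) (𝓝 (gMean P)))
    (hrate : Tendsto (fun p : ℕ × Ω => √(p.1 : ℝ) *
      ((piHat (γ p) (fun i => X i p.2) p.1 - treatProb P) * (t p - gMean P)))
      (probFilter Pr) (𝓝 0)) :
    AsympLinear Pr P X (fun n ω => t (n, ω) + empMean (fun i => X i ω) n
      (infl (m (n, ω)) (γ (n, ω)) (piHat (γ (n, ω)) (fun i => X i ω) n) (t (n, ω)))) (gMean P)
      (inflAt P) := by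
  have hdiff := ht.sub_const (gMean P)
  rw [sub_self] at hdiff
  have hcorr := (hrate.sub (tendsto_empProc_mul R.sample (memLp_treated P) hdiff)).mul
    (R.tendsto_piHat.inv₀ R.treatProb_ne_zero)
  have hlim := hcorr.add (R.tendsto_normalized R.tendsto_piHat)
  rw [sub_zero, zero_mul, add_zero] at hlim
  refine R.asympLinear_of_tendsto (hlim.congr' ?_)
  filter_upwards [R.tendsto_piHat.eventually_ne R.treatProb_ne_zero] with p hp
  rw [empMean_infl_eq, empProc, integral_treated, piBar]
  field_simp
  ring

end RegularNuisance

end GComp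

theorem proposition8_general {d : ℕ} {P : Measure (Obs d)} [IsProbabilityMeasure P] {Ω : Type*}
    [MeasurableSpace Ω] {Pr : Measure Ω} {X : ℕ → Ω → Obs d} {m γ : ℕ × Ω → (Fin d → ℝ) → ℝ}
    {b M : ℝ} (R : RegularNuisance P Pr X m γ b M) :
    AsympLinear Pr P X (fun n ω => estEq (m (n, ω)) (γ (n, ω)) (fun i => X i ω) n)
      (gMean P) (inflAt P) ∧
    ((OuterLittleORootN Pr fun n ω =>
        (piHat (γ (n, ω)) (fun i => X i ω) n - treatProb P) *
          (plugIn (m (n, ω)) (γ (n, ω)) (fun i => X i ω) n - gMean P)) →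
      AsympLinear Pr P X (fun n ω => oneStep (m (n, ω)) (γ (n, ω)) (fun i => X i ω) n)
        (gMean P) (inflAt P)) ∧
    ((OuterLittleORootN Pr fun n ω =>
        (piHat (γ (n, ω)) (fun i => X i ω) n - treatProb P) *
          (plugInTreated (m (n, ω)) (γ (n, ω)) (fun i => X i ω) n - gMean P)) →
      AsympLinear Pr P X (fun n ω => oneStepTreated (m (n, ω)) (γ (n, ω)) (fun i => X i ω) n)
        (gMean P) (inflAt P)) := by
  refine ⟨R.asympLinear_estEq, fun hrate => ?_, fun hrate => ?_⟩
  · exact R.asympLinear_oneStep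
      (t := fun p => plugIn (m p) (γ p) (fun i => X i p.2) p.1) R.tendsto_plugIn hrate.tendsto
  · simp only [oneStepTreated_eq]
    exact R.asympLinear_oneStep
      (t := fun p => plugInTreated (m p) (γ p) (fun i => X i p.2) p.1)
      R.tendsto_plugInTreated hrate.tendsto

theorem proposition8 {d : ℕ} (P₀ : Measure (Obs d)) [IsProbabilityMeasure P₀]
    -- an IID sample from `P₀`
    {Ω : Type*} [MeasurableSpace Ω] (Pr : Measure Ω) [IsProbabilityMeasure Pr]
    (X : ℕ → Ω → Obs d) (hXmeas : ∀ i, Measurable (X i)) (hXindep : iIndepFun X Pr)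
    (hXlaw : ∀ i, Pr.map (X i) = P₀)
    -- the nuisance estimators `μ_n`, `g_n`: random measurable functions of `z`
    (μ g : ℕ → Ω → (Fin d → ℝ) → ℝ)
    (hμmeas : ∀ n ω, Measurable (μ n ω)) (hgmeas : ∀ n ω, Measurable (g n ω))
    -- Donsker conditions
    (Fμ Fg Fw : Set (Obs d → ℝ))
    (hFμ : IsDonsker P₀ Fμ) (hFg : IsDonsker P₀ Fg) (hFw : IsDonsker P₀ Fw)
    (hμF : WithProbTendstoOne Pr fun n => {ω | (fun x : Obs d => μ n ω x.2.2) ∈ Fμ})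
    (hgF : WithProbTendstoOne Pr fun n => {ω | (fun x : Obs d => g n ω x.2.2) ∈ Fg})
    (hwF : WithProbTendstoOne Pr fun n => {ω | weightedOutcome (g n ω) ∈ Fw})
    -- `E₀(Y²) < ∞`
    (hY : MemLp (fun x : Obs d => x.1) 2 P₀)
    -- boundedness, at almost every `z` and at the observed covariates
    (a b M : ℝ) (ha : 0 < a) (hab : a < b) (hb : b < 1)
    (hg₀ : ∀ᵐ x ∂P₀, propensity P₀ x.2.2 ∈ Set.Ioo a b)
    (hgbd : ∀ n, ∀ᵐ ω ∂Pr, (∀ᵐ x ∂P₀, g n ω x.2.2 ∈ Set.Ioo a b) ∧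
      ∀ i < n, g n ω (X i ω).2.2 ∈ Set.Ioo a b)
    (hμbd : ∀ n, ∀ᵐ ω ∂Pr, (∀ᵐ x ∂P₀, |μ n ω x.2.2| ≤ M) ∧
      ∀ i < n, |μ n ω (X i ω).2.2| ≤ M)
    -- consistency in `L₂(P₀)`
    (hgcons : OuterLittleOOne Pr fun n ω =>
      eLpNorm (fun x : Obs d => g n ω x.2.2 - propensity P₀ x.2.2) 2 P₀)
    (hμcons : OuterLittleOOne Pr fun n ω =>
      eLpNorm (fun x : Obs d => μ n ω x.2.2 - outcomeReg P₀ x.2.2) 2 P₀)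
    -- product rate
    (hprod : OuterLittleORootN Pr fun n ω =>
      ∫ x, (g n ω x.2.2 - propensity P₀ x.2.2) * (μ n ω x.2.2 - outcomeReg P₀ x.2.2) /
        (1 - g n ω x.2.2) ∂P₀) :
    -- the estimating equations-based estimator
    AsympLinear Pr P₀ X (fun n ω => estEq (μ n ω) (g n ω) (fun i => X i ω) n)
      (gMean P₀) (inflAt P₀) ∧
    -- the one-step estimator `ψ_n + ℙ_n φ_n` with `ψ_n = ∫ μ_n g_n π_n⁻¹ dQ_n`
    ((OuterLittleORootN Pr fun n ω =>
        (piHat (g n ω) (fun i => X i ω) n - treatProb P₀) *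
          (plugIn (μ n ω) (g n ω) (fun i => X i ω) n - gMean P₀)) →
      AsympLinear Pr P₀ X (fun n ω => oneStep (μ n ω) (g n ω) (fun i => X i ω) n)
        (gMean P₀) (inflAt P₀)) ∧
    -- the closed-form one-step estimator, for which `ψ_n = n⁻¹ ∑ I(A_i = 1) μ_n(Z_i) / π_n`
    ((OuterLittleORootN Pr fun n ω =>
        (piHat (g n ω) (fun i => X i ω) n - treatProb P₀) *
          (plugInTreated (μ n ω) (g n ω) (fun i => X i ω) n - gMean P₀)) →
      AsympLinear Pr P₀ X (fun n ω => oneStepTreated (μ n ω) (g n ω) (fun i => X i ω) n)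
        (gMean P₀) (inflAt P₀)) := by
  have hIcc : Set.Ioo a b ⊆ Set.Icc 0 b :=
    Set.Ioo_subset_Icc_self.trans (Set.Icc_subset_Icc_left ha.le)
  exact proposition8_general (m := fun p => μ p.1 p.2) (γ := fun p => g p.1 p.2)
    { sample := measurePreserving_sample hXmeas hXindep hXlaw
      measurable_m := fun p => hμmeas p.1 p.2
      measurable_γ := fun p => hgmeas p.1 p.2
      donsker_m := ⟨Fμ, hFμ, hμF.eventually⟩
      donsker_γ := ⟨Fg, hFg, hgF.eventually⟩
      donsker_weighted := ⟨Fw, hFw, hwF.eventually⟩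
      outcome_memLp := hY
      treatProb_ne_zero := (ha.trans_le (le_treatProb (hg₀.mono fun _ hx => hx.1.le))).ne'
      lt_one := hb
      propensity_le := hg₀.mono fun _ hx => hx.2.le
      γ_mem := eventually_probFilter_of_ae fun n => (hgbd n).mono fun _ hω =>
        ⟨hω.1.mono fun _ hx => hIcc hx, fun i hi => hIcc (hω.2 i hi)⟩
      m_le := eventually_probFilter_of_ae hμbd
      tendsto_γ := hgcons.tendsto
      tendsto_m := hμcons.tendsto
      product_rate := hprod.tendsto }
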